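/- Let $0\le m<k<n$ be integers. Let $G$ be the Grassmannian of $k$-dimensional linear subspaces of $\mathbf R^n$ with its $O(n)$-invariant Borel probability measure $dP$, and let $\Gamma=\{(P,x): P\in G,\ x\in P\}$ be the tautological bundle, with the measure $\int_\Gamma f=\int_G\int_P f(P,x)\,dx\,dP$. For $v\in\Lambda^m(\mathbf R^n)$ and $P \in G$, let $v|_P\in\Lambda^m(P)\subset\Lambda^m(\mathbf R^n)$ be the image of $v$ under the adjoint of the inclusion $\Lambda^m(P)\to\Lambda^m(\mathbf R^n)$. The exterior $k$-plane transform of a Schwartz $m$-form $\alpha:\mathbf R^n\to\Lambda^m(\mathbf R^n)$ is $$\mathcal R\alpha(P,x)=\int_{P^\perp}\alpha(x+y)|_P\,dy,\qquad (P,x)\in\Gamma.$$ Let $X$ be the completion of the space of Schwartz $m$-forms under the norm $\|\alpha\|_X^2=\|\alpha\|_{L^2(\mathbf R^n)}^2+\|\mathcal R\alpha\|_{L^2(\Gamma)}^2$, and extend $\alpha\mapsto\alpha\in L^2(\mathbf R^n)$ and $\mathcal R$ by continuity to $X\to L^2(\mathbf R^n)$ and $\mathcal R:X\to L^2(\Gamma)$.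 For $\beta\in L^2(\Gamma)$ put $\mathcal R^*\beta(x)=\int_G\beta(P,x_P)|_P\,dP$, where $x_P$ is the orthogonal projection of $x$ onto $P$. For $\xi\in\mathbf R^n\setminus\{0\}$ let $H_\xi=\xi^\perp$, let $\Pi(\xi)$ be the orthogonal projection of $\Lambda^m(\mathbf R^n)$ onto $\Lambda^m(H_\xi)$, let $\Psi(\xi)=I-\Pi(\xi)$, and let $$h(\xi)=\frac{k\,\mathrm{vol}(\mathbf S^{n-1})\binom{n-1}{m}}{\mathrm{vol}(\mathbf S^{k-1})\binom{k}{m}}\left[\frac{\Pi(\xi)}{k-m}+\frac{\Psi(\xi)}{n-m}\right].$$ Let $\mathcal F f(\xi)=\int e^{-2\pi i x\cdot\xi}f(x)\,dx$ be the Fourier transform, extended to tempered distributions, and let $\mathcal Q$ be the Fourier multiplier $\mathcal Q\gamma=\mathcal F^{-1}\big(|\xi|^{n-k}h(\xi)\mathcal F\gamma(\xi)\big)\in L^2(\mathbf R^n)$, defined for those $\gamma$ for which $\mathcal F\gamma$ is a function such that $|\xi|^{n-k}h(\xi)\mathcal F\gamma(\xi)$ is square integrable. Then for every $\alpha\in X$,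 the form $\mathcal R^*\mathcal R\alpha$ lies in the domain of $\mathcal Q$, and $\alpha=\mathcal Q\mathcal R^*\mathcal R\alpha$ in $L^2(\mathbf R^n)$. -/

import Mathlib

open MeasureTheory Set Filter Topology
open scoped SchwartzMap ENNReal FourierTransform

noncomputable section

namespace KPlane

/-! ### Exterior powers -/

/-- Euclidean space `ℝⁿ`. -/
abbrev Euc (n : ℕ) : Type := EuclideanSpace ℝ (Fin n)

/-- The `m`-th exterior power `Λᵐ(V)` of a finite-dimensional real inner product space `V`. -/
def Lam (m : ℕ) (V : Type*) [NormedAddCommGroup V] [InnerProductSpace ℝ V]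
    [FiniteDimensional ℝ V] : Type _ := ⋀[ℝ]^m V

section Lam

variable {m : ℕ} {V : Type*} [NormedAddCommGroup V] [InnerProductSpace ℝ V]
  [FiniteDimensional ℝ V]

instance : NormedAddCommGroup (Lam m V) := inferInstanceAs (NormedAddCommGroup (⋀[ℝ]^m V))

/-- The usual inner product, given on decomposable elements by the determinant of the matrix of
inner products. -/
instance : InnerProductSpace ℝ (Lam m V) := inferInstanceAs (InnerProductSpace ℝ (⋀[ℝ]^m V))

instance : FiniteDimensional ℝ (Lam m V) := inferInstanceAs (FiniteDimensional ℝ (⋀[ℝ]^m V))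

/-- The wedge product `x₁ ∧ ⋯ ∧ x_m`. -/
def wedge (m : ℕ) (x : Fin m → V) : Lam m V := exteriorPower.ιMulti ℝ m x

theorem inner_wedge (x y : Fin m → V) :
    inner ℝ (wedge m x) (wedge m y) = Matrix.det (Matrix.of fun i j => inner ℝ (x j) (y i)) :=
  exteriorPower.inner_ιMulti_ιMulti x y

theorem lam_ext {W : Type*} [AddCommGroup W] [Module ℝ W] (f g : Lam m V →ₗ[ℝ] W)
    (h : ∀ x, f (wedge m x) = g (wedge m x)) : f = g :=
  exteriorPower.linearMap_ext (M := V) (by ext x; exact h x)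

theorem span_wedge : Submodule.span ℝ (Set.range (wedge m : (Fin m → V) → Lam m V)) = ⊤ :=
  exteriorPower.ιMulti_span ℝ m V

theorem continuous_wedge : Continuous (wedge m : (Fin m → V) → Lam m V) := by
  have key : ∀ v : Lam m V, Continuous fun x : Fin m → V => inner ℝ v (wedge m x) := by
    intro v
    have hv : v ∈ Submodule.span ℝ (Set.range (wedge m : (Fin m → V) → Lam m V)) := by
      rw [span_wedge]; trivial
    induction hv using Submodule.span_induction with
    | mem v hv =>
      obtain ⟨y, rfl⟩ := hv
      simp only [inner_wedge]
      refine Continuous.matrix_det ?_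
      refine continuous_matrix fun i j => ?_
      simp only [Matrix.of_apply]
      fun_prop
    | zero => simpa using continuous_const
    | add v w _ _ hv hw =>
      simp only [inner_add_left]
      exact hv.add hw
    | smul c v _ hv => simpa [inner_smul_left] using hv.const_mul c
  let b := stdOrthonormalBasis ℝ (Lam m V)
  have : (wedge m : (Fin m → V) → Lam m V) = fun x => ∑ i, (inner ℝ (b i) (wedge m x) : ℝ) • b i := by
    ext1 x
    exact (b.sum_repr' _).symm
  rw [this]
  exact continuous_finsetSum _ fun i _ => (key _).smul continuous_const

end Lam

/-- The map `Λᵐ(P) → Λᵐ(ℝⁿ)` induced by the inclusion of a linear subspace `P`. -/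
def incl {n : ℕ} (m : ℕ) (P : Submodule ℝ (Euc n)) : Lam m P →L[ℝ] Lam m (Euc n) :=
  LinearMap.toContinuousLinearMap (exteriorPower.map m P.subtype : Lam m P →ₗ[ℝ] Lam m (Euc n))

/-- The restriction `v|_P` of `v ∈ Λᵐ(ℝⁿ)` to `P`: the image of `v` under the adjoint
`Λᵐ(ℝⁿ) → Λᵐ(P)` of the inclusion, regarded as an element of `Λᵐ(ℝⁿ)`. -/
def restr {n : ℕ} (m : ℕ) (P : Submodule ℝ (Euc n)) : Lam m (Euc n) →L[ℝ] Lam m (Euc n) :=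
  incl m P ∘L ContinuousLinearMap.adjoint (incl m P)

theorem incl_wedge {n m : ℕ} (P : Submodule ℝ (Euc n)) (x : Fin m → P) :
    incl m P (wedge m x) = wedge m fun i => (x i : Euc n) :=
  exteriorPower.map_apply_ιMulti _ _

theorem restr_wedge {n m : ℕ} (P : Submodule ℝ (Euc n)) (x : Fin m → Euc n) :
    restr m P (wedge m x) = wedge m fun i => P.starProjection (x i) := by
  have : ContinuousLinearMap.adjoint (incl m P) (wedge m x) =
      wedge m fun i => P.orthogonalProjectionOnto (x i) := by
    refine ext_inner_right ℝ fun v => ?_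
    rw [ContinuousLinearMap.adjoint_inner_left]
    have h := lam_ext (innerₛₗ ℝ (wedge m x) ∘ₗ (incl m P).toLinearMap)
      (innerₛₗ ℝ (wedge m fun i => P.orthogonalProjectionOnto (x i)))
      (fun y => by simp [incl_wedge, inner_wedge])
    exact LinearMap.congr_fun h v
  rw [restr, ContinuousLinearMap.comp_apply, this, incl_wedge]
  rfl

theorem norm_restr_le {n m : ℕ} (P : Submodule ℝ (Euc n)) (v : Lam m (Euc n)) :
    ‖restr m P v‖ ≤ ‖v‖ := by
  have hidem : restr m P (restr m P v) = restr m P v := by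
    have h := lam_ext ((restr m P).toLinearMap ∘ₗ (restr m P).toLinearMap) (restr m P).toLinearMap
      (fun y => by
        simp only [LinearMap.comp_apply, ContinuousLinearMap.coe_coe, restr_wedge]
        congr 1
        ext1 i
        exact Submodule.starProjection_eq_self_iff.2 (P.starProjection_apply_mem _))
    exact LinearMap.congr_fun h v
  have hsa : ∀ u w, (inner ℝ (restr m P u) w : ℝ) = inner ℝ u (restr m P w) := fun u w => by
    rw [restr, ContinuousLinearMap.comp_apply, ContinuousLinearMap.comp_apply,
      ← ContinuousLinearMap.adjoint_inner_right, ContinuousLinearMap.adjoint_inner_left]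
  have h1 : ‖restr m P v‖ * ‖restr m P v‖ ≤ ‖v‖ * ‖restr m P v‖ := by
    calc ‖restr m P v‖ * ‖restr m P v‖ = inner ℝ (restr m P v) (restr m P v) :=
          (real_inner_self_eq_norm_mul_norm _).symm
      _ = inner ℝ v (restr m P v) := by rw [hsa, hidem]
      _ ≤ _ := real_inner_le_norm _ _
  rcases eq_or_ne ‖restr m P v‖ 0 with h0 | h0
  · rw [h0]; exact norm_nonneg _
  · exact le_of_mul_le_mul_right h1 (lt_of_le_of_ne (norm_nonneg _) h0.symm)

/-! ### The Grassmannian and its invariant measure -/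

/-- Endomorphisms of `ℝⁿ`. -/
abbrev EndE (n : ℕ) : Type := Euc n →L[ℝ] Euc n

/-- The Grassmannian of `k`-dimensional linear subspaces of `ℝⁿ`. -/
@[ext]
structure Gr (n k : ℕ) : Type where
  /-- the underlying linear subspace -/
  plane : Submodule ℝ (Euc n)
  finrank_eq : Module.finrank ℝ plane = k

/-- The usual topology of the Grassmannian: a plane is identified with the orthogonal projection
onto it. -/
instance (n k : ℕ) : TopologicalSpace (Gr n k) :=
  TopologicalSpace.induced (fun P : Gr n k => (P.plane.starProjection : EndE n)) inferInstance

instance (n k : ℕ) : MeasurableSpace (Gr n k) := borel _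

instance (n k : ℕ) : BorelSpace (Gr n k) := ⟨rfl⟩

instance (n k : ℕ) : SecondCountableTopology (Gr n k) :=
  TopologicalSpace.secondCountableTopology_induced _ _ _

theorem continuous_proj (n k : ℕ) : Continuous fun P : Gr n k => (P.plane.starProjection : EndE n) :=
  continuous_induced_dom

theorem continuous_restr (n m k : ℕ) : Continuous fun P : Gr n k => restr m P.plane := by
  refine continuous_clm_apply.2 fun v => ?_
  have hv : v ∈ Submodule.span ℝ (Set.range (wedge m : (Fin m → Euc n) → Lam m (Euc n))) := by
    rw [span_wedge]; trivial
  induction hv using Submodule.span_induction with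
  | mem v hv =>
    obtain ⟨y, rfl⟩ := hv
    simp only [restr_wedge]
    exact continuous_wedge.comp (continuous_pi fun i =>
      (continuous_proj n k).clm_apply continuous_const)
  | zero => simpa using continuous_const
  | add v w _ _ hv hw =>
    simp only [map_add]
    exact hv.add hw
  | smul c v _ hv =>
    simp only [map_smul]
    exact hv.const_smul c

/-- The orthogonal group `O(n)`. -/
abbrev OrthGroup (n : ℕ) : Type := unitary (EndE n)

instance (n : ℕ) : ContinuousStar (EndE n) :=
  ⟨(ContinuousLinearMap.adjoint (𝕜 := ℝ) (E := Euc n) (F := Euc n)).continuous⟩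

instance (n : ℕ) : MeasurableSpace (OrthGroup n) := borel _

instance (n : ℕ) : BorelSpace (OrthGroup n) := ⟨rfl⟩

instance (n : ℕ) : CompactSpace (OrthGroup n) := by
  have : ProperSpace (EndE n) := FiniteDimensional.proper ℝ _
  refine isCompact_iff_compactSpace.mp (Metric.isCompact_of_isClosed_isBounded ?_ ?_)
  · have : ((unitary (EndE n) : Submonoid (EndE n)) : Set (EndE n)) =
        {T | star T * T = 1} ∩ {T | T * star T = 1} := by
      ext T; simp [Unitary.mem_iff]
    rw [this]
    exact (isClosed_eq (by fun_prop) continuous_const).inter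
      (isClosed_eq (by fun_prop) continuous_const)
  · refine (Metric.isBounded_closedBall (x := (0 : EndE n)) (r := 1)).subset fun T hT => ?_
    rw [mem_closedBall_zero_iff]
    refine T.opNorm_le_bound zero_le_one fun x => ?_
    have := (Unitary.linearIsometryEquiv (⟨T, hT⟩ : unitary (EndE n))).norm_map x
    rw [one_mul]
    exact this.le

/-- The action of `O(n)` on the Grassmannian. -/
def rotate {n k : ℕ} (g : OrthGroup n) (P : Gr n k) : Gr n k :=
  ⟨P.plane.map ((Unitary.linearIsometryEquiv g).toLinearEquiv : Euc n →ₗ[ℝ] Euc n),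
    (LinearEquiv.finrank_map_eq _ _).trans P.finrank_eq⟩

/-- The coordinate plane spanned by the first `k` standard basis vectors. -/
def basePlane {n k : ℕ} (h : k ≤ n) : Gr n k :=
  ⟨Submodule.span ℝ (Set.range fun i : Fin k => EuclideanSpace.basisFun (Fin n) ℝ (Fin.castLE h i)),
    by
      rw [finrank_span_eq_card]
      · simp
      · exact (EuclideanSpace.basisFun (Fin n) ℝ).orthonormal.linearIndependent.comp _
          (Fin.castLE_injective h)⟩

/-- The `O(n)`-invariant Borel probability measure on the Grassmannian: the image of the Haar
probability measure of `O(n)` under an orbit map. (If `n < k`, the Grassmannian is empty.) -/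
def grMeasure (n k : ℕ) : Measure (Gr n k) :=
  if h : k ≤ n then
    (Measure.haarMeasure (⊤ : TopologicalSpace.PositiveCompacts (OrthGroup n))).map
      fun g => rotate g (basePlane h)
  else 0

theorem continuous_rotate {n k : ℕ} (P : Gr n k) :
    Continuous fun g : OrthGroup n => rotate g P := by
  refine continuous_induced_rng.2 ?_
  have : (fun g : OrthGroup n => ((rotate g P).plane.starProjection : EndE n)) =
      fun g : OrthGroup n => (g : EndE n) * P.plane.starProjection * star (g : EndE n) := by
    ext1 g
    ext1 x
    exact Submodule.starProjection_map_apply (Unitary.linearIsometryEquiv g) P.plane x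
  change Continuous (fun g : OrthGroup n => ((rotate g P).plane.starProjection : EndE n))
  rw [this]
  fun_prop

instance (n k : ℕ) : IsFiniteMeasure (grMeasure n k) := by
  unfold grMeasure
  split_ifs
  · infer_instance
  · infer_instance

theorem grMeasure_univ {n k : ℕ} (h : k ≤ n) : grMeasure n k univ = 1 := by
  rw [grMeasure, dif_pos h, Measure.map_apply (continuous_rotate _).measurable MeasurableSet.univ]
  exact Measure.haarMeasure_self

theorem map_rotate_grMeasure {n k : ℕ} (g : OrthGroup n) :
    (grMeasure n k).map (rotate g) = grMeasure n k := by
  have hg : Continuous (rotate g : Gr n k → Gr n k) := by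
    refine continuous_induced_rng.2 ?_
    have : (fun P : Gr n k => ((rotate g P).plane.starProjection : EndE n)) =
        fun P : Gr n k => (g : EndE n) * P.plane.starProjection * star (g : EndE n) := by
      ext1 P
      ext1 x
      exact Submodule.starProjection_map_apply (Unitary.linearIsometryEquiv g) P.plane x
    change Continuous (fun P : Gr n k => ((rotate g P).plane.starProjection : EndE n))
    rw [this]
    exact (continuous_const.mul (continuous_proj n k)).mul continuous_const
  unfold grMeasure
  split_ifs with h
  · rw [Measure.map_map hg.measurable (continuous_rotate _).measurable]
    have : (rotate g ∘ fun g' : OrthGroup n => rotate g' (basePlane h)) =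
        (fun g' : OrthGroup n => rotate g' (basePlane h)) ∘ (fun g' => g * g') := by
      ext1 g'
      apply Gr.ext
      simp only [rotate, Function.comp, map_mul]
      rw [← Submodule.map_comp]
      rfl
    rw [this, ← Measure.map_map (continuous_rotate _).measurable (measurable_const_mul g),
      map_mul_left_eq_self]
  · simp

/-! ### The tautological bundle -/

/-- The total space of the tautological bundle over the Grassmannian. -/
structure Taut (n k : ℕ) : Type where
  /-- the plane `P` -/
  base : Gr n k
  /-- the point `x` of `P` -/
  point : Euc n
  mem : point ∈ base.plane

/-- The pair `(P, x)` underlying a point of the tautological bundle. -/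
def Taut.pair {n k : ℕ} (p : Taut n k) : Gr n k × Euc n := (p.base, p.point)

/-- The tautological bundle carries the σ-algebra of a subset of `G × ℝⁿ`. -/
instance (n k : ℕ) : MeasurableSpace (Taut n k) := MeasurableSpace.comap Taut.pair inferInstance

/-- The point `(P, x)` of the tautological bundle, for `x ∈ P`. -/
def Taut.of {n k : ℕ} (P : Gr n k) (x : P.plane) : Taut n k := ⟨P, x, x.2⟩

/-- The measure on the tautological bundle: Lebesgue measure on each fibre, integrated over the
Grassmannian, that is, `∫ f = ∫_G ∫_P f(P, x) dx dP`. -/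
def tautMeasure (n k : ℕ) : Measure (Taut n k) :=
  (grMeasure n k).bind fun P => (volume : Measure P.plane).map (Taut.of P)

theorem measurable_pair (n k : ℕ) : Measurable (Taut.pair : Taut n k → Gr n k × Euc n) :=
  comap_measurable _

theorem measurable_tautOf {n k : ℕ} (P : Gr n k) : Measurable (Taut.of P) :=
  measurable_comap_iff.2 (measurable_const.prodMk measurable_subtype_coe)

/-- Integration over a subspace through a Gaussian weight on the ambient space. -/
theorem volume_subspace {n : ℕ} (K : Submodule ℝ (Euc n)) :
    (volume : Measure K) = (volume.withDensity fun z : Euc n =>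
      ENNReal.ofReal (Real.exp (-Real.pi * ‖z - K.starProjection z‖ ^ 2))).map
        K.orthogonalProjectionOnto := by
  have hw : Measurable fun z : Euc n =>
      ENNReal.ofReal (Real.exp (-Real.pi * ‖z - K.starProjection z‖ ^ 2)) := by fun_prop
  have hw' : Measurable fun y : Kᗮ =>
      ENNReal.ofReal (Real.exp (-Real.pi * ‖y‖ ^ 2)) := by fun_prop
  have hp : Measurable K.orthogonalProjectionOnto :=
    K.orthogonalProjectionOnto.continuous.measurable
  have hmp : MeasurePreserving (fun z : Euc n => WithLp.ofLp (K.orthogonalDecomposition z))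
      volume (volume.prod volume) :=
    (WithLp.volume_preserving_ofLp K Kᗮ).comp K.orthogonalDecomposition.measurePreserving
  ext s hs
  rw [Measure.map_apply hp hs, withDensity_apply _ (hp hs), ← lintegral_indicator (hp hs)]
  have h1 : ∀ z : Euc n, (K.orthogonalProjectionOnto ⁻¹' s).indicator (fun z : Euc n =>
      ENNReal.ofReal (Real.exp (-Real.pi * ‖z - K.starProjection z‖ ^ 2))) z =
      (fun q : K × Kᗮ => s.indicator 1 q.1 * ENNReal.ofReal (Real.exp (-Real.pi * ‖q.2‖ ^ 2)))
        (WithLp.ofLp (K.orthogonalDecomposition z)) := by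
    intro z
    have h2 : z - K.starProjection z = (Kᗮ.orthogonalProjectionOnto z : Euc n) :=
      sub_eq_of_eq_add' (Submodule.starProjection_add_starProjection_orthogonal (K := K) z).symm
    have h3 : ‖z - K.starProjection z‖ = ‖Kᗮ.orthogonalProjectionOnto z‖ := by
      rw [h2]; rfl
    by_cases hz : K.orthogonalProjectionOnto z ∈ s
    · rw [indicator_of_mem (by exact hz), h3]
      change _ = s.indicator 1 (K.orthogonalProjectionOnto z) * _
      rw [indicator_of_mem hz, Pi.one_apply, one_mul, Submodule.orthogonalDecomposition_apply]
    · rw [indicator_of_notMem (by exact hz)]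
      change _ = s.indicator 1 (K.orthogonalProjectionOnto z) * _
      rw [indicator_of_notMem hz, zero_mul]
  rw [lintegral_congr h1]
  have hmeas : Measurable fun q : K × Kᗮ => (s.indicator 1 q.1 : ℝ≥0∞) *
      ENNReal.ofReal (Real.exp (-Real.pi * ‖q.2‖ ^ 2)) :=
    ((measurable_one.indicator hs).comp measurable_fst).mul (hw'.comp measurable_snd)
  rw [hmp.lintegral_comp hmeas, lintegral_prod_mul (measurable_one.indicator hs).aemeasurable
    hw'.aemeasurable, lintegral_indicator_one hs, ← ofReal_integral_eq_lintegral_ofReal]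
  · rw [GaussianFourier.integral_rexp_neg_mul_sq_norm Real.pi_pos]
    simp
  · refine Integrable.of_integral_ne_zero ?_
    rw [GaussianFourier.integral_rexp_neg_mul_sq_norm Real.pi_pos]
    simp
  · exact Eventually.of_forall fun _ => (Real.exp_pos _).le

theorem continuous_proj_apply (n k : ℕ) :
    Continuous fun q : Gr n k × Euc n => q.1.plane.starProjection q.2 :=
  ((continuous_proj n k).comp continuous_fst).clm_apply continuous_snd

theorem measurable_fibre (n k : ℕ) :
    Measurable fun P : Gr n k => (volume : Measure P.plane).map (Taut.of P) := by
  refine Measure.measurable_of_measurable_coe _ fun s hs => ?_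
  obtain ⟨t, ht, rfl⟩ := hs
  have hw : Measurable fun q : Gr n k × Euc n =>
      ENNReal.ofReal (Real.exp (-Real.pi * ‖q.2 - q.1.plane.starProjection q.2‖ ^ 2)) := by
    have := (continuous_proj_apply n k).measurable
    fun_prop
  have hT : Measurable fun q : Gr n k × Euc n => (q.1, q.1.plane.starProjection q.2) :=
    measurable_fst.prodMk (continuous_proj_apply n k).measurable
  have : ∀ P : Gr n k, (volume : Measure P.plane).map (Taut.of P) (Taut.pair ⁻¹' t) =
      ∫⁻ z : Euc n, (((fun q : Gr n k × Euc n => (q.1, q.1.plane.starProjection q.2)) ⁻¹' t).indicator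
        (fun q : Gr n k × Euc n =>
          ENNReal.ofReal (Real.exp (-Real.pi * ‖q.2 - q.1.plane.starProjection q.2‖ ^ 2)))) (P, z) := by
    intro P
    have hst : MeasurableSet (Taut.pair ⁻¹' t : Set (Taut n k)) := ⟨t, ht, rfl⟩
    have hp : Measurable P.plane.orthogonalProjectionOnto :=
      P.plane.orthogonalProjectionOnto.continuous.measurable
    rw [volume_subspace, Measure.map_map (measurable_tautOf P) hp,
      Measure.map_apply ((measurable_tautOf P).comp hp) hst,
      withDensity_apply _ (((measurable_tautOf P).comp hp) hst),
      ← lintegral_indicator (((measurable_tautOf P).comp hp) hst)]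
    rfl
  simp_rw [this]
  exact (hw.indicator (hT ht)).lintegral_prod_right'

theorem lintegral_tautMeasure {n k : ℕ} {f : Taut n k → ℝ≥0∞} (hf : Measurable f) :
    ∫⁻ p, f p ∂(tautMeasure n k) = ∫⁻ P, (∫⁻ x : P.plane, f (Taut.of P x)) ∂(grMeasure n k) := by
  rw [tautMeasure, Measure.lintegral_bind (measurable_fibre n k).aemeasurable hf.aemeasurable]
  exact lintegral_congr fun P => lintegral_map hf (measurable_tautOf P)

/-! ### The exterior `k`-plane transform and its dual -/

/-- The exterior `k`-plane transform `ℛα(P, x) = ∫_{P^⊥} α(x + y)|_P dy`. -/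
def planeTransform {n m k : ℕ} (α : Euc n → Lam m (Euc n)) (p : Taut n k) : Lam m (Euc n) :=
  ∫ y : (p.base.planeᗮ : Submodule ℝ (Euc n)), restr m p.base.plane (α (p.point + (y : Euc n)))

/-- The dual transform `ℛ^*β(x) = ∫_G β(P, x_P)|_P dP`, where `x_P` is the orthogonal projection
of `x` onto `P`. -/
def dualTransform {n m k : ℕ} (β : Taut n k → Lam m (Euc n)) (x : Euc n) : Lam m (Euc n) :=
  ∫ P : Gr n k, restr m P.plane (β (Taut.of P (P.plane.orthogonalProjectionOnto x))) ∂(grMeasure n k)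

theorem integral_orthogonal {n : ℕ} {F : Type*} [NormedAddCommGroup F] [NormedSpace ℝ F]
    (K : Submodule ℝ (Euc n)) (f : Euc n → F) (hf : Continuous f) :
    ∫ y : Kᗮ, f y = ∫ z : Euc n, Real.exp (-Real.pi * ‖K.starProjection z‖ ^ 2) •
      f (z - K.starProjection z) := by
  have hp : Measurable Kᗮ.orthogonalProjectionOnto :=
    Kᗮ.orthogonalProjectionOnto.continuous.measurable
  have h2 : ∀ z, Kᗮ.starProjection z = z - K.starProjection z := fun z =>
    (sub_eq_of_eq_add'
      (Submodule.starProjection_add_starProjection_orthogonal (K := K) z).symm).symm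
  have hc : Continuous fun y : Kᗮ => f y := hf.comp continuous_subtype_val
  rw [volume_subspace Kᗮ, integral_map hp.aemeasurable
    hc.aestronglyMeasurable]
  rw [integral_withDensity_eq_integral_toReal_smul (by fun_prop)
    (Eventually.of_forall fun _ => ENNReal.ofReal_lt_top)]
  refine integral_congr_ae (Eventually.of_forall fun z => ?_)
  simp only
  rw [ENNReal.toReal_ofReal (Real.exp_pos _).le, h2, sub_sub_cancel]
  congr 2
  exact h2 z

theorem stronglyMeasurable_planeTransform {n m k : ℕ} {α : Euc n → Lam m (Euc n)}
    (hα : Continuous α) : StronglyMeasurable (planeTransform α : Taut n k → Lam m (Euc n)) := by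
  have h1 : (planeTransform α : Taut n k → Lam m (Euc n)) =
      (fun q : Gr n k × Euc n => ∫ z : Euc n,
        Real.exp (-Real.pi * ‖q.1.plane.starProjection z‖ ^ 2) •
          restr m q.1.plane (α (q.2 + (z - q.1.plane.starProjection z)))) ∘ Taut.pair := by
    ext1 p
    exact integral_orthogonal p.base.plane (fun y => restr m p.base.plane (α (p.point + y)))
      ((restr m p.base.plane).continuous.comp (hα.comp (continuous_const.add continuous_id)))
  rw [h1]
  refine StronglyMeasurable.comp_measurable ?_ (measurable_pair n k)
  refine StronglyMeasurable.integral_prod_right (f := fun (q : Gr n k × Euc n) (z : Euc n) =>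
    Real.exp (-Real.pi * ‖q.1.plane.starProjection z‖ ^ 2) •
      restr m q.1.plane (α (q.2 + (z - q.1.plane.starProjection z)))) ?_
  have hp : Continuous fun w : (Gr n k × Euc n) × Euc n => w.1.1.plane.starProjection w.2 :=
    (continuous_proj_apply n k).comp
      ((continuous_fst.comp continuous_fst).prodMk continuous_snd)
  have hr : Continuous fun w : (Gr n k × Euc n) × Euc n => restr m w.1.1.plane :=
    (continuous_restr n m k).comp (continuous_fst.comp continuous_fst)
  refine Continuous.stronglyMeasurable ?_
  refine Continuous.smul (Real.continuous_exp.comp (continuous_const.mul (hp.norm.pow 2))) (hr.clm_apply (hα.comp ?_))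
  fun_prop

/-- A weight on a `d`-dimensional space has the same integral for all spaces. -/
theorem weight_integral {V : Type*} [NormedAddCommGroup V] [InnerProductSpace ℝ V]
    [FiniteDimensional ℝ V] [MeasurableSpace V] [BorelSpace V] (f : ℝ → ℝ) :
    ∫ y : V, f ‖y‖ = ∫ y : Euc (Module.finrank ℝ V), f ‖y‖ := by
  rw [← (stdOrthonormalBasis ℝ V).repr.measurePreserving.integral_comp
    (stdOrthonormalBasis ℝ V).repr.toHomeomorph.measurableEmbedding]
  simp

theorem weight_integrable {V : Type*} [NormedAddCommGroup V] [InnerProductSpace ℝ V]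
    [FiniteDimensional ℝ V] [MeasurableSpace V] [BorelSpace V] {n : ℕ}
    (h : Module.finrank ℝ V ≤ n) :
    Integrable fun y : V => ((1 + ‖y‖) ^ (n + 1))⁻¹ := by
  have h1 : (Module.finrank ℝ V : ℝ) < ((n + 1 : ℕ) : ℝ) := by exact_mod_cast Nat.lt_succ_of_le h
  refine (integrable_one_add_norm h1).congr (Eventually.of_forall fun y => ?_)
  simp only
  rw [Real.rpow_neg (by positivity), Real.rpow_natCast]

theorem schwartz_bound {n m : ℕ} (α : 𝓢(Euc n, Lam m (Euc n))) :
    ∃ C : ℝ, 0 ≤ C ∧ ∀ (K : Submodule ℝ (Euc n)) (x : Euc n), x ∈ K → ∀ y : Kᗮ,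
      ‖α (x + y)‖ ≤ C * ((1 + ‖x‖) ^ (n + 1))⁻¹ * ((1 + ‖y‖) ^ (n + 1))⁻¹ := by
  obtain ⟨C, hC⟩ : ∃ C : ℝ, ∀ z, (1 + ‖z‖) ^ (2 * (n + 1)) * ‖α z‖ ≤ C := by
    have h := fun z => SchwartzMap.one_add_le_sup_seminorm_apply (𝕜 := ℝ) (m := (2 * (n + 1), 0))
      (k := 2 * (n + 1)) (n := 0) le_rfl le_rfl α z
    simp only [norm_iteratedFDeriv_zero] at h
    exact ⟨_, h⟩
  refine ⟨C, le_trans (by positivity) (hC 0), fun K x hx y => ?_⟩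
  have hxy : ‖x + y‖ ^ 2 = ‖x‖ ^ 2 + ‖y‖ ^ 2 := by
    have := norm_add_sq_eq_norm_sq_add_norm_sq_of_inner_eq_zero x (y : Euc n) (y.2 x hx)
    simpa [sq] using this
  have hx1 : ‖x‖ ≤ ‖x + y‖ := by
    refine le_of_sq_le_sq ?_ (norm_nonneg _)
    rw [hxy]; nlinarith [sq_nonneg ‖y‖]
  have hy1 : ‖y‖ ≤ ‖x + y‖ := by
    refine le_of_sq_le_sq ?_ (norm_nonneg _)
    rw [hxy]; nlinarith [sq_nonneg ‖x‖]
  have h1 : (1 + ‖x‖) ^ (n + 1) * (1 + ‖y‖) ^ (n + 1) ≤ (1 + ‖x + y‖) ^ (2 * (n + 1)) := by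
    rw [two_mul (n + 1), pow_add _ (n + 1) (n + 1)]
    have hx2 : (1 + ‖x‖) ^ (n + 1) ≤ (1 + ‖x + y‖) ^ (n + 1) :=
      pow_le_pow_left₀ (by positivity) (by linarith) _
    have hy2 : (1 + ‖y‖) ^ (n + 1) ≤ (1 + ‖x + y‖) ^ (n + 1) :=
      pow_le_pow_left₀ (by positivity) (by linarith) _
    exact mul_le_mul hx2 hy2 (by positivity) (by positivity)
  have h2 : (1 + ‖x‖) ^ (n + 1) * (1 + ‖y‖) ^ (n + 1) * ‖α (x + y)‖ ≤ C :=
    le_trans (mul_le_mul_of_nonneg_right h1 (norm_nonneg _)) (hC (x + y))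
  rw [mul_assoc, ← mul_inv, ← div_eq_mul_inv, le_div_iff₀ (by positivity)]
  linarith

theorem integrable_planeTransform {n m k : ℕ} (α : 𝓢(Euc n, Lam m (Euc n))) (p : Taut n k) :
    Integrable fun y : (p.base.planeᗮ : Submodule ℝ (Euc n)) =>
      restr m p.base.plane (α (p.point + (y : Euc n))) := by
  obtain ⟨C, hC0, hC⟩ := schwartz_bound α
  refine ((weight_integrable (n := n) ((Submodule.finrank_le _).trans (by simp))).const_mul
    (C * ((1 + ‖p.point‖) ^ (n + 1))⁻¹)).mono' ?_ (Eventually.of_forall fun y => ?_)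
  · have := α.continuous
    exact Continuous.aestronglyMeasurable (by fun_prop)
  · exact (norm_restr_le _ _).trans (hC _ _ p.mem y)

theorem norm_planeTransform_le {n m k : ℕ} (α : 𝓢(Euc n, Lam m (Euc n))) :
    ∃ C : ℝ, ∀ p : Taut n k, ‖planeTransform α p‖ ≤ C * ((1 + ‖p.point‖) ^ (n + 1))⁻¹ := by
  obtain ⟨C, hC0, hC⟩ := schwartz_bound α
  refine ⟨C * ∫ y : Euc (n - k), ((1 + ‖y‖) ^ (n + 1))⁻¹, fun p => ?_⟩
  have hfin : Module.finrank ℝ (p.base.planeᗮ : Submodule ℝ (Euc n)) = n - k := by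
    have h1 := Submodule.finrank_add_finrank_orthogonal p.base.plane
    have h2 := p.base.finrank_eq
    rw [finrank_euclideanSpace_fin] at h1
    omega
  have hw := weight_integral (V := (p.base.planeᗮ : Submodule ℝ (Euc n)))
    (fun t => ((1 + t) ^ (n + 1))⁻¹)
  rw [hfin] at hw
  rw [← hw]
  rw [mul_right_comm, ← integral_const_mul]
  have hle : Module.finrank ℝ (p.base.planeᗮ : Submodule ℝ (Euc n)) ≤ n :=
    (Submodule.finrank_le _).trans (by simp)
  exact norm_integral_le_of_norm_le ((weight_integrable hle).const_mul _)
    (Eventually.of_forall fun y => (norm_restr_le _ _).trans (hC _ _ p.mem y))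

/-- An integrable weight on the tautological bundle. -/
def weight {n k : ℕ} (p : Taut n k) : ℝ := ((1 + ‖p.point‖) ^ (n + 1))⁻¹

theorem measurable_weight (n k : ℕ) : Measurable (weight : Taut n k → ℝ) := by
  have h : Measurable fun x : Euc n => ((1 + ‖x‖) ^ (n + 1))⁻¹ :=
    ((measurable_const.add measurable_norm).pow_const (n + 1)).inv
  exact h.comp (measurable_snd.comp (measurable_pair n k))

theorem weight_nonneg {n k : ℕ} (p : Taut n k) : 0 ≤ weight p := by
  unfold weight; positivity

theorem weight_le_one {n k : ℕ} (p : Taut n k) : weight p ≤ 1 :=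
  inv_le_one_of_one_le₀ (one_le_pow₀ (by linarith [norm_nonneg p.point]))

theorem lintegral_weight {n k : ℕ} (P : Gr n k) :
    ∫⁻ x : P.plane, ‖weight (Taut.of P x)‖ₑ =
      ENNReal.ofReal (∫ y : Euc k, ((1 + ‖y‖) ^ (n + 1))⁻¹) := by
  have hle : Module.finrank ℝ P.plane ≤ n := (Submodule.finrank_le _).trans (by simp)
  have hw := weight_integral (V := P.plane) (fun t => ((1 + t) ^ (n + 1))⁻¹)
  rw [P.finrank_eq] at hw
  rw [← hw, ofReal_integral_eq_lintegral_ofReal (weight_integrable hle)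
    (Eventually.of_forall fun x => by positivity)]
  refine lintegral_congr fun x => ?_
  rw [Real.enorm_of_nonneg (weight_nonneg _)]
  rfl

theorem integrable_weight (n k : ℕ) : Integrable weight (tautMeasure n k) := by
  refine ⟨(measurable_weight n k).aestronglyMeasurable, ?_⟩
  rw [hasFiniteIntegral_iff_enorm, lintegral_tautMeasure (measurable_weight n k).enorm,
    lintegral_congr lintegral_weight, lintegral_const]
  exact ENNReal.mul_lt_top ENNReal.ofReal_lt_top (measure_lt_top _ _)

theorem memLp_weight (n k : ℕ) : MemLp weight 2 (tautMeasure n k) := by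
  refine (memLp_two_iff_integrable_sq (measurable_weight n k).aestronglyMeasurable).2 ?_
  refine (integrable_weight n k).mono' ((measurable_weight n k).pow_const 2).aestronglyMeasurable
    (Eventually.of_forall fun p => ?_)
  rw [Real.norm_of_nonneg (sq_nonneg _), sq]
  exact mul_le_of_le_one_left (weight_nonneg p) (weight_le_one p)

/-- `ℛα` is square integrable for every Schwartz form `α`. -/
theorem memLp_planeTransform {n m : ℕ} (k : ℕ) (α : 𝓢(Euc n, Lam m (Euc n))) :
    MemLp (planeTransform α) 2 (tautMeasure n k) := by
  obtain ⟨C, hC⟩ := norm_planeTransform_le (k := k) α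
  refine (memLp_weight n k).of_le_mul (c := C)
    (stronglyMeasurable_planeTransform α.continuous).aestronglyMeasurable
    (Eventually.of_forall fun p => ?_)
  rw [Real.norm_of_nonneg (weight_nonneg p)]
  exact hC p

/-! ### The space `X` -/

/-- The space `L²` of square integrable `m`-forms on `ℝⁿ`. -/
abbrev L2Form (n m : ℕ) : Type := Lp (Lam m (Euc n)) 2 (volume : Measure (Euc n))

/-- The space `L²(Γ)` of square integrable maps from the tautological bundle to `Λᵐ(ℝⁿ)`. -/
abbrev L2Taut (n m k : ℕ) : Type := Lp (Lam m (Euc n)) 2 (tautMeasure n k)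

theorem planeTransform_add {n m k : ℕ} (α β : 𝓢(Euc n, Lam m (Euc n))) (p : Taut n k) :
    planeTransform (α + β) p = planeTransform α p + planeTransform β p := by
  unfold planeTransform
  rw [← integral_add (integrable_planeTransform α p) (integrable_planeTransform β p)]
  refine integral_congr_ae (Eventually.of_forall fun y => ?_)
  exact map_add (restr m p.base.plane) _ _

theorem planeTransform_smul {n m k : ℕ} (c : ℝ) (α : 𝓢(Euc n, Lam m (Euc n))) (p : Taut n k) :
    planeTransform (c • α) p = c • planeTransform α p := by
  unfold planeTransform
  rw [← integral_smul]
  refine integral_congr_ae (Eventually.of_forall fun y => ?_)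
  exact map_smul (restr m p.base.plane) _ _

/-- The transform `α ↦ ℛα` from the Schwartz `m`-forms to `L²(Γ)`. -/
def schwartzTransform (n m k : ℕ) : 𝓢(Euc n, Lam m (Euc n)) →ₗ[ℝ] L2Taut n m k where
  toFun α := (memLp_planeTransform k α).toLp (planeTransform α)
  map_add' α β := by
    rw [← MemLp.toLp_add]
    exact MemLp.toLp_congr _ _ (Eventually.of_forall fun p => planeTransform_add α β p)
  map_smul' c α := by
    rw [← MemLp.toLp_const_smul]
    exact MemLp.toLp_congr _ _ (Eventually.of_forall fun p => planeTransform_smul c α p)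

/-- The map `α ↦ (α, ℛα)` from the Schwartz `m`-forms to the Hilbert sum of `L²` and `L²(Γ)`. -/
def graphMap (n m k : ℕ) :
    𝓢(Euc n, Lam m (Euc n)) →ₗ[ℝ] WithLp 2 (L2Form n m × L2Taut n m k) :=
  (WithLp.linearEquiv 2 ℝ (L2Form n m × L2Taut n m k)).symm.toLinearMap ∘ₗ
    LinearMap.prod (SchwartzMap.toLpCLM ℝ (Lam m (Euc n)) 2 volume).toLinearMap
      (schwartzTransform n m k)

/-- The space of Schwartz `m`-forms on `ℝⁿ`, as a copy to be equipped with the norm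
`‖α‖_X = (‖α‖²_{L²(ℝⁿ)} + ‖ℛα‖²_{L²(Γ)})^{1/2}`, which depends on `k`. -/
def SForm (n m _k : ℕ) : Type := 𝓢(Euc n, Lam m (Euc n))

instance (n m k : ℕ) : AddCommGroup (SForm n m k) :=
  inferInstanceAs (AddCommGroup 𝓢(Euc n, Lam m (Euc n)))

instance (n m k : ℕ) : Module ℝ (SForm n m k) :=
  inferInstanceAs (Module ℝ 𝓢(Euc n, Lam m (Euc n)))

/-- The Schwartz form underlying an element of `SForm`. -/
def SForm.toSchwartz (n m k : ℕ) : SForm n m k ≃ₗ[ℝ] 𝓢(Euc n, Lam m (Euc n)) :=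
  LinearEquiv.refl ℝ _

/-- The map `α ↦ (α, ℛα)` on `SForm`. -/
def SForm.graph (n m k : ℕ) : SForm n m k →ₗ[ℝ] WithLp 2 (L2Form n m × L2Taut n m k) :=
  graphMap n m k ∘ₗ (SForm.toSchwartz n m k).toLinearMap

/-- The norm `‖α‖_X`, where `‖α‖_X² = ‖α‖²_{L²} + ‖ℛα‖²_{L²(Γ)}`. -/
instance (n m k : ℕ) : SeminormedAddCommGroup (SForm n m k) :=
  SeminormedAddCommGroup.induced _ _ (SForm.graph n m k)

instance (n m k : ℕ) : NormedSpace ℝ (SForm n m k) :=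
  NormedSpace.induced ℝ (SForm n m k) _ (SForm.graph n m k)

theorem SForm.norm_sq {n m k : ℕ} (α : SForm n m k) :
    ‖α‖ ^ 2 = ‖SchwartzMap.toLp (SForm.toSchwartz n m k α) 2 volume‖ ^ 2 +
      ‖schwartzTransform n m k (SForm.toSchwartz n m k α)‖ ^ 2 :=
  WithLp.prod_norm_sq_eq_of_L2 (SForm.graph n m k α)

/-- The completion `X` of the Schwartz `m`-forms under the norm `‖·‖_X`. -/
abbrev X (n m k : ℕ) : Type := UniformSpace.Completion (SForm n m k)

/-- The isometric map `α ↦ (α, ℛα)`, as a continuous linear map. -/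
def SForm.graphL (n m k : ℕ) : SForm n m k →L[ℝ] WithLp 2 (L2Form n m × L2Taut n m k) :=
  (SForm.graph n m k).mkContinuous 1 fun α => (one_mul ‖α‖).symm ▸ le_refl ‖α‖

/-- The extension by continuity of `α ↦ (α, ℛα)` to `X`. -/
def X.graph (n m k : ℕ) : X n m k →L[ℝ] WithLp 2 (L2Form n m × L2Taut n m k) :=
  (SForm.graphL n m k).extend UniformSpace.Completion.toComplL

theorem X.graph_coe {n m k : ℕ} (α : SForm n m k) :
    X.graph n m k (α : X n m k) = SForm.graph n m k α :=
  (SForm.graphL n m k).extend_eq (UniformSpace.Completion.denseRange_coe)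
    (UniformSpace.Completion.isUniformInducing_coe _) α

/-- The square integrable form underlying an element of `X`: the extension by continuity of
the map that sends a Schwartz form to its class in `L²`. -/
def X.form {n m k : ℕ} (a : X n m k) : L2Form n m := (X.graph n m k a).fst

/-- The exterior `k`-plane transform `ℛ : X → L²(Γ)`, extended by continuity from the Schwartz
forms. -/
def X.transform {n m k : ℕ} (a : X n m k) : L2Taut n m k := (X.graph n m k a).snd

/-! ### The Fourier multiplier -/

/-- The complexification of `Λᵐ(ℝⁿ)`, in coordinates with respect to the orthonormal basis of the
`m`-fold wedge products of the standard basis vectors. -/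
abbrev LamC (n m : ℕ) : Type := EuclideanSpace ℂ (Set.powersetCard (Fin n) m)

/-- The orthonormal basis `e_{i₁} ∧ ⋯ ∧ e_{i_m}`, `i₁ < ⋯ < i_m`, of `Λᵐ(ℝⁿ)`. -/
def lamBasis (n m : ℕ) : OrthonormalBasis (Set.powersetCard (Fin n) m) ℝ (Lam m (Euc n)) :=
  (EuclideanSpace.basisFun (Fin n) ℝ).exteriorPower m

/-- The inclusion of `Λᵐ(ℝⁿ)` into its complexification. -/
def toC (n m : ℕ) : Lam m (Euc n) →L[ℝ] LamC n m :=
  LinearMap.toContinuousLinearMap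
    { toFun := fun v => WithLp.toLp 2 fun s => (((lamBasis n m).repr v s : ℝ) : ℂ)
      map_add' := fun v w => by ext s; simp
      map_smul' := fun c v => by ext s; simp }

/-- The complex-linear extension of an endomorphism of `Λᵐ(ℝⁿ)` to the complexification. -/
def endC {n m : ℕ} (T : Lam m (Euc n) →L[ℝ] Lam m (Euc n)) : LamC n m →ₗ[ℂ] LamC n m :=
  Matrix.toEuclideanLin
    ((LinearMap.toMatrix (lamBasis n m).toBasis (lamBasis n m).toBasis T.toLinearMap).map
      Complex.ofReal)

theorem endC_toC {n m : ℕ} (T : Lam m (Euc n) →L[ℝ] Lam m (Euc n)) (v : Lam m (Euc n)) :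
    endC T (toC n m v) = toC n m (T v) := by
  have h := LinearMap.toMatrix_mulVec_repr (lamBasis n m).toBasis (lamBasis n m).toBasis
    T.toLinearMap v
  ext s
  have hs := congrFun h s
  simp only [Matrix.mulVec, dotProduct, OrthonormalBasis.coe_toBasis_repr_apply,
    ContinuousLinearMap.coe_coe] at hs
  simp only [endC, toC, LinearMap.coe_toContinuousLinearMap', LinearMap.coe_mk, AddHom.coe_mk,
    Matrix.toLpLin_apply, Matrix.mulVec, dotProduct, Matrix.map_apply]
  rw [← hs]
  push_cast
  rfl

/-- The hyperplane `H_ξ` orthogonal to `ξ`. -/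
def hyperplane {n : ℕ} (ξ : Euc n) : Submodule ℝ (Euc n) := (Submodule.span ℝ {ξ})ᗮ

/-- `Λᵐ(H_ξ)` as a subspace of `Λᵐ(ℝⁿ)`. -/
def lamHyperplane {n : ℕ} (m : ℕ) (ξ : Euc n) : Submodule ℝ (Lam m (Euc n)) :=
  LinearMap.range (incl m (hyperplane ξ)).toLinearMap

/-- The orthogonal projection `Π(ξ)` onto `Λᵐ(H_ξ)`. -/
def projPi {n : ℕ} (m : ℕ) (ξ : Euc n) : Lam m (Euc n) →L[ℝ] Lam m (Euc n) :=
  (lamHyperplane m ξ).starProjection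

/-- The orthogonal projection `Ψ(ξ)` onto the orthocomplement of `Λᵐ(H_ξ)`. -/
def projPsi {n : ℕ} (m : ℕ) (ξ : Euc n) : Lam m (Euc n) →L[ℝ] Lam m (Euc n) :=
  (lamHyperplane m ξ)ᗮ.starProjection

/-- The `(d - 1)`-dimensional volume of the unit sphere of `ℝᵈ`. -/
def sphereVol (d : ℕ) : ℝ := (volume : Measure (Euc d)).toSphere.real univ

/-- The symbol
`h(ξ) = k vol(S^{n-1}) C(n-1,m) / (vol(S^{k-1}) C(k,m)) * (Π(ξ)/(k-m) + Ψ(ξ)/(n-m))`. -/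
def symbolH {n : ℕ} (m k : ℕ) (ξ : Euc n) : Lam m (Euc n) →L[ℝ] Lam m (Euc n) :=
  ((k : ℝ) * sphereVol n * ((n - 1).choose m : ℝ) / (sphereVol k * (k.choose m : ℝ))) •
    (((k : ℝ) - m)⁻¹ • projPi m ξ + ((n : ℝ) - m)⁻¹ • projPsi m ξ)

/-- The function `g` is the Fourier transform of the form `γ`, in the sense of tempered
distributions: `∫ γ(x) φ̂(x) dx = ∫ g(ξ) φ(ξ) dξ` for every Schwartz function `φ`, where
`φ̂(x) = ∫ e^{-2πi x·ξ} φ(ξ) dξ`, and all these integrals converge absolutely. -/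
def IsFourierTransform {n m : ℕ} (γ : Euc n → Lam m (Euc n)) (g : Euc n → LamC n m) : Prop :=
  ∀ φ : 𝓢(Euc n, ℂ),
    Integrable (fun x => (𝓕 φ) x • toC n m (γ x)) ∧ Integrable (fun ξ => φ ξ • g ξ) ∧
      ∫ x, (𝓕 φ) x • toC n m (γ x) = ∫ ξ, φ ξ • g ξ

/-- Multiplication of a function of the frequency `ξ` by `|ξ|^{n-k} h(ξ)`. -/
def applySymbol {n m : ℕ} (k : ℕ) (g : Euc n → LamC n m) (ξ : Euc n) : LamC n m :=
  ((‖ξ‖ ^ (n - k) : ℝ) : ℂ) • endC (symbolH m k ξ) (g ξ)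

/-- The domain of the Fourier multiplier `𝒬`: the forms `γ` whose distributional Fourier transform
is a function such that `|ξ|^{n-k} h(ξ) γ̂(ξ)` is square integrable. -/
def InDomQ {n m : ℕ} (k : ℕ) (γ : Euc n → Lam m (Euc n)) : Prop :=
  ∃ g : Euc n → LamC n m, IsFourierTransform γ g ∧ MemLp (applySymbol k g) 2 volume

/-- The Fourier multiplier `𝒬` with symbol `|ξ|^{n-k} h(ξ)`: the inverse Fourier transform of
`|ξ|^{n-k} h(ξ) γ̂(ξ)` in `L²`. (The function `γ̂` is determined by `γ` up to a null set.) -/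
def multiplierQ {n m : ℕ} (k : ℕ) (γ : Euc n → Lam m (Euc n)) (hγ : InDomQ k γ) :
    Lp (LamC n m) 2 (volume : Measure (Euc n)) :=
  𝓕⁻ (hγ.choose_spec.2.toLp (applySymbol k hγ.choose))

end KPlane

namespace KPlane

/-! ### Restriction operators in an adapted basis -/

/-! For a Schwartz form α, integration over the fibres orthogonal to a plane P becomes, after the
Fourier transform on P, restriction of `α̂` to P (`fourier_fibreInt`, the projection-slice theorem).
Parseval's formula on each plane (`integral_fibreInt_mul`) therefore turns the pairing of `ℛ^*ℛα`
with a test function into an integral over Γ of `α̂(ξ)|_P` against the inverse transform of that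
function. Integrating first over the planes through a given ξ leaves an integral over ℝⁿ with the
factor `σ |ξ|^{-(n-k)} M(ξ)`, where `σ = vol(S^{k-1}) / vol(S^{n-1})` and `M(ξ)` is the mean of `v ↦
v|_P` over the planes P through ξ (`meanRestr`, `integral_grassmann`). So `ℛ^*ℛ` is the Fourier
multiplier with this symbol, and inversion amounts to `h(ξ) σ M(ξ) = I` (`symbolH_meanRestr`).

The mean is found by counting. In an orthonormal basis having ξ/|ξ| as its j-th member, restriction
to a coordinate plane keeps or kills each basic wedge `e_I`; counting the k-element index sets that
contain j and I gives one eigenvalue on the range of Π (j not in I) and another on the range of Ψ (j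
in I). The finite mean over coordinate planes may replace the mean over all planes through ξ because
the stabilizer of a basis vector is transitive on the coordinate planes through it and Haar measure
is invariant (`orbitInt_coordPlane_eq`). No disintegration of the measure on Γ is needed.

For a general element of X both sides have to be continuous in the norm of X. The same computation
gives `‖ℛα‖² = σ ∫ |ξ|^{-(n-k)} ⟨α̂, M(ξ) α̂⟩ dξ`. Since m < k, both eigenvalues of M are positive,
so `ℛα` controls `|ξ|^{-(n-k)/2} α̂` in L² (`lintegral_sqrtWeight_fourier_le`). As `|ξ|^{-(n-k)}` is
locally integrable for k > 0, the Cauchy-Schwarz inequality makes the frequency side continuous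
(`lintegral_schwartz_inverseSymbol_le`); a similar bound on Γ handles `ℛ^*`
(`lintegral_schwartz_dual_le`). The limit gives the Fourier transform of `ℛ^*ℛa` for every `a` in X
(`isFourierTransform_dualTransform`). -/

theorem restr_incl {n m : ℕ} (P : Submodule ℝ (Euc n)) (u : Lam m P) :
    restr m P (incl m P u) = incl m P u := by
  have h := lam_ext ((restr m P).toLinearMap ∘ₗ (incl m P).toLinearMap) (incl m P).toLinearMap
    (fun y => by
      simp only [LinearMap.comp_apply, ContinuousLinearMap.coe_coe, incl_wedge, restr_wedge]
      congr 1
      ext1 i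
      exact Submodule.starProjection_eq_self_iff.2 (y i).2)
  exact LinearMap.congr_fun h u

theorem restr_restr {n m : ℕ} (P : Submodule ℝ (Euc n)) (v : Lam m (Euc n)) :
    restr m P (restr m P v) = restr m P v :=
  restr_incl P _

theorem inner_restr_left {n m : ℕ} (P : Submodule ℝ (Euc n)) (u w : Lam m (Euc n)) :
    (inner ℝ (restr m P u) w : ℝ) = inner ℝ u (restr m P w) := by
  rw [restr, ContinuousLinearMap.comp_apply, ContinuousLinearMap.comp_apply,
    ← ContinuousLinearMap.adjoint_inner_right, ContinuousLinearMap.adjoint_inner_left]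

/-- The operator `restr m P` is idempotent and self-adjoint with range Λᵐ(P). Through this Π(ξ) acts
on wedges by projecting each factor to `H_ξ`, exactly like restriction to a k-plane, and the two can
be compared in one basis. -/
theorem starProjection_range_incl {n m : ℕ} (P : Submodule ℝ (Euc n)) :
    (LinearMap.range (incl m P).toLinearMap).starProjection = restr m P := by
  ext1 v
  refine Submodule.eq_starProjection_of_mem_of_inner_eq_zero ⟨_, rfl⟩ ?_
  rintro _ ⟨u, rfl⟩
  rw [inner_sub_left, inner_restr_left]
  change (inner ℝ v (incl m P u) : ℝ) - inner ℝ v (restr m P (incl m P u)) = 0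
  rw [restr_incl, sub_self]

theorem projPi_eq_restr {n : ℕ} (m : ℕ) (ξ : Euc n) : projPi m ξ = restr m (hyperplane ξ) :=
  starProjection_range_incl _

theorem projPsi_apply {n : ℕ} (m : ℕ) (ξ : Euc n) (v : Lam m (Euc n)) :
    projPsi m ξ v = v - projPi m ξ v :=
  (sub_eq_of_eq_add' (Submodule.starProjection_add_starProjection_orthogonal
    (K := lamHyperplane m ξ) v).symm).symm

theorem projPi_projPi {n : ℕ} (m : ℕ) (ξ : Euc n) (v : Lam m (Euc n)) :
    projPi m ξ (projPi m ξ v) = projPi m ξ v := by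
  rw [projPi_eq_restr, restr_restr]

theorem hyperplane_smul {n : ℕ} {r : ℝ} (hr : r ≠ 0) (ξ : Euc n) :
    hyperplane (r • ξ) = hyperplane ξ := by
  rw [hyperplane, hyperplane, Submodule.span_singleton_smul_eq (IsUnit.mk0 r hr)]

theorem projPi_smul {n : ℕ} (m : ℕ) {r : ℝ} (hr : r ≠ 0) (ξ : Euc n) :
    projPi m (r • ξ) = projPi m ξ := by
  rw [projPi_eq_restr, projPi_eq_restr, hyperplane_smul hr]

/-- The orthonormal basis of `Λᵐ(ℝⁿ)` given by the wedge products of an orthonormal basis. -/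
def wedgeBasis {n : ℕ} (m : ℕ) (b : OrthonormalBasis (Fin n) ℝ (Euc n)) :
    OrthonormalBasis (Set.powersetCard (Fin n) m) ℝ (Lam m (Euc n)) :=
  b.exteriorPower m

theorem wedgeBasis_apply {n m : ℕ} (b : OrthonormalBasis (Fin n) ℝ (Euc n))
    (I : Set.powersetCard (Fin n) m) :
    wedgeBasis m b I = wedge m (b ∘ Set.powersetCard.ofFinEmbEquiv.symm I) := by
  change b.exteriorPower m I = _
  rw [← OrthonormalBasis.coe_toBasis, OrthonormalBasis.toBasis_exteriorPower,
    exteriorPower.coe_basis]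
  simp [exteriorPower.ιMulti_family, wedge]

/-- A plane whose projection is diagonal in an orthonormal basis acts diagonally on wedges. -/
theorem restr_wedgeBasis_apply {n m : ℕ} (b : OrthonormalBasis (Fin n) ℝ (Euc n))
    (P : Submodule ℝ (Euc n)) (S : Finset (Fin n))
    (hP : ∀ i, P.starProjection (b i) = if i ∈ S then b i else 0)
    (I : Set.powersetCard (Fin n) m) :
    restr m P (wedgeBasis m b I) =
      if (I : Finset (Fin n)) ⊆ S then wedgeBasis m b I else 0 := by
  rw [wedgeBasis_apply, restr_wedge]
  simp only [Function.comp_apply, hP]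
  have hmem : ∀ i : Fin n, i ∈ (I : Finset (Fin n)) ↔
      i ∈ Set.range (Set.powersetCard.ofFinEmbEquiv.symm I) := fun i =>
    (Set.powersetCard.mem_range_ofFinEmbEquiv_symm_iff_mem I i).symm
  by_cases h : (I : Finset (Fin n)) ⊆ S
  · rw [if_pos h]
    refine congrArg (wedge m : (Fin m → Euc n) → Lam m (Euc n)) (funext fun j => ?_)
    rw [if_pos (h ((hmem _).2 ⟨j, rfl⟩))]
    rfl
  · obtain ⟨i, hi, hiS⟩ := Finset.not_subset.1 h
    obtain ⟨j, rfl⟩ := (hmem i).1 hi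
    rw [if_neg h]
    exact (exteriorPower.ιMulti ℝ m).map_coord_zero j (if_neg hiS)

theorem starProjection_span_image {n : ℕ} (b : OrthonormalBasis (Fin n) ℝ (Euc n))
    (S : Finset (Fin n)) (i : Fin n) :
    (Submodule.span ℝ (b '' S)).starProjection (b i) = if i ∈ S then b i else 0 := by
  split_ifs with h
  · exact Submodule.starProjection_eq_self_iff.2 (Submodule.subset_span ⟨i, h, rfl⟩)
  · refine (Submodule.starProjection_apply_eq_zero_iff _).2 ?_
    rw [Submodule.mem_orthogonal]
    intro u hu
    induction hu using Submodule.span_induction with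
    | mem u hu =>
      obtain ⟨j, hj, rfl⟩ := hu
      exact b.orthonormal.2 fun hij => h (hij ▸ hj)
    | zero => simp
    | add u v _ _ hu hv => rw [inner_add_left, hu, hv, add_zero]
    | smul c u _ hu => rw [inner_smul_left, hu, mul_zero]

theorem starProjection_hyperplane {n : ℕ} (b : OrthonormalBasis (Fin n) ℝ (Euc n))
    (j i : Fin n) :
    (hyperplane (b j)).starProjection (b i) =
      if i ∈ ({j}ᶜ : Finset (Fin n)) then b i else 0 := by
  simp only [Finset.mem_compl, Finset.mem_singleton]
  split_ifs with h
  · subst h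
    refine (Submodule.starProjection_apply_eq_zero_iff _).2 ?_
    exact Submodule.le_orthogonal_orthogonal _ (Submodule.mem_span_singleton_self _)
  · refine Submodule.starProjection_eq_self_iff.2 ?_
    rw [hyperplane, Submodule.mem_orthogonal_singleton_iff_inner_right]
    exact b.orthonormal.2 (Ne.symm h)

/-! ### Rotated coordinate planes and the mean of the restriction operators -/

/-- The image of the standard basis under an orthogonal map. -/
def rotBasis {n : ℕ} (g : OrthGroup n) : OrthonormalBasis (Fin n) ℝ (Euc n) :=
  (EuclideanSpace.basisFun (Fin n) ℝ).map (Unitary.linearIsometryEquiv g)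

theorem rotBasis_apply {n : ℕ} (g : OrthGroup n) (i : Fin n) :
    rotBasis g i = (g : EndE n) (EuclideanSpace.basisFun (Fin n) ℝ i) := by
  rw [rotBasis, OrthonormalBasis.map_apply]
  rfl

/-- The coordinate plane spanned by the standard basis vectors with index in `S`. -/
def coordPlane {n k : ℕ} (S : Set.powersetCard (Fin n) k) : Gr n k :=
  ⟨Submodule.span ℝ (EuclideanSpace.basisFun (Fin n) ℝ '' (S : Finset (Fin n))), by
    rw [Set.image_eq_range, finrank_span_eq_card]
    · exact (Fintype.card_coe _).trans S.2
    · exact (EuclideanSpace.basisFun (Fin n) ℝ).orthonormal.linearIndependent.comp _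
        Subtype.val_injective⟩

theorem plane_rotate_coordPlane {n k : ℕ} (g : OrthGroup n) (S : Set.powersetCard (Fin n) k) :
    (rotate g (coordPlane S)).plane = Submodule.span ℝ (rotBasis g '' (S : Finset (Fin n))) := by
  simp only [rotate, coordPlane]
  rw [Submodule.map_span, ← Set.image_comp]
  rfl

theorem card_filter_powersetCard {n k : ℕ} (J : Finset (Fin n)) (hJ : J.card ≤ k) :
    (Finset.univ.filter fun S : Set.powersetCard (Fin n) k => J ⊆ (S : Finset (Fin n))).card =
      (n - J.card).choose (k - J.card) := by
  have h := Finset.card_filter_powersetCard_subset J Finset.univ k (Finset.subset_univ J) hJ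
  rw [Finset.card_univ, Fintype.card_fin] at h
  rw [← h]
  refine Finset.card_bij (fun S _ => (S : Finset (Fin n))) ?_ ?_ ?_
  · intro S hS
    simpa [Finset.mem_powersetCard] using hS
  · intro S _ T _ hST
    exact Subtype.ext hST
  · intro T hT
    simp only [Finset.mem_filter, Finset.mem_powersetCard] at hT
    exact ⟨⟨T, hT.1.2⟩, by simpa using hT.2, rfl⟩

/-- The index sets of the coordinate planes that contain the `j`-th basis vector. -/
def setsThrough {n : ℕ} (k : ℕ) (j : Fin n) : Finset (Set.powersetCard (Fin n) k) :=
  Finset.univ.filter fun S => j ∈ (S : Finset (Fin n))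

theorem card_setsThrough {n k : ℕ} (hk : 0 < k) (j : Fin n) :
    (setsThrough k j).card = (n - 1).choose (k - 1) := by
  have h := card_filter_powersetCard (n := n) (k := k) {j} (by simpa using Nat.succ_le_of_lt hk)
  simpa [setsThrough] using h

/-- The average of the operators of restriction to the `k`-planes containing `ξ`. -/
def meanRestr {n : ℕ} (m k : ℕ) (ξ : Euc n) : Lam m (Euc n) →L[ℝ] Lam m (Euc n) :=
  (((n - 1).choose (k - 1) : ℝ))⁻¹ •
    (((n - 1 - m).choose (k - 1 - m) : ℝ) • projPi m ξ +
      ((n - m).choose (k - m) : ℝ) • projPsi m ξ)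

/-- All operators involved are diagonal in the wedges of the rotated basis. A wedge `e_I` survives
restriction to the plane of S exactly when I ⊆ S, so the eigenvalue is the number of k-sets
containing I and j: C(n-m, k-m) if j ∈ I, where Ψ is the identity, and C(n-1-m, k-1-m) if j ∉ I,
where Π is. -/
theorem sum_restr_rotate_coordPlane {n m k : ℕ} (hmk : m < k) (hkn : k ≤ n) (g : OrthGroup n)
    (j : Fin n) :
    ∑ S ∈ setsThrough k j,
        restr m (rotate g (coordPlane S)).plane =
      ((n - 1).choose (k - 1) : ℝ) •
        meanRestr m k ((g : EndE n) (EuclideanSpace.basisFun (Fin n) ℝ j)) := by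
  have hc : ((n - 1).choose (k - 1) : ℝ) ≠ 0 :=
    Nat.cast_ne_zero.2 (Nat.choose_pos (by omega)).ne'
  rw [meanRestr, smul_smul, mul_inv_cancel₀ hc, one_smul, setsThrough, ← rotBasis_apply]
  refine ContinuousLinearMap.coe_injective ((wedgeBasis m (rotBasis g)).toBasis.ext fun I => ?_)
  have hI : (I : Finset (Fin n)).card = m := I.2
  change (∑ S ∈ Finset.univ.filter fun S : Set.powersetCard (Fin n) k => j ∈ (S : Finset (Fin n)),
      restr m (rotate g (coordPlane S)).plane) ((wedgeBasis m (rotBasis g)).toBasis I) =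
    (((n - 1 - m).choose (k - 1 - m) : ℝ) • projPi m (rotBasis g j) +
      ((n - m).choose (k - m) : ℝ) • projPsi m (rotBasis g j))
        ((wedgeBasis m (rotBasis g)).toBasis I)
  rw [OrthonormalBasis.coe_toBasis, _root_.sum_apply]
  set v := wedgeBasis m (rotBasis g) I with hv
  have h1 : ∀ S : Set.powersetCard (Fin n) k, restr m (rotate g (coordPlane S)).plane v =
      (if (I : Finset (Fin n)) ⊆ (S : Finset (Fin n)) then (1 : ℝ) else 0) • v := by
    intro S
    rw [plane_rotate_coordPlane, hv, restr_wedgeBasis_apply (rotBasis g) _ S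
      (starProjection_span_image _ _)]
    split_ifs <;> simp
  have h2 : projPi m (rotBasis g j) v =
      (if j ∉ (I : Finset (Fin n)) then (1 : ℝ) else 0) • v := by
    rw [projPi_eq_restr, hv, restr_wedgeBasis_apply (rotBasis g) _ {j}ᶜ
      (starProjection_hyperplane _ _)]
    have h : (I : Finset (Fin n)) ⊆ {j}ᶜ ↔ j ∉ (I : Finset (Fin n)) := by
      rw [Finset.subset_compl_comm, Finset.singleton_subset_iff, Finset.mem_compl]
    simp only [h]
    split_ifs <;> simp
  rw [Finset.sum_congr rfl fun S _ => h1 S, ← Finset.sum_smul, ← Finset.sum_filter,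
    Finset.filter_filter, Finset.sum_const, nsmul_eq_mul, mul_one]
  have h3 : (Finset.univ.filter fun S : Set.powersetCard (Fin n) k =>
      j ∈ (S : Finset (Fin n)) ∧ (I : Finset (Fin n)) ⊆ (S : Finset (Fin n))) =
      Finset.univ.filter fun S : Set.powersetCard (Fin n) k =>
        insert j (I : Finset (Fin n)) ⊆ (S : Finset (Fin n)) := by
    ext S
    simp [Finset.insert_subset_iff]
  rw [h3]
  simp only [_root_.add_apply, _root_.smul_apply, projPsi_apply, h2]
  by_cases hj : j ∈ (I : Finset (Fin n))
  · rw [Finset.insert_eq_of_mem hj, card_filter_powersetCard _ (by omega), hI]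
    simp [hj]
  · rw [card_filter_powersetCard _ (by rw [Finset.card_insert_of_notMem hj]; omega),
      Finset.card_insert_of_notMem hj, hI]
    simp only [hj, not_false_eq_true, if_true, one_smul, sub_self, smul_zero, add_zero]
    rw [Nat.sub_sub, Nat.sub_sub, Nat.add_comm 1 m]

/-! ### The symbol -/

theorem sphereVol_pos {d : ℕ} (hd : 0 < d) : 0 < sphereVol d := by
  rw [sphereVol, Measure.toSphere_real_apply_univ, finrank_euclideanSpace_fin]
  refine mul_pos (Nat.cast_pos.2 hd) (ENNReal.toReal_pos ?_ ?_)
  · exact (Metric.measure_ball_pos volume 0 one_pos).ne'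
  · exact measure_ball_lt_top.ne

/-- Trinomial revision, C(n-1,k-1) C(k-1,m) = C(n-1,m) C(n-1-m,k-1-m), combined with k C(k-1,m) =
(k-m) C(k,m). -/
theorem choose_pi_identity {n m k : ℕ} (hmk : m < k) (hkn : k < n) :
    ((n - 1 - m).choose (k - 1 - m) : ℝ) * (k * (n - 1).choose m) =
      (n - 1).choose (k - 1) * (k.choose m * ((k : ℝ) - m)) := by
  have h1 := Nat.choose_mul (n := n - 1) (k := k - 1) (s := m) (by omega)
  have h2 : k * (k - 1).choose m = k.choose m * (k - m) := by
    obtain ⟨k, rfl⟩ : ∃ j, k = j + 1 := ⟨k - 1, by omega⟩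
    rw [Nat.add_sub_cancel, ← Nat.choose_mul_succ_eq k m, mul_comm]
  have h3 : ((k - m : ℕ) : ℝ) = (k : ℝ) - m := Nat.cast_sub hmk.le
  rw [← h3]
  have h4 : (n - 1 - m).choose (k - 1 - m) * (k * (n - 1).choose m) =
      (n - 1).choose (k - 1) * (k.choose m * (k - m)) := by
    rw [← h2]
    calc _ = k * ((n - 1).choose m * (n - 1 - m).choose (k - 1 - m)) := by ring
      _ = _ := by rw [← h1]; ring
  exact_mod_cast h4

theorem choose_psi_identity {n m k : ℕ} (hmk : m < k) (hkn : k < n) :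
    ((n - m).choose (k - m) : ℝ) * (k * (n - 1).choose m) =
      (n - 1).choose (k - 1) * (k.choose m * ((n : ℝ) - m)) := by
  have h1 := Nat.choose_mul (n := n) (k := k) (s := m) hmk.le
  obtain ⟨n, rfl⟩ : ∃ j, n = j + 1 := ⟨n - 1, by omega⟩
  obtain ⟨k, rfl⟩ : ∃ j, k = j + 1 := ⟨k - 1, by omega⟩
  have h2 := Nat.choose_mul_succ_eq n m
  have h5 := Nat.add_one_mul_choose_eq n k
  have h3 : ((n + 1 - m : ℕ) : ℝ) = ((n + 1 : ℕ) : ℝ) - m := Nat.cast_sub (by omega)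
  rw [← h3]
  simp only [Nat.add_sub_cancel]
  -- After the shift of n, `n + 1` is the dimension. The extra factor lets the absorption identities
  -- `h2` and `h5` apply without division; it is cancelled at the end.
  have h4 : (n + 1) * ((n + 1 - m).choose (k + 1 - m) * ((k + 1) * n.choose m)) =
      (n + 1) * (n.choose k * ((k + 1).choose m * (n + 1 - m))) := by
    calc _ = (k + 1) * (n + 1 - m).choose (k + 1 - m) * (n.choose m * (n + 1)) := by ring
      _ = (k + 1) * (n + 1 - m) * ((n + 1).choose m * (n + 1 - m).choose (k + 1 - m)) := by
        rw [h2]; ring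
      _ = (n + 1 - m) * (k + 1).choose m * ((n + 1).choose (k + 1) * (k + 1)) := by
        rw [← h1]; ring
      _ = _ := by rw [← h5]; ring
  exact_mod_cast Nat.eq_of_mul_eq_mul_left (Nat.succ_pos n) h4

/-- Both operators are scalar on the range of Π(ξ) and on the range of Ψ(ξ), so the claim splits
into two scalar equations, `f1` and `f2`. These are the two binomial identities above, and they
account for the constants in h. -/
theorem symbolH_meanRestr {n m k : ℕ} (hmk : m < k) (hkn : k < n) (ξ : Euc n)
    (v : Lam m (Euc n)) :
    symbolH m k ξ ((sphereVol k / sphereVol n) • meanRestr m k ξ v) = v := by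
  have hk := sphereVol_pos (d := k) (by omega)
  have hn := sphereVol_pos (d := n) (by omega)
  have hc : ((n - 1).choose (k - 1) : ℝ) ≠ 0 :=
    Nat.cast_ne_zero.2 (Nat.choose_pos (by omega)).ne'
  have hkm : (k.choose m : ℝ) ≠ 0 := Nat.cast_ne_zero.2 (Nat.choose_pos hmk.le).ne'
  have hd1 : (k : ℝ) - m ≠ 0 := sub_ne_zero.2 (by exact_mod_cast hmk.ne')
  have hd2 : (n : ℝ) - m ≠ 0 := sub_ne_zero.2 (by exact_mod_cast (hmk.trans hkn).ne')
  have e1 := choose_pi_identity hmk hkn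
  have e2 := choose_psi_identity hmk hkn
  simp only [symbolH, meanRestr, _root_.smul_apply, _root_.add_apply, projPsi_apply, map_smul,
    map_add, map_sub, projPi_projPi, sub_self, smul_zero, add_zero]
  set A : ℝ := ((n - 1 - m).choose (k - 1 - m) : ℝ)
  set B : ℝ := ((n - m).choose (k - m) : ℝ)
  have f1 : (k : ℝ) * sphereVol n * ((n - 1).choose m : ℝ) / (sphereVol k * (k.choose m : ℝ)) *
      (sphereVol k / sphereVol n) * (((n - 1).choose (k - 1) : ℝ))⁻¹ * ((k : ℝ) - m)⁻¹ * A = 1 := by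
    field_simp
    linear_combination e1
  have f2 : (k : ℝ) * sphereVol n * ((n - 1).choose m : ℝ) / (sphereVol k * (k.choose m : ℝ)) *
      (sphereVol k / sphereVol n) * (((n - 1).choose (k - 1) : ℝ))⁻¹ * ((n : ℝ) - m)⁻¹ * B = 1 := by
    field_simp
    linear_combination e2
  set a := (k : ℝ) * sphereVol n * ((n - 1).choose m : ℝ) / (sphereVol k * (k.choose m : ℝ))
  set s := sphereVol k / sphereVol n
  set c := (((n - 1).choose (k - 1) : ℝ))⁻¹
  set w := projPi m ξ v
  have : a • (((k : ℝ) - m)⁻¹ • s • c • A • w + ((n : ℝ) - m)⁻¹ • s • c • B • (v - w)) =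
      (a * s * c * ((k : ℝ) - m)⁻¹ * A) • w + (a * s * c * ((n : ℝ) - m)⁻¹ * B) • (v - w) := by
    module
  rw [f1, f2] at this
  refine Eq.trans ?_ (this.trans (by simp))
  module

theorem norm_projPi_le {n : ℕ} (m : ℕ) (ξ : Euc n) (v : Lam m (Euc n)) : ‖projPi m ξ v‖ ≤ ‖v‖ := by
  rw [projPi_eq_restr]; exact norm_restr_le _ _

theorem norm_meanRestr_le {n : ℕ} (m k : ℕ) :
    ∃ C : ℝ, 0 ≤ C ∧ ∀ (ξ : Euc n) (v : Lam m (Euc n)), ‖meanRestr m k ξ v‖ ≤ C * ‖v‖ := by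
  refine ⟨((n - 1).choose (k - 1) : ℝ)⁻¹ * (((n - 1 - m).choose (k - 1 - m) : ℝ) +
    ((n - m).choose (k - m) : ℝ) * 2), by positivity, fun ξ v => ?_⟩
  simp only [meanRestr, _root_.smul_apply, _root_.add_apply, projPsi_apply]
  rw [norm_smul, Real.norm_of_nonneg (by positivity), mul_assoc]
  refine mul_le_mul_of_nonneg_left ?_ (by positivity)
  refine (norm_add_le _ _).trans ?_
  rw [norm_smul, norm_smul, Real.norm_of_nonneg (by positivity), Real.norm_of_nonneg (by positivity),
    add_mul, mul_assoc]
  have h1 := norm_projPi_le m ξ v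
  have h2 : ‖v - projPi m ξ v‖ ≤ 2 * ‖v‖ := (norm_sub_le _ _).trans (by linarith)
  gcongr

theorem inner_projPi_self {n : ℕ} (m : ℕ) (ξ : Euc n) (v : Lam m (Euc n)) :
    (inner ℝ v (projPi m ξ v) : ℝ) = ‖projPi m ξ v‖ ^ 2 := by
  rw [← real_inner_self_eq_norm_sq, projPi_eq_restr, inner_restr_left, restr_restr]

/-- The two binomial numerators are at least 1 because m < k < n, so the smaller eigenvalue is at
least 1 / C(n-1, k-1). This uniform coercivity is what makes the norm of `ℛα` control a weighted
norm of `α̂`. -/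
theorem le_inner_meanRestr {n m k : ℕ} (hmk : m < k) (hkn : k < n) :
    ∃ c : ℝ, 0 < c ∧ ∀ (ξ : Euc n) (v : Lam m (Euc n)),
      c * ‖v‖ ^ 2 ≤ inner ℝ v (meanRestr m k ξ v) := by
  have hc : (0 : ℝ) < ((n - 1).choose (k - 1) : ℝ) :=
    Nat.cast_pos.2 (Nat.choose_pos (by omega))
  have hA : (1 : ℝ) ≤ ((n - 1 - m).choose (k - 1 - m) : ℝ) :=
    Nat.one_le_cast.2 (Nat.choose_pos (by omega))
  have hB : (1 : ℝ) ≤ ((n - m).choose (k - m) : ℝ) :=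
    Nat.one_le_cast.2 (Nat.choose_pos (by omega))
  refine ⟨((n - 1).choose (k - 1) : ℝ)⁻¹, by positivity, fun ξ v => ?_⟩
  simp only [meanRestr, _root_.smul_apply, _root_.add_apply, projPsi_apply, inner_smul_right,
    inner_add_right, inner_sub_right, inner_projPi_self, real_inner_self_eq_norm_sq]
  refine mul_le_mul_of_nonneg_left ?_ (by positivity)
  have h1 : ‖projPi m ξ v‖ ^ 2 ≤ ‖v‖ ^ 2 :=
    pow_le_pow_left₀ (norm_nonneg _) (norm_projPi_le m ξ v) 2
  nlinarith [sq_nonneg ‖projPi m ξ v‖]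

instance {n m : ℕ} : MeasurableSpace (Lam m (Euc n)) := borel _

instance {n m : ℕ} : BorelSpace (Lam m (Euc n)) := ⟨rfl⟩

theorem measurable_projPi {n : ℕ} (m : ℕ) (v : Lam m (Euc n)) :
    Measurable fun ξ : Euc n => (projPi m ξ v : Lam m (Euc n)) := by

  have hv : v ∈ Submodule.span ℝ (Set.range (wedge m : (Fin m → Euc n) → Lam m (Euc n))) := by
    rw [span_wedge]; trivial
  simp only [projPi_eq_restr]
  induction hv using Submodule.span_induction with
  | mem v hv =>
    obtain ⟨y, rfl⟩ := hv
    simp only [restr_wedge]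
    refine continuous_wedge.measurable.comp (measurable_pi_lambda _ fun i => ?_)
    -- The formula remains valid at ξ = 0, where the hyperplane is the whole space and the
    -- subtracted term vanishes.
    have : ∀ ξ : Euc n, (hyperplane ξ).starProjection (y i) =
        y i - (inner ℝ ξ (y i) / (‖ξ‖ ^ 2 : ℝ) : ℝ) • ξ := by
      intro ξ
      rw [hyperplane, Submodule.starProjection_orthogonal_val, Submodule.starProjection_singleton]
      rfl
    simp only [this]
    fun_prop
  | zero => simp
  | add v w _ _ hv hw =>
    simp only [map_add]
    exact hv.add hw
  | smul c v _ hv =>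
    simp only [map_smul]
    exact hv.const_smul c

/-! ### Complexification -/

theorem toC_apply {n m : ℕ} (v : Lam m (Euc n)) (s : Set.powersetCard (Fin n) m) :
    toC n m v s = ((inner ℝ (lamBasis n m s) v : ℝ) : ℂ) := by
  rw [← OrthonormalBasis.repr_apply_apply]; rfl

theorem toC_lamBasis_repr_symm {n m : ℕ} (x : EuclideanSpace ℝ (Set.powersetCard (Fin n) m))
    (s : Set.powersetCard (Fin n) m) :
    toC n m ((lamBasis n m).repr.symm x) s = (x s : ℂ) := by
  rw [toC_apply, ← OrthonormalBasis.repr_apply_apply, LinearIsometryEquiv.apply_symm_apply]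

theorem exists_eq_toC_add {n m : ℕ} (z : LamC n m) :
    ∃ x y : Lam m (Euc n), z = toC n m x + Complex.I • toC n m y := by
  refine ⟨(lamBasis n m).repr.symm (WithLp.toLp 2 fun s => (z s).re),
    (lamBasis n m).repr.symm (WithLp.toLp 2 fun s => (z s).im), ?_⟩
  ext s
  rw [PiLp.add_apply, PiLp.smul_apply, toC_lamBasis_repr_symm, toC_lamBasis_repr_symm, smul_eq_mul,
    mul_comm]
  exact (Complex.re_add_im (z s)).symm

theorem inner_toC {n m : ℕ} (v w : Lam m (Euc n)) :
    inner ℂ (toC n m v) (toC n m w) = ((inner ℝ v w : ℝ) : ℂ) := by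
  rw [PiLp.inner_apply, ← (lamBasis n m).sum_inner_mul_inner v w]
  push_cast
  refine Finset.sum_congr rfl fun s _ => ?_
  rw [toC_apply, toC_apply, RCLike.inner_apply, Complex.conj_ofReal, mul_comm,
    real_inner_comm v]

/-- The mixed terms are purely imaginary. Together with `exists_eq_toC_add` this reduces norm and
coercivity bounds for a complexified operator to the real ones, with the same constants. -/
theorem re_inner_toC_add {n m : ℕ} (x y x' y' : Lam m (Euc n)) :
    (inner ℂ (toC n m x + Complex.I • toC n m y) (toC n m x' + Complex.I • toC n m y')).re =
      (inner ℝ x x' : ℝ) + inner ℝ y y' := by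
  simp only [inner_add_left, inner_add_right, inner_smul_left, inner_smul_right, inner_toC]
  simp

theorem norm_sq_toC_add {n m : ℕ} (x y : Lam m (Euc n)) :
    ‖toC n m x + Complex.I • toC n m y‖ ^ 2 = ‖x‖ ^ 2 + ‖y‖ ^ 2 := by
  rw [← inner_self_eq_norm_sq (𝕜 := ℂ)]
  refine (re_inner_toC_add x y x y).trans ?_
  rw [real_inner_self_eq_norm_sq, real_inner_self_eq_norm_sq]

theorem norm_toC {n m : ℕ} (v : Lam m (Euc n)) : ‖toC n m v‖ = ‖v‖ := by
  have h := norm_sq_toC_add v 0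
  simp only [map_zero, smul_zero, add_zero, norm_zero, ne_eq, OfNat.ofNat_ne_zero,
    not_false_eq_true, zero_pow] at h
  exact (sq_eq_sq₀ (norm_nonneg _) (norm_nonneg _)).1 h

theorem endC_toC_add {n m : ℕ} (T : Lam m (Euc n) →L[ℝ] Lam m (Euc n)) (x y : Lam m (Euc n)) :
    endC T (toC n m x + Complex.I • toC n m y) = toC n m (T x) + Complex.I • toC n m (T y) := by
  rw [map_add, map_smul, endC_toC, endC_toC]

theorem endC_apply {n m : ℕ} (T : Lam m (Euc n) →L[ℝ] Lam m (Euc n)) (z : LamC n m)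
    (t : Set.powersetCard (Fin n) m) :
    endC T z t = ∑ s, ((inner ℝ (lamBasis n m t) (T (lamBasis n m s)) : ℝ) : ℂ) * z s := by
  simp only [endC, Matrix.toLpLin_apply, Matrix.mulVec, dotProduct, Matrix.map_apply,
    LinearMap.toMatrix_apply, OrthonormalBasis.coe_toBasis, ContinuousLinearMap.coe_coe,
    OrthonormalBasis.coe_toBasis_repr_apply, OrthonormalBasis.repr_apply_apply]

theorem norm_endC_le {n m : ℕ} {T : Lam m (Euc n) →L[ℝ] Lam m (Euc n)} {C : ℝ} (hC : 0 ≤ C)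
    (hT : ∀ v, ‖T v‖ ≤ C * ‖v‖) (z : LamC n m) : ‖endC T z‖ ≤ C * ‖z‖ := by
  obtain ⟨x, y, rfl⟩ := exists_eq_toC_add z
  refine le_of_sq_le_sq ?_ (by positivity)
  rw [endC_toC_add, norm_sq_toC_add, mul_pow, norm_sq_toC_add, mul_add, ← mul_pow, ← mul_pow]
  exact add_le_add (pow_le_pow_left₀ (norm_nonneg _) (hT x) 2)
    (pow_le_pow_left₀ (norm_nonneg _) (hT y) 2)

theorem le_re_inner_endC {n m : ℕ} {T : Lam m (Euc n) →L[ℝ] Lam m (Euc n)} {c : ℝ}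
    (hT : ∀ v, c * ‖v‖ ^ 2 ≤ inner ℝ v (T v)) (z : LamC n m) :
    c * ‖z‖ ^ 2 ≤ (inner ℂ z (endC T z)).re := by
  obtain ⟨x, y, rfl⟩ := exists_eq_toC_add z
  rw [endC_toC_add, norm_sq_toC_add, re_inner_toC_add, mul_add]
  exact add_le_add (hT x) (hT y)

theorem endC_smul {n m : ℕ} (c : ℝ) (T : Lam m (Euc n) →L[ℝ] Lam m (Euc n)) (z : LamC n m) :
    endC (c • T) z = (c : ℂ) • endC T z := by
  ext t
  rw [PiLp.smul_apply, endC_apply, endC_apply, smul_eq_mul, Finset.mul_sum]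
  refine Finset.sum_congr rfl fun s _ => ?_
  rw [_root_.smul_apply, inner_smul_right]
  push_cast
  ring

theorem endC_symbolH_meanRestr {n m k : ℕ} (hmk : m < k) (hkn : k < n) (ξ : Euc n)
    (z : LamC n m) :
    endC (symbolH m k ξ) (((sphereVol k / sphereVol n : ℝ) : ℂ) • endC (meanRestr m k ξ) z) = z := by
  obtain ⟨x, y, rfl⟩ := exists_eq_toC_add z
  rw [← endC_smul, endC_toC_add, endC_toC_add]
  simp only [_root_.smul_apply, symbolH_meanRestr hmk hkn]

/-- Matrix entries of `meanRestr`. -/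
def meanEntry {n m : ℕ} (k : ℕ) (t s : Set.powersetCard (Fin n) m) (ξ : Euc n) : ℝ :=
  inner ℝ (lamBasis n m t) (meanRestr m k ξ (lamBasis n m s))

theorem measurable_meanEntry {n m : ℕ} (k : ℕ) (t s : Set.powersetCard (Fin n) m) :
    Measurable (meanEntry k t s) := by
  have h1 := measurable_projPi m (lamBasis n m s)
  have : (meanEntry k t s : Euc n → ℝ) = fun ξ => inner ℝ (lamBasis n m t)
      ((((n - 1).choose (k - 1) : ℝ))⁻¹ •
        (((n - 1 - m).choose (k - 1 - m) : ℝ) • projPi m ξ (lamBasis n m s) +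
        ((n - m).choose (k - m) : ℝ) • (lamBasis n m s - projPi m ξ (lamBasis n m s)))) := by
    ext1 ξ
    rw [← projPsi_apply]; rfl
  rw [this]
  fun_prop

theorem abs_meanEntry_le {n m : ℕ} (k : ℕ) :
    ∃ C : ℝ, 0 ≤ C ∧ ∀ (t s : Set.powersetCard (Fin n) m) (ξ : Euc n), |meanEntry k t s ξ| ≤ C := by
  obtain ⟨C, hC0, hC⟩ := norm_meanRestr_le (n := n) m k
  refine ⟨C, hC0, fun t s ξ => (abs_real_inner_le_norm _ _).trans ?_⟩
  have := hC ξ (lamBasis n m s)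
  rw [(lamBasis n m).orthonormal.1 t, one_mul]
  rwa [(lamBasis n m).orthonormal.1 s, mul_one] at this

/-- Homogeneity of degree 0 lets the mean be evaluated on the unit sphere in polar coordinates. -/
theorem meanEntry_smul {n m : ℕ} (k : ℕ) (t s : Set.powersetCard (Fin n) m) {r : ℝ} (hr : r ≠ 0)
    (ξ : Euc n) : meanEntry k t s (r • ξ) = meanEntry k t s ξ := by
  rw [meanEntry, meanEntry]
  have h : meanRestr m k (r • ξ) = meanRestr m k ξ := by
    ext1 v
    simp only [meanRestr, _root_.smul_apply, _root_.add_apply, projPsi_apply, projPi_smul m hr]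
  rw [h]

/-- Matrix entries of the operator of restriction to a plane. -/
def restrEntry {n m k : ℕ} (t s : Set.powersetCard (Fin n) m) (P : Gr n k) : ℝ :=
  inner ℝ (lamBasis n m t) (restr m P.plane (lamBasis n m s))

theorem continuous_restrEntry {n m k : ℕ} (t s : Set.powersetCard (Fin n) m) :
    Continuous (restrEntry t s : Gr n k → ℝ) :=
  continuous_const.inner ((continuous_restr n m k).clm_apply continuous_const)

theorem abs_restrEntry_le {n m k : ℕ} (t s : Set.powersetCard (Fin n) m) (P : Gr n k) :
    |restrEntry t s P| ≤ 1 := by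
  refine (abs_real_inner_le_norm _ _).trans ?_
  rw [(lamBasis n m).orthonormal.1 t, one_mul]
  exact (norm_restr_le _ _).trans ((lamBasis n m).orthonormal.1 s).le

theorem sum_restrEntry {n m k : ℕ} (hmk : m < k) (hkn : k ≤ n) (t s : Set.powersetCard (Fin n) m)
    (g : OrthGroup n) (j : Fin n) :
    ∑ S ∈ setsThrough k j, restrEntry t s (rotate g (coordPlane S)) = (setsThrough k j).card *
        meanEntry k t s ((g : EndE n) (EuclideanSpace.basisFun (Fin n) ℝ j)) := by
  have h := sum_restr_rotate_coordPlane hmk hkn g j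
  have h2 := congrArg (fun T : Lam m (Euc n) →L[ℝ] Lam m (Euc n) =>
    (inner ℝ (lamBasis n m t) (T (lamBasis n m s)) : ℝ)) h
  simp only [_root_.sum_apply, inner_sum, _root_.smul_apply, inner_smul_right] at h2
  rw [card_setsThrough (by omega)]
  exact h2

/-! ### Integration over the orthogonal group -/

/-- The Haar probability measure of `O(n)`. -/
def orthMeasure (n : ℕ) : Measure (OrthGroup n) :=
  Measure.haarMeasure (⊤ : TopologicalSpace.PositiveCompacts (OrthGroup n))

instance (n : ℕ) : (orthMeasure n).IsHaarMeasure := by unfold orthMeasure; infer_instance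

instance (n : ℕ) : IsProbabilityMeasure (orthMeasure n) := ⟨Measure.haarMeasure_self⟩

/-- A right translate of Haar probability measure is again a Haar probability measure, and on a
compact group there is only one. -/
instance (n : ℕ) : (orthMeasure n).IsMulRightInvariant where
  map_mul_right_eq_self g := by
    have h1 : IsProbabilityMeasure ((orthMeasure n).map (· * g)) :=
      Measure.isProbabilityMeasure_map (measurable_mul_const g).aemeasurable
    exact Measure.isHaarMeasure_eq_of_isProbabilityMeasure _ _

theorem rotate_mul {n k : ℕ} (g h : OrthGroup n) (P : Gr n k) :
    rotate (g * h) P = rotate g (rotate h P) := by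
  apply Gr.ext
  simp only [rotate, map_mul]
  rw [← Submodule.map_comp]
  rfl

theorem norm_orth_apply {n : ℕ} (g : OrthGroup n) (x : Euc n) : ‖(g : EndE n) x‖ = ‖x‖ :=
  (Unitary.linearIsometryEquiv g).norm_map x

theorem mem_rotate_iff {n k : ℕ} (g : OrthGroup n) (P : Gr n k) (x : Euc n) :
    x ∈ (rotate g P).plane ↔ ∃ y ∈ P.plane, (g : EndE n) y = x :=
  Iff.rfl

theorem rotate_eq_of_forall_mem {n k : ℕ} (g : OrthGroup n) (P Q : Gr n k)
    (h : ∀ x ∈ P.plane, (g : EndE n) x ∈ Q.plane) : rotate g P = Q := by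
  refine Gr.ext (Submodule.eq_of_le_of_finrank_eq ?_ ?_)
  · intro x hx
    obtain ⟨y, hy, rfl⟩ := (mem_rotate_iff g P x).1 hx
    exact h y hy
  · rw [(rotate g P).finrank_eq, Q.finrank_eq]

/-! ### Transitivity of stabilizers and averages over orbits -/

/-- The stabilizer of a plane acts transitively on the vectors of given length of the plane. -/
theorem exists_rotate_eq_self {n k : ℕ} (P : Gr n k) {x y : Euc n} (hx : x ∈ P.plane)
    (hy : y ∈ P.plane) (hxy : ‖x‖ = ‖y‖) :
    ∃ h : OrthGroup n, rotate h P = P ∧ (h : EndE n) x = y := by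
  -- The reflection in the hyperplane orthogonal to x - y exchanges the two vectors, and it
  -- preserves P because x - y lies in P.
  let R : Euc n ≃ₗᵢ[ℝ] Euc n := (Submodule.span ℝ {x - y})ᗮ.reflection
  let h : OrthGroup n := Unitary.linearIsometryEquiv.symm R
  have hh : ∀ z, (h : EndE n) z = R z := fun z => by
    change Unitary.linearIsometryEquiv (Unitary.linearIsometryEquiv.symm R) z = R z
    rw [MulEquiv.apply_symm_apply]
  refine ⟨h, rotate_eq_of_forall_mem _ _ _ fun z hz => ?_, ?_⟩
  · rw [hh]
    change (Submodule.span ℝ {x - y})ᗮ.reflection z ∈ P.plane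
    rw [Submodule.reflection_orthogonal_apply, Submodule.reflection_apply]
    refine P.plane.neg_mem (P.plane.sub_mem (P.plane.smul_of_tower_mem _ ?_) hz)
    have hle : Submodule.span ℝ {x - y} ≤ P.plane :=
      (Submodule.span_singleton_le_iff_mem _ _).2 (P.plane.sub_mem hx hy)
    exact hle (Submodule.starProjection_apply_mem _ _)
  · rw [hh]
    exact Submodule.reflection_sub hxy

theorem exists_orth_apply_eq {n : ℕ} {x y : Euc n} (hxy : ‖x‖ = ‖y‖) :
    ∃ h : OrthGroup n, (h : EndE n) x = y := by
  obtain ⟨h, -, hh⟩ := exists_rotate_eq_self (⟨⊤, rfl⟩ : Gr n _) (Submodule.mem_top (x := x))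
    (Submodule.mem_top (x := y)) hxy
  exact ⟨h, hh⟩

theorem basisFun_mem_coordPlane {n k : ℕ} {S : Set.powersetCard (Fin n) k} {j : Fin n}
    (hj : j ∈ (S : Finset (Fin n))) :
    EuclideanSpace.basisFun (Fin n) ℝ j ∈ (coordPlane S).plane :=
  Submodule.subset_span ⟨j, hj, rfl⟩

/-- The stabilizer of a basis vector permutes the coordinate planes through it transitively. -/
theorem exists_rotate_coordPlane {n k : ℕ} {S T : Set.powersetCard (Fin n) k} {j : Fin n}
    (hS : j ∈ (S : Finset (Fin n))) (hT : j ∈ (T : Finset (Fin n))) :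
    ∃ h : OrthGroup n, rotate h (coordPlane S) = coordPlane T ∧
      (h : EndE n) (EuclideanSpace.basisFun (Fin n) ℝ j) = EuclideanSpace.basisFun (Fin n) ℝ j := by
  have hcard : (S : Finset (Fin n)).card = (T : Finset (Fin n)).card := S.2.trans T.2.symm
  let σ₀ : Equiv.Perm (Fin n) := Equiv.extendSubtype (p := (· ∈ (S : Finset (Fin n))))
    (q := (· ∈ (T : Finset (Fin n)))) (Finset.equivOfCardEq hcard)
  have hσ₀ : ∀ i ∈ (S : Finset (Fin n)), σ₀ i ∈ (T : Finset (Fin n)) := fun i hi =>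
    Equiv.extendSubtype_mem (p := (· ∈ (S : Finset (Fin n))))
      (q := (· ∈ (T : Finset (Fin n)))) (Finset.equivOfCardEq hcard) i hi
  -- The bijection of S onto T need not fix j. Composing with the transposition of `σ₀ j` and j
  -- repairs this, and it still maps S into T since both points lie in T.
  let σ : Equiv.Perm (Fin n) := σ₀.trans (Equiv.swap (σ₀ j) j)
  have hσj : σ j = j := by simp [σ]
  have hσ : ∀ i ∈ (S : Finset (Fin n)), σ i ∈ (T : Finset (Fin n)) := by
    intro i hi
    simp only [σ, Equiv.trans_apply, Equiv.swap_apply_def]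
    split_ifs
    · exact hT
    · exact hσ₀ j hS
    · exact hσ₀ i hi
  let b := EuclideanSpace.basisFun (Fin n) ℝ
  let h : OrthGroup n := Unitary.linearIsometryEquiv.symm (b.equiv b σ)
  have hh : ∀ i, (h : EndE n) (b i) = b (σ i) := fun i => by
    change Unitary.linearIsometryEquiv (Unitary.linearIsometryEquiv.symm (b.equiv b σ)) (b i) = _
    rw [MulEquiv.apply_symm_apply, OrthonormalBasis.equiv_apply_basis]
  refine ⟨h, rotate_eq_of_forall_mem _ _ _ fun x hx => ?_, ?_⟩
  · have hle : (coordPlane S).plane ≤ (coordPlane T).plane.comap (h : EndE n).toLinearMap := by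
      refine Submodule.span_le.2 ?_
      rintro _ ⟨i, hi, rfl⟩
      change (h : EndE n) (b i) ∈ (coordPlane T).plane
      rw [hh]
      exact basisFun_mem_coordPlane (hσ i hi)
    exact hle hx
  · exact (hh j).trans (by rw [hσj])

/-- The average over `O(n)` of `ρ(gP) f(gx)`. -/
def orbitInt {n k : ℕ} (ρ : Gr n k → ℝ) (f : Euc n → ℂ) (P : Gr n k) (x : Euc n) : ℂ :=
  ∫ g, (ρ (rotate g P) : ℂ) * f ((g : EndE n) x) ∂orthMeasure n

/-- Right invariance of Haar measure: the average depends only on the orbit of the pair (P, x). -/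
theorem orbitInt_rotate {n k : ℕ} (ρ : Gr n k → ℝ) (f : Euc n → ℂ) (P : Gr n k) (x : Euc n)
    (h : OrthGroup n) : orbitInt ρ f (rotate h P) ((h : EndE n) x) = orbitInt ρ f P x := by
  rw [orbitInt, orbitInt,
    ← integral_mul_right_eq_self (fun g => (ρ (rotate g P) : ℂ) * f ((g : EndE n) x)) h]
  refine integral_congr_ae (Eventually.of_forall fun g => ?_)
  simp only [rotate_mul]
  rfl

theorem continuous_orth_apply (n : ℕ) :
    Continuous fun q : OrthGroup n × Euc n => (q.1 : EndE n) q.2 :=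
  (continuous_subtype_val.comp continuous_fst).clm_apply continuous_snd

theorem integrable_orbit {n k : ℕ} {ρ : Gr n k → ℝ} (hρ : Continuous ρ) {f : Euc n → ℂ}
    (hf : Continuous f) (P : Gr n k) (x : Euc n) :
    Integrable (fun g => (ρ (rotate g P) : ℂ) * f ((g : EndE n) x)) (orthMeasure n) := by
  refine Continuous.integrable_of_hasCompactSupport ?_ (HasCompactSupport.of_compactSpace _)
  refine Continuous.mul (Complex.continuous_ofReal.comp (hρ.comp (continuous_rotate P))) ?_
  exact hf.comp ((continuous_orth_apply n).comp (continuous_id.prodMk continuous_const))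

/-- The rotations fixing e_j permute the coordinate planes through e_j transitively, so all these
planes have the same orbit average. Summing over them and dividing by their number replaces ρ by its
mean N under the integral sign, with the factor in f untouched. -/
theorem orbitInt_coordPlane_eq {n k : ℕ} {ρ : Gr n k → ℝ} (hρ : Continuous ρ) {N : Euc n → ℝ}
    {j : Fin n}
    (hN : ∀ g : OrthGroup n, ∑ S ∈ setsThrough k j, ρ (rotate g (coordPlane S)) =
      (setsThrough k j).card * N ((g : EndE n) (EuclideanSpace.basisFun (Fin n) ℝ j)))
    {f : Euc n → ℂ} (hf : Continuous f) {S : Set.powersetCard (Fin n) k}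
    (hS : j ∈ (S : Finset (Fin n))) (r : ℝ) :
    orbitInt ρ f (coordPlane S) (r • EuclideanSpace.basisFun (Fin n) ℝ j) =
      ∫ g, (N ((g : EndE n) (EuclideanSpace.basisFun (Fin n) ℝ j)) : ℂ) *
        f ((g : EndE n) (r • EuclideanSpace.basisFun (Fin n) ℝ j)) ∂orthMeasure n := by
  set e := EuclideanSpace.basisFun (Fin n) ℝ j
  have hSm : S ∈ setsThrough k j := by simpa [setsThrough] using hS
  have hc : ((setsThrough k j).card : ℂ) ≠ 0 :=
    Nat.cast_ne_zero.2 (Finset.card_pos.2 ⟨S, hSm⟩).ne'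
  refine mul_left_cancel₀ hc ?_
  have h1 : ∀ T ∈ setsThrough k j,
      orbitInt ρ f (coordPlane T) (r • e) = orbitInt ρ f (coordPlane S) (r • e) := by
    intro T hT
    obtain ⟨h, h1, h2⟩ := exists_rotate_coordPlane (S := S) (T := T) hS
      (by simpa [setsThrough] using hT)
    have h3 := orbitInt_rotate ρ f (coordPlane S) (r • e) h
    rwa [h1, map_smul, h2] at h3
  have h2 := Finset.sum_congr rfl h1
  rw [Finset.sum_const, nsmul_eq_mul] at h2
  rw [← h2]
  simp only [orbitInt]
  rw [← integral_finsetSum _ fun T _ => integrable_orbit hρ hf _ _, ← integral_const_mul]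
  refine integral_congr_ae (Eventually.of_forall fun g => ?_)
  simp only
  rw [← Finset.sum_mul, ← mul_assoc]
  congr 1
  exact_mod_cast hN g

/-! ### Polar coordinates on the tautological bundle -/

/-- Choosing an orthonormal basis reduces to ℝᵈ, where the area of the unit sphere is d times the
volume of the unit ball. -/
theorem integral_fun_norm {V : Type*} [NormedAddCommGroup V] [InnerProductSpace ℝ V]
    [FiniteDimensional ℝ V] [MeasurableSpace V] [BorelSpace V] {d : ℕ} (hd : 0 < d)
    (hV : Module.finrank ℝ V = d) (F : ℝ → ℂ) :
    ∫ x : V, F ‖x‖ = (sphereVol d : ℂ) * ∫ r in Ioi (0 : ℝ), r ^ (d - 1) • F r := by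
  subst hV
  have : Nonempty (Fin (Module.finrank ℝ V)) := ⟨⟨0, hd⟩⟩
  have h1 : ∫ x : V, F ‖x‖ = ∫ y : Euc (Module.finrank ℝ V), F ‖y‖ := by
    rw [← (stdOrthonormalBasis ℝ V).repr.measurePreserving.integral_comp
      (stdOrthonormalBasis ℝ V).repr.toHomeomorph.measurableEmbedding]
    simp
  rw [h1, integral_fun_norm_addHaar, sphereVol, Measure.toSphere_real_apply_univ,
    finrank_euclideanSpace_fin, nsmul_eq_mul, Complex.real_smul, ← mul_assoc]
  push_cast
  rfl

/-- In polar coordinates the singular factor turns the radial density r^{n-1} into r^{k-1}, so the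
question is the integrability of the nonsingular weight on ℝᵏ. The hypothesis k > 0 keeps the
singularity at the origin integrable. -/
theorem integrable_singular_weight {n k : ℕ} (hk : 0 < k) (hkn : k ≤ n) :
    Integrable fun ξ : Euc n => (‖ξ‖ ^ (n - k))⁻¹ * ((1 + ‖ξ‖) ^ (n + 1))⁻¹ := by
  have : Nonempty (Fin n) := ⟨⟨0, by omega⟩⟩
  have : Nonempty (Fin k) := ⟨⟨0, hk⟩⟩
  have h1 : Integrable fun y : Euc k => ((1 + ‖y‖) ^ (n + 1))⁻¹ :=
    weight_integrable (by simpa using hkn)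
  have h2 := (integrable_fun_norm_addHaar (volume : Measure (Euc k))
    (f := fun t : ℝ => ((1 + t) ^ (n + 1))⁻¹)).1 h1
  refine (integrable_fun_norm_addHaar (volume : Measure (Euc n))
    (f := fun t : ℝ => (t ^ (n - k))⁻¹ * ((1 + t) ^ (n + 1))⁻¹)).2 ?_
  refine h2.congr_fun (fun t ht => ?_) measurableSet_Ioi
  have ht' : (t : ℝ) ≠ 0 := (mem_Ioi.1 ht).ne'
  simp only [finrank_euclideanSpace_fin, smul_eq_mul]
  rw [← mul_assoc]
  congr 1
  rw [eq_mul_inv_iff_mul_eq₀ (pow_ne_zero _ ht'), ← pow_add]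
  congr 1
  omega

theorem basePlane_eq_coordPlane {n k : ℕ} (hk : 0 < k) (hkn : k ≤ n) :
    ∃ S : Set.powersetCard (Fin n) k, (⟨0, hk.trans_le hkn⟩ : Fin n) ∈ (S : Finset (Fin n)) ∧
      basePlane hkn = coordPlane S := by
  refine ⟨⟨Finset.univ.map (Fin.castLEEmb hkn), by simp [Set.powersetCard]⟩, ?_, ?_⟩
  · exact Finset.mem_map.2 ⟨⟨0, hk⟩, Finset.mem_univ _, rfl⟩
  · refine Gr.ext ?_
    simp only [basePlane, coordPlane]
    congr 1
    rw [Finset.coe_map, ← Set.image_comp, Finset.coe_univ, Set.image_univ]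
    rfl

/-- The Gaussian in the orthogonal variable has total mass 1. The domain of integration no longer
depends on the plane, which makes measurability in P accessible. -/
theorem integral_plane_eq {n : ℕ} (K : Submodule ℝ (Euc n)) {f : Euc n → ℂ} (hf : Continuous f) :
    ∫ x : K, f x = ∫ z : Euc n, Real.exp (-Real.pi * ‖z - K.starProjection z‖ ^ 2) •
      f (K.starProjection z) := by
  have hp : Measurable K.orthogonalProjectionOnto :=
    K.orthogonalProjectionOnto.continuous.measurable
  have hc : Continuous fun y : K => f y := hf.comp continuous_subtype_val
  conv_lhs => rw [volume_subspace K]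
  rw [integral_map hp.aemeasurable hc.aestronglyMeasurable,
    integral_withDensity_eq_integral_toReal_smul (by fun_prop)
    (Eventually.of_forall fun _ => ENNReal.ofReal_lt_top)]
  refine integral_congr_ae (Eventually.of_forall fun z => ?_)
  simp only
  rw [ENNReal.toReal_ofReal (Real.exp_pos _).le]
  rfl

theorem stronglyMeasurable_integral_plane {n k : ℕ} {f : Euc n → ℂ} (hf : Continuous f) :
    StronglyMeasurable fun P : Gr n k => ∫ x : P.plane, f x := by
  simp only [integral_plane_eq _ hf]
  refine StronglyMeasurable.integral_prod_right (f := fun (P : Gr n k) (z : Euc n) =>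
    Real.exp (-Real.pi * ‖z - P.plane.starProjection z‖ ^ 2) • f (P.plane.starProjection z)) ?_
  have hp := continuous_proj_apply n k
  refine Continuous.stronglyMeasurable ?_
  refine Continuous.smul (Real.continuous_exp.comp (continuous_const.mul
    ((continuous_snd.sub hp).norm.pow 2))) (hf.comp hp)

theorem integral_rotate_plane {n k : ℕ} (g : OrthGroup n) (P : Gr n k) (f : Euc n → ℂ) :
    ∫ x : (rotate g P).plane, f x = ∫ x : P.plane, f ((g : EndE n) x) := by
  let e : P.plane ≃ₗᵢ[ℝ] (rotate g P).plane :=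
    LinearIsometryEquiv.submoduleMap P.plane (Unitary.linearIsometryEquiv g)
  rw [← e.measurePreserving.integral_comp e.toHomeomorph.measurableEmbedding]
  rfl

theorem measurePreserving_orth {n : ℕ} (g : OrthGroup n) :
    MeasurePreserving (fun x : Euc n => (g : EndE n) x) volume volume :=
  (Unitary.linearIsometryEquiv g).measurePreserving

theorem integral_comp_orth {n : ℕ} (g : OrthGroup n) (w : Euc n → ℂ) :
    ∫ x, w ((g : EndE n) x) = ∫ x, w x :=
  (measurePreserving_orth g).integral_comp
    (Unitary.linearIsometryEquiv g).toHomeomorph.measurableEmbedding w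

/-- Rapid decay of a function on `ℝⁿ`, sufficient for all integrals over planes to converge. -/
def Decays {n : ℕ} (f : Euc n → ℂ) : Prop :=
  Continuous f ∧ ∃ C : ℝ, 0 ≤ C ∧ ∀ x, ‖f x‖ ≤ C * ((1 + ‖x‖) ^ (n + 1))⁻¹

/-- Pulling the measure back to O(n) and exchanging integrals gives an orbit average at each point x
of the base plane. The stabilizer of the plane is transitive on vectors of equal length, so this
average is a function of ‖x‖ and the radial formula in dimension k applies. -/
theorem integral_grMeasure_plane {n k : ℕ} (hk : 0 < k) (hkn : k ≤ n) {ρ : Gr n k → ℝ}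
    (hρ : Continuous ρ) {Cρ : ℝ} (hCρ : ∀ P, |ρ P| ≤ Cρ) {f : Euc n → ℂ} (hf : Decays f) :
    ∫ P, (ρ P : ℂ) * (∫ x : P.plane, f x) ∂grMeasure n k =
      (sphereVol k : ℂ) * ∫ r in Ioi (0 : ℝ), r ^ (k - 1) • orbitInt ρ f (basePlane hkn)
        (r • EuclideanSpace.basisFun (Fin n) ℝ ⟨0, hk.trans_le hkn⟩) := by
  obtain ⟨hfc, C, hC0, hC⟩ := hf
  set e := EuclideanSpace.basisFun (Fin n) ℝ ⟨0, hk.trans_le hkn⟩ with he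
  have he1 : ‖e‖ = 1 := (EuclideanSpace.basisFun (Fin n) ℝ).orthonormal.1 _
  have heP : e ∈ (basePlane hkn).plane := by
    obtain ⟨S, hS, hSP⟩ := basePlane_eq_coordPlane hk hkn
    rw [hSP]
    exact basisFun_mem_coordPlane hS
  have hgr : grMeasure n k = (orthMeasure n).map fun g => rotate g (basePlane hkn) := by
    rw [grMeasure, dif_pos hkn]; rfl
  have hsm : StronglyMeasurable fun P : Gr n k => (ρ P : ℂ) * ∫ x : P.plane, f x :=
    (Complex.continuous_ofReal.comp hρ).stronglyMeasurable.mul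
      (stronglyMeasurable_integral_plane hfc)
  rw [hgr, integral_map (continuous_rotate _).measurable.aemeasurable hsm.aestronglyMeasurable]
  rw [← integral_fun_norm hk (basePlane hkn).finrank_eq
    (fun r => orbitInt ρ f (basePlane hkn) (r • e))]
  simp only [integral_rotate_plane, ← integral_const_mul]
  have hcont : Continuous fun q : OrthGroup n × (basePlane hkn : Gr n k).plane =>
      (ρ (rotate q.1 (basePlane hkn)) : ℂ) * f ((q.1 : EndE n) q.2) := by
    refine Continuous.mul (Complex.continuous_ofReal.comp
      (hρ.comp ((continuous_rotate _).comp continuous_fst))) ?_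
    exact hfc.comp ((continuous_orth_apply n).comp
      (continuous_fst.prodMk (continuous_subtype_val.comp continuous_snd)))
  have hw : Integrable fun x : (basePlane hkn : Gr n k).plane => ((1 + ‖x‖) ^ (n + 1))⁻¹ :=
    weight_integrable ((Submodule.finrank_le _).trans (by simp))
  rw [integral_integral_swap]
  · refine integral_congr_ae (Eventually.of_forall fun x => ?_)
    obtain ⟨h, h1, h2⟩ := exists_rotate_eq_self (basePlane hkn) x.2
      ((basePlane hkn).plane.smul_mem ‖x‖ heP) (by rw [norm_smul, he1]; simp)
    have h3 := orbitInt_rotate ρ f (basePlane hkn) x h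
    rw [h1, h2] at h3
    exact h3.symm
  -- Rotations preserve norms, so one weight on the base plane dominates the integrand for all g;
  -- this justifies the exchange of integrals.
  · refine ((hw.const_mul (Cρ * C)).comp_snd (orthMeasure n)).mono'
      hcont.aestronglyMeasurable (Eventually.of_forall fun q => ?_)
    rw [Function.uncurry_def, norm_mul, mul_assoc, Complex.norm_real, Real.norm_eq_abs]
    refine mul_le_mul (hCρ _) ((hC _).trans_eq ?_) (norm_nonneg _)
      ((abs_nonneg _).trans (hCρ (basePlane hkn)))
    rw [norm_orth_apply]; rfl

/-- Averaging over O(n) does not change an integral over ℝⁿ, and it makes the integrand radial since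
O(n) is transitive on spheres. The density r^{n-1} r^{-(n-k)} = r^{k-1} then matches the one found
on a k-plane. -/
theorem integral_singular_orbit {n k : ℕ} (hk : 0 < k) (hkn : k ≤ n) {N : Euc n → ℝ}
    (hNm : Measurable N) {CN : ℝ} (hCN : ∀ ξ, |N ξ| ≤ CN)
    (hNs : ∀ (r : ℝ) (ξ : Euc n), 0 < r → N (r • ξ) = N ξ) {f : Euc n → ℂ} (hf : Decays f) :
    Integrable (fun ξ : Euc n => ((‖ξ‖ ^ (n - k))⁻¹ : ℝ) * ((N ξ : ℂ) * f ξ)) ∧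
    ∫ ξ : Euc n, (((‖ξ‖ ^ (n - k))⁻¹ : ℝ) : ℂ) * ((N ξ : ℂ) * f ξ) =
      (sphereVol n : ℂ) * ∫ r in Ioi (0 : ℝ), r ^ (k - 1) •
        ∫ g, (N ((g : EndE n) (EuclideanSpace.basisFun (Fin n) ℝ ⟨0, hk.trans_le hkn⟩)) : ℂ) *
          f ((g : EndE n) (r • EuclideanSpace.basisFun (Fin n) ℝ ⟨0, hk.trans_le hkn⟩))
          ∂orthMeasure n := by
  obtain ⟨hfc, C, hC0, hC⟩ := hf
  set e := EuclideanSpace.basisFun (Fin n) ℝ ⟨0, hk.trans_le hkn⟩ with he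
  have he1 : ‖e‖ = 1 := (EuclideanSpace.basisFun (Fin n) ℝ).orthonormal.1 _
  have hwm : Measurable fun ξ : Euc n => (((‖ξ‖ ^ (n - k))⁻¹ : ℝ) : ℂ) * ((N ξ : ℂ) * f ξ) := by
    have := hfc.measurable
    fun_prop
  have hbd : ∀ ξ : Euc n, ‖(((‖ξ‖ ^ (n - k))⁻¹ : ℝ) : ℂ) * ((N ξ : ℂ) * f ξ)‖ ≤
      CN * C * ((‖ξ‖ ^ (n - k))⁻¹ * ((1 + ‖ξ‖) ^ (n + 1))⁻¹) := by
    intro ξ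
    rw [norm_mul, norm_mul, Complex.norm_real, Complex.norm_real, Real.norm_eq_abs,
      Real.norm_eq_abs, abs_of_nonneg (by positivity : 0 ≤ (‖ξ‖ ^ (n - k))⁻¹)]
    calc _ ≤ (‖ξ‖ ^ (n - k))⁻¹ * (CN * (C * ((1 + ‖ξ‖) ^ (n + 1))⁻¹)) := by
          refine mul_le_mul_of_nonneg_left ?_ (by positivity)
          exact mul_le_mul (hCN _) (hC _) (norm_nonneg _) ((abs_nonneg _).trans (hCN ξ))
      _ = _ := by ring
  have hint := (integrable_singular_weight hk hkn).const_mul (CN * C)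
  refine ⟨hint.mono' hwm.aestronglyMeasurable (Eventually.of_forall hbd), ?_⟩
  set w : Euc n → ℂ := fun ξ => (((‖ξ‖ ^ (n - k))⁻¹ : ℝ) : ℂ) * ((N ξ : ℂ) * f ξ) with hw
  have h1 : ∫ ξ, w ξ = ∫ g : OrthGroup n, (∫ ξ, w ((g : EndE n) ξ)) ∂orthMeasure n := by
    simp [integral_comp_orth]
  rw [h1, integral_integral_swap]
  swap
  · refine (hint.comp_snd (orthMeasure n)).mono'
      (hwm.comp (continuous_orth_apply n).measurable).aestronglyMeasurable
      (Eventually.of_forall fun q => ?_)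
    have := hbd ((q.1 : EndE n) q.2)
    refine this.trans_eq ?_
    rw [norm_orth_apply]
  have h2 : ∀ ξ : Euc n, ∫ g, w ((g : EndE n) ξ) ∂orthMeasure n =
      ∫ g, w ((g : EndE n) (‖ξ‖ • e)) ∂orthMeasure n := by
    intro ξ
    obtain ⟨h, hh⟩ := exists_orth_apply_eq (x := ξ) (y := ‖ξ‖ • e) (by rw [norm_smul, he1]; simp)
    rw [← integral_mul_right_eq_self (fun g : OrthGroup n => w ((g : EndE n) ξ)) h, ← hh]
    rfl
  rw [integral_congr_ae (Eventually.of_forall h2),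
    integral_fun_norm (hk.trans_le hkn) finrank_euclideanSpace_fin
      (fun r => ∫ g, w ((g : EndE n) (r • e)) ∂orthMeasure n)]
  congr 1
  refine setIntegral_congr_fun measurableSet_Ioi fun r hr => ?_
  have hr' : (0 : ℝ) < r := hr
  simp only [hw, norm_orth_apply, norm_smul, he1, mul_one, Real.norm_of_nonneg hr'.le]
  rw [integral_const_mul, Complex.real_smul, Complex.real_smul, ← mul_assoc, ← Complex.ofReal_mul]
  simp only [map_smul, hNs r _ hr']
  congr 2
  rw [mul_inv_eq_iff_eq_mul₀ (pow_ne_zero _ hr'.ne'), ← pow_add]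
  congr 1
  omega

/-- Integration over the tautological bundle in polar coordinates. -/
theorem integral_grassmann {n k : ℕ} (hk : 0 < k) (hkn : k ≤ n) {ρ : Gr n k → ℝ}
    (hρ : Continuous ρ) {Cρ : ℝ} (hCρ : ∀ P, |ρ P| ≤ Cρ) {N : Euc n → ℝ}
    (hNm : Measurable N) {CN : ℝ} (hCN : ∀ ξ, |N ξ| ≤ CN)
    (hNs : ∀ (r : ℝ) (ξ : Euc n), 0 < r → N (r • ξ) = N ξ)
    (hN : ∀ (g : OrthGroup n) (j : Fin n),
      ∑ S ∈ setsThrough k j, ρ (rotate g (coordPlane S)) =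
      (setsThrough k j).card * N ((g : EndE n) (EuclideanSpace.basisFun (Fin n) ℝ j)))
    {f : Euc n → ℂ} (hf : Decays f) :
    ∫ P, (ρ P : ℂ) * (∫ x : P.plane, f x) ∂grMeasure n k =
      ((sphereVol k / sphereVol n : ℝ) : ℂ) *
        ∫ ξ : Euc n, (((‖ξ‖ ^ (n - k))⁻¹ : ℝ) : ℂ) * ((N ξ : ℂ) * f ξ) := by
  have hn : ((sphereVol n : ℝ) : ℂ) ≠ 0 :=
    Complex.ofReal_ne_zero.2 (sphereVol_pos (hk.trans_le hkn)).ne'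
  rw [integral_grMeasure_plane hk hkn hρ hCρ hf,
    (integral_singular_orbit hk hkn hNm hCN hNs hf).2]
  -- The base plane is a coordinate plane through the first basis vector, so the two radial
  -- integrands coincide; only the sphere volumes in front differ.
  obtain ⟨S, hS, hSP⟩ := basePlane_eq_coordPlane hk hkn
  rw [hSP]
  simp only [orbitInt_coordPlane_eq hρ (fun g => hN g _) hf.1 hS]
  push_cast
  field_simp

/-! ### Integration over the fibres of an orthogonal projection -/

section Fibre

variable {n : ℕ} (K : Submodule ℝ (Euc n))

theorem measurePreserving_decomposition :
    MeasurePreserving (fun z : Euc n => WithLp.ofLp (K.orthogonalDecomposition z))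
      volume (volume.prod volume) :=
  (WithLp.volume_preserving_ofLp K Kᗮ).comp K.orthogonalDecomposition.measurePreserving

theorem measurableEmbedding_decomposition :
    MeasurableEmbedding (fun z : Euc n => WithLp.ofLp (K.orthogonalDecomposition z)) :=
  (MeasurableEquiv.toLp 2 (K × Kᗮ)).symm.measurableEmbedding.comp
    K.orthogonalDecomposition.toHomeomorph.measurableEmbedding

theorem fst_decomposition_add (z : Euc n) :
    ((WithLp.ofLp (K.orthogonalDecomposition z)).1 : Euc n) +
      (WithLp.ofLp (K.orthogonalDecomposition z)).2 = z := by
  rw [Submodule.orthogonalDecomposition_apply]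
  exact Submodule.starProjection_add_starProjection_orthogonal (K := K) z

theorem fst_decomposition (z : Euc n) :
    (WithLp.ofLp (K.orthogonalDecomposition z)).1 = K.orthogonalProjectionOnto z := by
  rw [Submodule.orthogonalDecomposition_apply]

theorem integral_decomposition {E : Type*} [NormedAddCommGroup E] [NormedSpace ℝ E]
    (F : Euc n → K → E) :
    ∫ z, F z (K.orthogonalProjectionOnto z) =
      ∫ q : K × Kᗮ, F (q.1 + q.2 : Euc n) q.1 ∂(volume.prod volume) := by
  rw [← (measurePreserving_decomposition K).integral_comp (measurableEmbedding_decomposition K)]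
  simp only [fst_decomposition_add]
  simp only [fst_decomposition]

theorem lintegral_decomposition (F : Euc n → K → ℝ≥0∞) :
    ∫⁻ z, F z (K.orthogonalProjectionOnto z) =
      ∫⁻ q : K × Kᗮ, F (q.1 + q.2 : Euc n) q.1 ∂(volume.prod volume) := by
  rw [← (measurePreserving_decomposition K).lintegral_comp_emb
    (measurableEmbedding_decomposition K)]
  simp only [fst_decomposition_add]
  simp only [fst_decomposition]

theorem integrable_decomposition {E : Type*} [NormedAddCommGroup E]
    {F : Euc n → K → E} (hF : Integrable fun z => F z (K.orthogonalProjectionOnto z)) :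
    Integrable (fun q : K × Kᗮ => F (q.1 + q.2 : Euc n) q.1) (volume.prod volume) := by
  rw [← (measurePreserving_decomposition K).integrable_comp_emb
    (measurableEmbedding_decomposition K)]
  simp only [Function.comp_def, fst_decomposition_add]
  simpa only [fst_decomposition] using hF

/-- By Pythagoras both norms are at most ‖x + y‖. Decay of order 2N in ℝⁿ thus yields decay of order
N along K and along its complement separately. -/
theorem one_add_norm_mul_le {x y : Euc n} (hx : x ∈ K) (hy : y ∈ Kᗮ) (N : ℕ) :
    (1 + ‖x‖) ^ N * (1 + ‖y‖) ^ N ≤ (1 + ‖x + y‖) ^ (2 * N) := by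
  have hxy : ‖x + y‖ ^ 2 = ‖x‖ ^ 2 + ‖y‖ ^ 2 := by
    have := norm_add_sq_eq_norm_sq_add_norm_sq_of_inner_eq_zero x y (hy x hx)
    simpa [sq] using this
  have hx1 : ‖x‖ ≤ ‖x + y‖ := by
    refine le_of_sq_le_sq ?_ (norm_nonneg _)
    rw [hxy]; nlinarith [sq_nonneg ‖y‖]
  have hy1 : ‖y‖ ≤ ‖x + y‖ := by
    refine le_of_sq_le_sq ?_ (norm_nonneg _)
    rw [hxy]; nlinarith [sq_nonneg ‖x‖]
  rw [two_mul, pow_add]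
  gcongr

/-- Schwartz functions decay like powers of `(1 + ‖x‖)⁻¹`. -/
theorem schwartz_decay (f : 𝓢(Euc n, ℂ)) :
    ∃ C : ℝ, 0 ≤ C ∧ ∀ x, ‖f x‖ ≤ C * ((1 + ‖x‖) ^ (2 * (n + 1)))⁻¹ := by
  obtain ⟨C, hC⟩ : ∃ C : ℝ, ∀ z, (1 + ‖z‖) ^ (2 * (n + 1)) * ‖f z‖ ≤ C := by
    have h := fun z => SchwartzMap.one_add_le_sup_seminorm_apply (𝕜 := ℝ) (m := (2 * (n + 1), 0))
      (k := 2 * (n + 1)) (n := 0) le_rfl le_rfl f z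
    simp only [norm_iteratedFDeriv_zero] at h
    exact ⟨_, h⟩
  refine ⟨C, le_trans (by positivity) (hC 0), fun x => ?_⟩
  rw [← div_eq_mul_inv, le_div_iff₀ (by positivity), mul_comm]
  exact hC x

theorem decays_schwartz (f : 𝓢(Euc n, ℂ)) : Decays f := by
  obtain ⟨C, hC0, hC⟩ := schwartz_decay f
  refine ⟨f.continuous, C, hC0, fun x => (hC x).trans ?_⟩
  gcongr
  · linarith [norm_nonneg x]
  · omega

theorem Decays.mul {f g : Euc n → ℂ} (hf : Decays f) (hg : Decays g) :
    Decays fun x => f x * g x := by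
  obtain ⟨hfc, C, hC0, hC⟩ := hf
  obtain ⟨hgc, D, hD0, hD⟩ := hg
  refine ⟨hfc.mul hgc, C * D, by positivity, fun x => ?_⟩
  have h1 : ((1 + ‖x‖) ^ (n + 1))⁻¹ ≤ 1 :=
    inv_le_one_of_one_le₀ (one_le_pow₀ (by linarith [norm_nonneg x]))
  rw [norm_mul]
  calc ‖f x‖ * ‖g x‖ ≤ (C * ((1 + ‖x‖) ^ (n + 1))⁻¹) * (D * ((1 + ‖x‖) ^ (n + 1))⁻¹) :=
        mul_le_mul (hC x) (hD x) (norm_nonneg _) (by positivity)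
    _ ≤ (C * ((1 + ‖x‖) ^ (n + 1))⁻¹) * (D * 1) := by gcongr
    _ = _ := by ring

theorem Decays.integrable_restrict {f : Euc n → ℂ} (hf : Decays f) :
    Integrable fun u : K => f u := by
  obtain ⟨hfc, C, hC0, hC⟩ := hf
  exact ((weight_integrable (V := K) (n := n) ((Submodule.finrank_le _).trans (by simp))).const_mul
    C).mono' (hfc.comp continuous_subtype_val).aestronglyMeasurable
    (Eventually.of_forall fun u => hC u)

/-- The integral of `f` over the affine subspace through `u ∈ K` orthogonal to `K`. -/
def fibreInt (f : Euc n → ℂ) (u : K) : ℂ := ∫ y : Kᗮ, f (u + y)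

/-- The exponent 2(n+1) is split evenly; n + 1 exceeds the dimension of K and of its complement, so
each factor is integrable. The constant does not depend on K. -/
theorem schwartz_fibre_decay (f : 𝓢(Euc n, ℂ)) :
    ∃ C : ℝ, 0 ≤ C ∧ ∀ (K : Submodule ℝ (Euc n)) (u : K) (y : Kᗮ),
      ‖f (u + y)‖ ≤ C * ((1 + ‖u‖) ^ (n + 1))⁻¹ * ((1 + ‖y‖) ^ (n + 1))⁻¹ := by
  obtain ⟨C, hC0, hC⟩ := schwartz_decay f
  refine ⟨C, hC0, fun K u y => (hC _).trans ?_⟩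
  rw [mul_assoc, ← mul_inv]
  refine mul_le_mul_of_nonneg_left (inv_anti₀ (by positivity) ?_) hC0
  exact one_add_norm_mul_le K u.2 y.2 (n + 1)

theorem integrable_weight_submodule : Integrable fun u : K => ((1 + ‖u‖) ^ (n + 1))⁻¹ :=
  weight_integrable ((Submodule.finrank_le _).trans (by simp))

theorem integrable_fibre (f : 𝓢(Euc n, ℂ)) (u : K) : Integrable fun y : Kᗮ => f (u + y) := by
  obtain ⟨C, hC0, hC⟩ := schwartz_fibre_decay f
  have := f.continuous
  exact ((integrable_weight_submodule Kᗮ).const_mul (C * ((1 + ‖u‖) ^ (n + 1))⁻¹)).mono'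
    (Continuous.aestronglyMeasurable (by fun_prop)) (Eventually.of_forall fun y => hC K u y)

theorem norm_fibreInt_le (f : 𝓢(Euc n, ℂ)) :
    ∃ C : ℝ, 0 ≤ C ∧ ∀ u : K, ∫ y : Kᗮ, ‖f (u + y)‖ ≤ C * ((1 + ‖u‖) ^ (n + 1))⁻¹ := by
  obtain ⟨C, hC0, hC⟩ := schwartz_fibre_decay f
  refine ⟨C * ∫ y : Kᗮ, ((1 + ‖y‖) ^ (n + 1))⁻¹,
    mul_nonneg hC0 (integral_nonneg fun y => by positivity), fun u => ?_⟩
  rw [mul_right_comm, ← integral_const_mul]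
  exact integral_mono (integrable_fibre K f u).norm
    ((integrable_weight_submodule Kᗮ).const_mul _) fun y => hC K u y

/-- All complements of k-planes have dimension n - k, so the integral of the weight over them, and
with it the constant, is the same for every P. -/
theorem norm_fibreInt_plane_le {k : ℕ} (f : 𝓢(Euc n, ℂ)) :
    ∃ C : ℝ, 0 ≤ C ∧ ∀ (P : Gr n k) (u : P.plane),
      ∫ y : (P.planeᗮ : Submodule ℝ (Euc n)), ‖f (u + y)‖ ≤ C * ((1 + ‖u‖) ^ (n + 1))⁻¹ := by
  obtain ⟨C, hC0, hC⟩ := schwartz_fibre_decay f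
  refine ⟨C * ∫ y : Euc (n - k), ((1 + ‖y‖) ^ (n + 1))⁻¹,
    mul_nonneg hC0 (integral_nonneg fun y => by positivity), fun P u => ?_⟩
  have hfin : Module.finrank ℝ (P.planeᗮ : Submodule ℝ (Euc n)) = n - k := by
    have h1 := Submodule.finrank_add_finrank_orthogonal P.plane
    have h2 := P.finrank_eq
    rw [finrank_euclideanSpace_fin] at h1
    omega
  have hw := weight_integral (V := (P.planeᗮ : Submodule ℝ (Euc n)))
    (fun t => ((1 + t) ^ (n + 1))⁻¹)
  rw [hfin] at hw
  rw [← hw, mul_right_comm, ← integral_const_mul]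
  exact integral_mono (integrable_fibre _ f u).norm
    ((integrable_weight_submodule _).const_mul _) fun y => hC _ u y

theorem continuous_fibreInt (f : 𝓢(Euc n, ℂ)) : Continuous (fibreInt K f) := by
  obtain ⟨C, hC0, hC⟩ := schwartz_fibre_decay f
  have hf := f.continuous
  refine continuous_of_dominated (bound := fun y : Kᗮ => C * ((1 + ‖y‖) ^ (n + 1))⁻¹)
    (fun u => (integrable_fibre K f u).aestronglyMeasurable)
    (fun u => Eventually.of_forall fun y => (hC K u y).trans ?_)
    ((integrable_weight_submodule Kᗮ).const_mul C)
    (Eventually.of_forall fun y => by fun_prop)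
  have h1 : ((1 + ‖u‖) ^ (n + 1))⁻¹ ≤ 1 :=
    inv_le_one_of_one_le₀ (one_le_pow₀ (by linarith [norm_nonneg u]))
  have := mul_le_mul_of_nonneg_left h1 hC0
  rw [mul_one] at this
  gcongr

theorem integrable_fibreInt (f : 𝓢(Euc n, ℂ)) : Integrable (fibreInt K f) := by
  obtain ⟨C, hC0, hC⟩ := norm_fibreInt_le K f
  exact ((integrable_weight_submodule K).const_mul C).mono'
    (continuous_fibreInt K f).aestronglyMeasurable
    (Eventually.of_forall fun u => (norm_integral_le_integral_norm _).trans (hC u))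

/-- Fubini on K × Kᗮ: the second factor is constant along the fibres. This is the duality between
fibre integration and pullback by the projection. -/
theorem integral_mul_comp_projection (f : 𝓢(Euc n, ℂ)) {F : K → ℂ} (hF : Continuous F) {C : ℝ}
    (hC : ∀ u, ‖F u‖ ≤ C) :
    ∫ z, f z * F (K.orthogonalProjectionOnto z) = ∫ u : K, fibreInt K f u * F u := by
  have hint : Integrable fun z => f z * F (K.orthogonalProjectionOnto z) :=
    f.integrable.mul_bdd (c := C)
      (hF.comp K.orthogonalProjectionOnto.continuous).aestronglyMeasurable
      (Eventually.of_forall fun z => hC _)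
  rw [integral_decomposition K (fun z u => f z * F u),
    integral_prod _ (integrable_decomposition K (F := fun z u => f z * F u) hint)]
  simp only [integral_mul_const]
  rfl

theorem inner_add_orthogonal (u ξ : K) (y : Kᗮ) :
    (inner ℝ ((u : Euc n) + y) (ξ : Euc n) : ℝ) = inner ℝ u ξ := by
  rw [inner_add_left, real_inner_comm (ξ : Euc n) (y : Euc n), y.2 ξ ξ.2, add_zero]
  rfl

theorem norm_exp_ofReal_mul_I_le (t : ℝ) : ‖Complex.exp ((t : ℂ) * Complex.I)‖ ≤ 1 :=
  (Complex.norm_exp_ofReal_mul_I t).le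

/-- The projection-slice theorem. -/
theorem fourier_fibreInt (f : 𝓢(Euc n, ℂ)) (ξ : K) :
    𝓕 (fibreInt K f) ξ = (𝓕 f) (ξ : Euc n) := by
  rw [SchwartzMap.fourier_coe, Real.fourier_eq', Real.fourier_eq']
  simp only [smul_eq_mul]
  have h := integral_mul_comp_projection K f
    (F := fun u => Complex.exp ((-2 * Real.pi * inner ℝ u ξ : ℝ) * Complex.I)) (by fun_prop)
    (C := 1) (fun u => norm_exp_ofReal_mul_I_le _)
  simp only [mul_comm (f _), mul_comm (fibreInt K f _)] at h
  rw [← h]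
  refine integral_congr_ae (Eventually.of_forall fun z => ?_)
  have h2 := inner_add_orthogonal K (K.orthogonalProjectionOnto z) ξ
    (Kᗮ.orthogonalProjectionOnto z)
  have h3 : ((K.orthogonalProjectionOnto z : Euc n) + (Kᗮ.orthogonalProjectionOnto z : Euc n)) = z :=
    Submodule.starProjection_add_starProjection_orthogonal (K := K) z
  rw [h3] at h2
  simp only [h2]

theorem fourierInv_fibreInt (f : 𝓢(Euc n, ℂ)) (ξ : K) :
    𝓕⁻ (fibreInt K f) ξ = (𝓕⁻ f) (ξ : Euc n) := by
  have h := fourier_fibreInt K f (-ξ)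
  rw [SchwartzMap.fourier_coe] at h
  rw [SchwartzMap.fourierInv_coe, Real.fourierInv_eq_fourier_neg, Real.fourierInv_eq_fourier_neg, h]
  rfl

/-- Parseval's formula for integrals over the fibres of an orthogonal projection. -/
theorem integral_fibreInt_mul (f g : 𝓢(Euc n, ℂ)) :
    ∫ u : K, fibreInt K f u * fibreInt K g u = ∫ ξ : K, (𝓕⁻ f) (ξ : Euc n) * (𝓕 g) (ξ : Euc n) := by
  have hf := integrable_fibreInt K f
  have hg := integrable_fibreInt K g
  have hf1 : Integrable (𝓕 (fibreInt K f)) :=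
    ((decays_schwartz (𝓕 f)).integrable_restrict K).congr
      (Eventually.of_forall fun ξ => (fourier_fibreInt K f ξ).symm)
  have hf2 : Integrable (𝓕⁻ (fibreInt K f)) :=
    ((decays_schwartz (𝓕⁻ f)).integrable_restrict K).congr
      (Eventually.of_forall fun ξ => (fourierInv_fibreInt K f ξ).symm)
  -- Fourier inversion writes the first factor as the transform of its inverse transform; the
  -- symmetry of the Fourier integral in `h2` then moves that transform to the second factor.
  -- Continuity and integrability of the fibre integrals make the inversion hold at every point.
  have h1 := (continuous_fibreInt K f).fourier_fourierInv_eq hf hf1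
  have h2 := VectorFourier.integral_fourierIntegral_smul_eq_flip (L := innerₗ K)
    (μ := volume) (ν := volume) Real.continuous_fourierChar
    (continuous_inner (𝕜 := ℝ) (E := K)) hf2 hg
  simp only [flip_innerₗ] at h2
  change ∫ ξ, (𝓕 (𝓕⁻ (fibreInt K f))) ξ * fibreInt K g ξ =
    ∫ x, 𝓕⁻ (fibreInt K f) x * 𝓕 (fibreInt K g) x at h2
  rw [h1] at h2
  rw [h2]
  simp only [fourier_fibreInt, fourierInv_fibreInt]

end Fibre

/-! ### Schwartz forms in coordinates -/

section SchwartzForm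

variable {n m k : ℕ}

/-- A coordinate of a Schwartz form, as a complex-valued Schwartz function. -/
def coord (α : 𝓢(Euc n, Lam m (Euc n))) (s : Set.powersetCard (Fin n) m) : 𝓢(Euc n, ℂ) :=
  α.postcompCLM (Complex.ofRealCLM ∘L innerSL ℝ (lamBasis n m s))

/-- The complexification of a Schwartz form. -/
def complexForm (α : 𝓢(Euc n, Lam m (Euc n))) : 𝓢(Euc n, LamC n m) := α.postcompCLM (toC n m)

theorem coord_apply (α : 𝓢(Euc n, Lam m (Euc n))) (s : Set.powersetCard (Fin n) m) (x : Euc n) :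
    coord α s x = toC n m (α x) s := by
  rw [toC_apply]; rfl

theorem fourier_complexForm_apply (α : 𝓢(Euc n, Lam m (Euc n))) (s : Set.powersetCard (Fin n) m)
    (ξ : Euc n) : (𝓕 (complexForm α)) ξ s = (𝓕 (coord α s)) ξ := by
  rw [SchwartzMap.fourier_coe, SchwartzMap.fourier_coe, Real.fourier_eq, Real.fourier_eq]
  have h := (EuclideanSpace.proj s : LamC n m →L[ℂ] ℂ).integral_comp_comm
    ((Real.fourierIntegral_convergent_iff ξ).2 ((complexForm α).integrable (μ := volume)))
  refine Eq.trans h.symm (integral_congr_ae (Eventually.of_forall fun x => ?_))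
  simp only [Circle.smul_def, map_smul, coord_apply]
  rfl

/-- The coordinate is real-valued. This converts the bilinear form of Parseval's formula into a
Hermitian one. -/
theorem fourierInv_coord (α : 𝓢(Euc n, Lam m (Euc n))) (s : Set.powersetCard (Fin n) m)
    (ξ : Euc n) : (𝓕⁻ (coord α s)) ξ = starRingEnd ℂ ((𝓕 (coord α s)) ξ) := by
  rw [SchwartzMap.fourier_coe, SchwartzMap.fourierInv_coe, Real.fourier_eq', Real.fourierInv_eq',
    ← integral_conj]
  refine integral_congr_ae (Eventually.of_forall fun x => ?_)
  simp only [smul_eq_mul, map_mul, ← Complex.exp_conj, Complex.conj_ofReal, Complex.conj_I,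
    coord_apply, toC_apply]
  congr 2
  push_cast
  ring

/-- The integral of a form over the fibre of the projection onto `K`. -/
def fibreForm (K : Submodule ℝ (Euc n)) (α : Euc n → Lam m (Euc n)) (u : K) : Lam m (Euc n) :=
  ∫ y : Kᗮ, α (u + y)

theorem integrable_fibreForm (K : Submodule ℝ (Euc n)) (α : 𝓢(Euc n, Lam m (Euc n))) (u : K) :
    Integrable fun y : Kᗮ => α ((u : Euc n) + y) := by
  obtain ⟨C, hC0, hC⟩ := schwartz_bound α
  have := α.continuous
  exact ((integrable_weight_submodule Kᗮ).const_mul (C * ((1 + ‖(u : Euc n)‖) ^ (n + 1))⁻¹)).mono'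
    (Continuous.aestronglyMeasurable (by fun_prop)) (Eventually.of_forall fun y => hC K u u.2 y)

theorem planeTransform_of (α : 𝓢(Euc n, Lam m (Euc n))) (P : Gr n k) (u : P.plane) :
    planeTransform α (Taut.of P u) = restr m P.plane (fibreForm P.plane α u) :=
  (restr m P.plane).integral_comp_comm (integrable_fibreForm P.plane α u)

theorem toC_fibreForm (α : 𝓢(Euc n, Lam m (Euc n))) (K : Submodule ℝ (Euc n)) (u : K)
    (s : Set.powersetCard (Fin n) m) :
    toC n m (fibreForm K α u) s = fibreInt K (coord α s) u := by
  rw [toC_apply]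
  exact ((Complex.ofRealCLM ∘L innerSL ℝ (lamBasis n m s)).integral_comp_comm
    (integrable_fibreForm K α u)).symm

theorem toC_restr (P : Gr n k) (v : Lam m (Euc n)) (t : Set.powersetCard (Fin n) m) :
    toC n m (restr m P.plane v) t = ∑ s, (restrEntry t s P : ℂ) * toC n m v s := by
  rw [← endC_toC, endC_apply]
  rfl

theorem toC_planeTransform (α : 𝓢(Euc n, Lam m (Euc n))) (P : Gr n k) (u : P.plane)
    (t : Set.powersetCard (Fin n) m) :
    toC n m (planeTransform α (Taut.of P u)) t =
      ∑ s, (restrEntry t s P : ℂ) * fibreInt P.plane (coord α s) u := by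
  rw [planeTransform_of, toC_restr]
  simp only [toC_fibreForm]

/-- Restriction is an orthogonal projection, so ‖v|_P‖² = ⟨v, v|_P⟩. The square norm is thus linear
in the matrix of the restriction operator, and the averaging formula applies to it. -/
theorem norm_sq_planeTransform (α : 𝓢(Euc n, Lam m (Euc n))) (P : Gr n k) (u : P.plane) :
    ((‖planeTransform α (Taut.of P u)‖ ^ 2 : ℝ) : ℂ) =
      ∑ t, ∑ s, (restrEntry t s P : ℂ) *
        (fibreInt P.plane (coord α t) u * fibreInt P.plane (coord α s) u) := by
  rw [← real_inner_self_eq_norm_sq, planeTransform_of, inner_restr_left, restr_restr, ← inner_toC,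
    PiLp.inner_apply]
  refine Finset.sum_congr rfl fun t _ => ?_
  rw [RCLike.inner_apply, toC_restr, toC_apply, Complex.conj_ofReal, ← toC_apply, Finset.sum_mul]
  refine Finset.sum_congr rfl fun s _ => ?_
  rw [toC_fibreForm, toC_fibreForm]
  ring

/-- The polar coordinate formula for the matrix entries of the restriction operators. -/
theorem integral_restrEntry (hmk : m < k) (hkn : k < n) (t s : Set.powersetCard (Fin n) m)
    {f : Euc n → ℂ} (hf : Decays f) :
    Integrable (fun ξ : Euc n => (((‖ξ‖ ^ (n - k))⁻¹ : ℝ) : ℂ) * ((meanEntry k t s ξ : ℂ) * f ξ)) ∧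
    ∫ P : Gr n k, (restrEntry t s P : ℂ) * (∫ x : P.plane, f x) ∂grMeasure n k =
      ((sphereVol k / sphereVol n : ℝ) : ℂ) *
        ∫ ξ : Euc n, (((‖ξ‖ ^ (n - k))⁻¹ : ℝ) : ℂ) * ((meanEntry k t s ξ : ℂ) * f ξ) := by
  obtain ⟨C, hC0, hC⟩ := abs_meanEntry_le (n := n) (m := m) k
  have hk : 0 < k := by omega
  have hNs : ∀ (r : ℝ) (ξ : Euc n), 0 < r → meanEntry k t s (r • ξ) = meanEntry k t s ξ :=
    fun r ξ hr => meanEntry_smul k t s hr.ne' ξ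
  exact ⟨(integral_singular_orbit hk hkn.le (measurable_meanEntry k t s) (hC t s) hNs hf).1,
    integral_grassmann hk hkn.le (continuous_restrEntry t s) (abs_restrEntry_le t s)
      (measurable_meanEntry k t s) (hC t s) hNs (sum_restrEntry hmk hkn.le t s) hf⟩

theorem integrable_restrEntry (t s : Set.powersetCard (Fin n) m)
    {f : Euc n → ℂ} (hf : Decays f) :
    Integrable (fun P : Gr n k => (restrEntry t s P : ℂ) * ∫ x : P.plane, f x)
      (grMeasure n k) := by
  obtain ⟨hfc, C, hC0, hC⟩ := hf
  refine (integrable_const (C * ∫ y : Euc k, ((1 + ‖y‖) ^ (n + 1))⁻¹)).mono'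
    ((Complex.continuous_ofReal.comp (continuous_restrEntry t s)).stronglyMeasurable.mul
      (stronglyMeasurable_integral_plane hfc)).aestronglyMeasurable
    (Eventually.of_forall fun P => ?_)
  have hw := weight_integral (V := P.plane) (fun t => ((1 + t) ^ (n + 1))⁻¹)
  rw [P.finrank_eq] at hw
  rw [norm_mul, Complex.norm_real, Real.norm_eq_abs, ← hw, ← integral_const_mul]
  refine (mul_le_of_le_one_left (norm_nonneg _) (abs_restrEntry_le t s P)).trans ?_
  exact norm_integral_le_of_norm_le ((integrable_weight_submodule P.plane).const_mul C)
    (Eventually.of_forall fun u => hC u)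

theorem continuous_proj_pair (n k : ℕ) :
    Continuous fun q : Euc n × Gr n k => q.2.plane.starProjection q.1 :=
  ((continuous_proj n k).comp continuous_snd).clm_apply continuous_fst

theorem measurable_tautOf_proj (n k : ℕ) : Measurable fun q : Euc n × Gr n k =>
    Taut.of q.2 (q.2.plane.orthogonalProjectionOnto q.1) :=
  measurable_comap_iff.2 (measurable_snd.prodMk (continuous_proj_pair n k).measurable)

theorem norm_planeTransform_le_const (α : 𝓢(Euc n, Lam m (Euc n))) :
    ∃ C : ℝ, ∀ p : Taut n k, ‖planeTransform α p‖ ≤ C := by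
  obtain ⟨C, hC⟩ := norm_planeTransform_le (k := k) α
  refine ⟨|C|, fun p => (hC p).trans ?_⟩
  have h1 : ((1 + ‖p.point‖) ^ (n + 1))⁻¹ ≤ 1 := weight_le_one p
  have h0 : 0 ≤ ((1 + ‖p.point‖) ^ (n + 1))⁻¹ := weight_nonneg p
  calc C * ((1 + ‖p.point‖) ^ (n + 1))⁻¹ ≤ |C| * ((1 + ‖p.point‖) ^ (n + 1))⁻¹ :=
        mul_le_mul_of_nonneg_right (le_abs_self C) h0
    _ ≤ |C| * 1 := mul_le_mul_of_nonneg_left h1 (abs_nonneg C)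
    _ = |C| := mul_one _

theorem continuous_toC_apply (t : Set.powersetCard (Fin n) m) :
    Continuous fun v : Lam m (Euc n) => toC n m v t :=
  ((EuclideanSpace.proj t : LamC n m →L[ℂ] ℂ).continuous).comp (toC n m).continuous

theorem norm_toC_apply_le (v : Lam m (Euc n)) (t : Set.powersetCard (Fin n) m) :
    ‖toC n m v t‖ ≤ ‖v‖ :=
  (PiLp.norm_apply_le _ t).trans (norm_toC v).le

/-- Values of `ℛα` at P already lie in Λᵐ(P), so the restriction built into `ℛ^*` has no effect on
them. -/
theorem toC_dualTransform_planeTransform (α : 𝓢(Euc n, Lam m (Euc n))) (x : Euc n)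
    (t : Set.powersetCard (Fin n) m) :
    toC n m (dualTransform (k := k) (planeTransform α) x) t =
      ∫ P : Gr n k, toC n m (planeTransform α
        (Taut.of P (P.plane.orthogonalProjectionOnto x))) t ∂grMeasure n k := by
  obtain ⟨C, hC⟩ := norm_planeTransform_le_const (k := k) α
  have hr : ∀ P : Gr n k, restr m P.plane (planeTransform α
      (Taut.of P (P.plane.orthogonalProjectionOnto x))) = planeTransform α
      (Taut.of P (P.plane.orthogonalProjectionOnto x)) := fun P => by
    rw [planeTransform_of, restr_restr]
  simp only [dualTransform, hr]
  have hint : Integrable (fun P : Gr n k => planeTransform α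
      (Taut.of P (P.plane.orthogonalProjectionOnto x))) (grMeasure n k) :=
    (integrable_const C).mono' ((stronglyMeasurable_planeTransform α.continuous).comp_measurable
      ((measurable_tautOf_proj n k).comp
        (measurable_const.prodMk measurable_id))).aestronglyMeasurable
      (Eventually.of_forall fun P => hC _)
  rw [toC_apply]
  refine ((Complex.ofRealCLM ∘L innerSL ℝ (lamBasis n m t)).integral_comp_comm hint).symm.trans
    (integral_congr_ae (Eventually.of_forall fun P => ?_))
  exact (toC_apply _ _).symm

theorem integrable_fibreInt_mul (K : Submodule ℝ (Euc n)) (f g : 𝓢(Euc n, ℂ)) :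
    Integrable fun u : K => fibreInt K f u * fibreInt K g u := by
  obtain ⟨D, hD0, hD⟩ := norm_fibreInt_le K g
  refine (integrable_fibreInt K f).mul_bdd (c := D)
    (continuous_fibreInt K g).aestronglyMeasurable (Eventually.of_forall fun u => ?_)
  refine (norm_integral_le_integral_norm _).trans ((hD u).trans ?_)
  exact mul_le_of_le_one_right hD0
    (inv_le_one_of_one_le₀ (one_le_pow₀ (by linarith [norm_nonneg u])))

/-- The Fourier transform of `ℛ^*ℛα` for a Schwartz form `α`, in coordinates. -/
theorem integral_mul_dualTransform (hmk : m < k) (hkn : k < n) (α : 𝓢(Euc n, Lam m (Euc n)))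
    (ψ : 𝓢(Euc n, ℂ)) (t : Set.powersetCard (Fin n) m) :
    ∫ x, ψ x * toC n m (dualTransform (k := k) (planeTransform α) x) t =
      ∑ s, ((sphereVol k / sphereVol n : ℝ) : ℂ) *
        ∫ ξ : Euc n, (((‖ξ‖ ^ (n - k))⁻¹ : ℝ) : ℂ) *
          ((meanEntry k t s ξ : ℂ) * ((𝓕⁻ ψ) ξ * (𝓕 (coord α s)) ξ)) := by
  obtain ⟨C, hC⟩ := norm_planeTransform_le_const (k := k) α
  have hd : ∀ s, Decays fun ξ => (𝓕⁻ ψ) ξ * (𝓕 (coord α s)) ξ := fun s =>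
    (decays_schwartz _).mul (decays_schwartz _)
  simp only [toC_dualTransform_planeTransform, ← integral_const_mul]
  rw [integral_integral_swap]
  swap
  · refine ((ψ.integrable.norm.mul_const C).comp_fst (grMeasure n k)).mono' ?_
      (Eventually.of_forall fun q => ?_)
    · refine ((ψ.continuous.comp continuous_fst).stronglyMeasurable.mul ?_).aestronglyMeasurable
      exact (continuous_toC_apply t).comp_stronglyMeasurable
        ((stronglyMeasurable_planeTransform α.continuous).comp_measurable
          (measurable_tautOf_proj n k))
    · rw [Function.uncurry_def, norm_mul]
      exact mul_le_mul_of_nonneg_left ((norm_toC_apply_le _ _).trans (hC _)) (norm_nonneg _)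
  -- For a fixed plane the transform depends only on the projection of x; integrating ψ along the
  -- fibres and applying Parseval on P brings in the Fourier transforms.
  have h1 : ∀ P : Gr n k, ∫ x, ψ x * toC n m (planeTransform α
      (Taut.of P (P.plane.orthogonalProjectionOnto x))) t =
      ∑ s, (restrEntry t s P : ℂ) *
        ∫ ξ : P.plane, (𝓕⁻ ψ) (ξ : Euc n) * (𝓕 (coord α s)) (ξ : Euc n) := by
    intro P
    have hF : Continuous fun u : P.plane => toC n m (planeTransform α (Taut.of P u)) t := by
      simp only [toC_planeTransform]
      exact continuous_finsetSum _ fun s _ =>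
        continuous_const.mul (continuous_fibreInt P.plane (coord α s))
    rw [integral_mul_comp_projection P.plane ψ hF
      (fun u => (norm_toC_apply_le _ _).trans (hC _))]
    simp only [toC_planeTransform, Finset.mul_sum, mul_left_comm (fibreInt P.plane ψ _)]
    rw [integral_finsetSum _ fun s _ => (integrable_fibreInt_mul _ _ _).const_mul _]
    refine Finset.sum_congr rfl fun s _ => ?_
    rw [integral_const_mul, integral_fibreInt_mul]
  simp only [h1]
  rw [integral_finsetSum _ fun s _ => integrable_restrEntry t s (hd s)]
  exact Finset.sum_congr rfl fun s _ =>
    (integral_restrEntry hmk hkn t s (hd s)).2.trans (integral_const_mul _ _).symm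

end SchwartzForm

/-! ### The energy estimate -/

section Energy

variable {n m k : ℕ}

theorem integrable_norm_sq_planeTransform (α : 𝓢(Euc n, Lam m (Euc n))) (P : Gr n k) :
    Integrable fun u : P.plane => ‖planeTransform α (Taut.of P u)‖ ^ 2 := by
  have h : Integrable fun u : P.plane => ((‖planeTransform α (Taut.of P u)‖ ^ 2 : ℝ) : ℂ) := by
    simp only [norm_sq_planeTransform]
    exact integrable_finsetSum _ fun t _ => integrable_finsetSum _ fun s _ =>
      (integrable_fibreInt_mul P.plane _ _).const_mul _
  exact h.re

theorem integral_norm_sq_planeTransform (α : 𝓢(Euc n, Lam m (Euc n))) (P : Gr n k) :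
    ((∫ u : P.plane, ‖planeTransform α (Taut.of P u)‖ ^ 2 : ℝ) : ℂ) =
      ∑ t, ∑ s, (restrEntry t s P : ℂ) *
        ∫ ξ : P.plane, (𝓕⁻ (coord α t)) (ξ : Euc n) * (𝓕 (coord α s)) (ξ : Euc n) := by
  rw [← integral_complex_ofReal]
  simp only [norm_sq_planeTransform]
  rw [integral_finsetSum _ fun t _ => integrable_finsetSum _ fun s _ =>
      (integrable_fibreInt_mul P.plane _ _).const_mul _]
  refine Finset.sum_congr rfl fun t _ => ?_
  rw [integral_finsetSum _ fun s _ => (integrable_fibreInt_mul P.plane _ _).const_mul _]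
  refine Finset.sum_congr rfl fun s _ => ?_
  rw [integral_const_mul, integral_fibreInt_mul]

theorem decays_fourier_mul (α : 𝓢(Euc n, Lam m (Euc n))) (t s : Set.powersetCard (Fin n) m) :
    Decays fun ξ => (𝓕⁻ (coord α t)) ξ * (𝓕 (coord α s)) ξ :=
  (decays_schwartz _).mul (decays_schwartz _)

theorem integrable_integral_norm_sq_planeTransform (α : 𝓢(Euc n, Lam m (Euc n))) :
    Integrable (fun P : Gr n k => ∫ u : P.plane, ‖planeTransform α (Taut.of P u)‖ ^ 2)
      (grMeasure n k) := by
  have h : Integrable (fun P : Gr n k =>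
      ((∫ u : P.plane, ‖planeTransform α (Taut.of P u)‖ ^ 2 : ℝ) : ℂ)) (grMeasure n k) := by
    simp only [integral_norm_sq_planeTransform]
    exact integrable_finsetSum _ fun t _ => integrable_finsetSum _ fun s _ =>
      integrable_restrEntry t s (decays_fourier_mul α t s)
  exact h.re

theorem lintegral_norm_sq_planeTransform (α : 𝓢(Euc n, Lam m (Euc n))) :
    ∫⁻ p, ‖planeTransform α p‖ₑ ^ 2 ∂tautMeasure n k =
      ENNReal.ofReal (∫ P : Gr n k, (∫ u : P.plane, ‖planeTransform α (Taut.of P u)‖ ^ 2)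
        ∂grMeasure n k) := by
  rw [lintegral_tautMeasure ((stronglyMeasurable_planeTransform α.continuous).enorm.pow_const 2),
    ofReal_integral_eq_lintegral_ofReal (integrable_integral_norm_sq_planeTransform α)
      (Eventually.of_forall fun P => integral_nonneg fun u => by positivity)]
  refine lintegral_congr fun P => ?_
  rw [ofReal_integral_eq_lintegral_ofReal (integrable_norm_sq_planeTransform α P)
      (Eventually.of_forall fun u => by positivity)]
  refine lintegral_congr fun u => ?_
  rw [ENNReal.ofReal_pow (norm_nonneg _), ofReal_norm]

theorem inner_endC_meanRestr (α : 𝓢(Euc n, Lam m (Euc n))) (ξ : Euc n) :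
    inner ℂ ((𝓕 (complexForm α)) ξ) (endC (meanRestr m k ξ) ((𝓕 (complexForm α)) ξ)) =
      ∑ t, ∑ s, (meanEntry k t s ξ : ℂ) * ((𝓕⁻ (coord α t)) ξ * (𝓕 (coord α s)) ξ) := by
  rw [PiLp.inner_apply]
  refine Finset.sum_congr rfl fun t _ => ?_
  rw [RCLike.inner_apply, endC_apply, Finset.sum_mul]
  refine Finset.sum_congr rfl fun s _ => ?_
  rw [fourier_complexForm_apply, fourier_complexForm_apply, fourierInv_coord]
  change ((meanEntry k t s ξ : ℝ) : ℂ) * _ * _ = _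
  ring

theorem integrable_inner_meanRestr (hmk : m < k) (hkn : k < n) (α : 𝓢(Euc n, Lam m (Euc n))) :
    Integrable fun ξ : Euc n => (((‖ξ‖ ^ (n - k))⁻¹ : ℝ) : ℂ) *
      inner ℂ ((𝓕 (complexForm α)) ξ) (endC (meanRestr m k ξ) ((𝓕 (complexForm α)) ξ)) := by
  simp only [inner_endC_meanRestr, Finset.mul_sum]
  exact integrable_finsetSum _ fun t _ => integrable_finsetSum _ fun s _ =>
    (integral_restrEntry hmk hkn t s (decays_fourier_mul α t s)).1

/-- Parseval on each plane, followed by the polar coordinate formula for each pair of matrix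
indices, gives the energy identity. -/
theorem integral_integral_norm_sq_planeTransform (hmk : m < k) (hkn : k < n)
    (α : 𝓢(Euc n, Lam m (Euc n))) :
    ((∫ P : Gr n k, (∫ u : P.plane, ‖planeTransform α (Taut.of P u)‖ ^ 2) ∂grMeasure n k : ℝ) : ℂ) =
      ((sphereVol k / sphereVol n : ℝ) : ℂ) * ∫ ξ : Euc n, (((‖ξ‖ ^ (n - k))⁻¹ : ℝ) : ℂ) *
        inner ℂ ((𝓕 (complexForm α)) ξ) (endC (meanRestr m k ξ) ((𝓕 (complexForm α)) ξ)) := by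
  have hi := fun t s => integral_restrEntry hmk hkn t s (decays_fourier_mul α t s)
  rw [← integral_complex_ofReal]
  simp only [integral_norm_sq_planeTransform, inner_endC_meanRestr]
  rw [integral_finsetSum _ fun t _ => integrable_finsetSum _ fun s _ =>
      integrable_restrEntry t s (decays_fourier_mul α t s)]
  simp only [Finset.mul_sum]
  rw [integral_finsetSum _ fun t _ => integrable_finsetSum _ fun s _ => (hi t s).1, Finset.mul_sum]
  refine Finset.sum_congr rfl fun t _ => ?_
  rw [integral_finsetSum _ fun s _ => integrable_restrEntry t s (decays_fourier_mul α t s),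
    integral_finsetSum _ fun s _ => (hi t s).1, Finset.mul_sum]
  exact Finset.sum_congr rfl fun s _ => (hi t s).2

/-- The weight `|ξ|^{-(n-k)/2}`. -/
def sqrtWeight (k : ℕ) (ξ : Euc n) : ℝ := Real.sqrt ((‖ξ‖ ^ (n - k))⁻¹)

theorem sqrtWeight_sq (k : ℕ) (ξ : Euc n) : sqrtWeight k ξ ^ 2 = (‖ξ‖ ^ (n - k))⁻¹ :=
  Real.sq_sqrt (by positivity)

theorem measurable_sqrtWeight (k : ℕ) : Measurable (sqrtWeight k : Euc n → ℝ) := by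
  unfold sqrtWeight; fun_prop

theorem enorm_sqrtWeight_smul_sq (k : ℕ) (ξ : Euc n) (z : LamC n m) :
    ‖(sqrtWeight k ξ : ℂ) • z‖ₑ ^ 2 = ENNReal.ofReal ((‖ξ‖ ^ (n - k))⁻¹ * ‖z‖ ^ 2) := by
  rw [← ofReal_norm, ← ENNReal.ofReal_pow (norm_nonneg _), norm_smul, mul_pow, Complex.norm_real,
    Real.norm_eq_abs, sq_abs, sqrtWeight_sq]

/-- The `k`-plane transform of `α` controls `|ξ|^{-(n-k)/2} α̂` in `L²`. -/
theorem lintegral_sqrtWeight_fourier_le (hmk : m < k) (hkn : k < n) :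
    ∃ C : ℝ, ∀ α : 𝓢(Euc n, Lam m (Euc n)),
      ∫⁻ ξ, ‖(sqrtWeight k ξ : ℂ) • (𝓕 (complexForm α)) ξ‖ₑ ^ 2 ≤
        ENNReal.ofReal C * ∫⁻ p, ‖planeTransform α p‖ₑ ^ 2 ∂tautMeasure n k := by
  obtain ⟨c, hc0, hc⟩ := le_inner_meanRestr (n := n) hmk hkn
  set σ : ℝ := sphereVol k / sphereVol n with hσ
  have hσ0 : 0 < σ := div_pos (sphereVol_pos (by omega)) (sphereVol_pos (by omega))
  -- Here c is the coercivity constant of the mean restriction operator and σ the constant of the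
  -- energy identity.
  refine ⟨(c * σ)⁻¹, fun α => ?_⟩
  have hint := integrable_inner_meanRestr hmk hkn α
  have heq := integral_integral_norm_sq_planeTransform hmk hkn α
  set D : Euc n → ℂ := fun ξ => (((‖ξ‖ ^ (n - k))⁻¹ : ℝ) : ℂ) *
    inner ℂ ((𝓕 (complexForm α)) ξ) (endC (meanRestr m k ξ) ((𝓕 (complexForm α)) ξ)) with hD
  have hle : ∀ ξ, (‖ξ‖ ^ (n - k))⁻¹ * ‖(𝓕 (complexForm α)) ξ‖ ^ 2 ≤ c⁻¹ * (D ξ).re := by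
    intro ξ
    have h1 := le_re_inner_endC (hc ξ) ((𝓕 (complexForm α)) ξ)
    rw [hD]
    simp only [Complex.re_ofReal_mul]
    rw [le_inv_mul_iff₀ hc0, mul_left_comm]
    exact mul_le_mul_of_nonneg_left h1 (by positivity)
  have hre : (∫ ξ, D ξ).re = ∫ ξ, (D ξ).re := (integral_re hint).symm
  have heq' : ∫ ξ, (D ξ).re = σ⁻¹ * ∫ P : Gr n k, (∫ u : P.plane,
      ‖planeTransform α (Taut.of P u)‖ ^ 2) ∂grMeasure n k := by
    have := congrArg Complex.re heq
    rw [Complex.ofReal_re, Complex.re_ofReal_mul, hre] at this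
    rw [this, inv_mul_cancel_left₀ hσ0.ne']
  rw [lintegral_norm_sq_planeTransform, ← ENNReal.ofReal_mul (by positivity)]
  calc ∫⁻ ξ, ‖(sqrtWeight k ξ : ℂ) • (𝓕 (complexForm α)) ξ‖ₑ ^ 2
      ≤ ∫⁻ ξ, ENNReal.ofReal (c⁻¹ * (D ξ).re) := by
        refine lintegral_mono fun ξ => ?_
        rw [enorm_sqrtWeight_smul_sq]
        exact ENNReal.ofReal_le_ofReal (hle ξ)
    _ = ENNReal.ofReal (∫ ξ, c⁻¹ * (D ξ).re) :=
        (ofReal_integral_eq_lintegral_ofReal (hint.re.const_mul _)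
          (Eventually.of_forall fun ξ => le_trans (by positivity) (hle ξ))).symm
    _ = _ := by
        rw [integral_const_mul, heq', mul_inv, mul_assoc]

end Energy

/-! ### The multiplier with the inverse symbol -/

section Inverse

variable {n m k : ℕ}

/-- Multiplication by the inverse of the symbol `|ξ|^{n-k} h(ξ)`. -/
def inverseSymbol (k : ℕ) (ξ : Euc n) (z : LamC n m) : LamC n m :=
  (((‖ξ‖ ^ (n - k))⁻¹ : ℝ) : ℂ) •
    (((sphereVol k / sphereVol n : ℝ) : ℂ) • endC (meanRestr m k ξ) z)

theorem inverseSymbol_apply (ξ : Euc n) (z : LamC n m) (t : Set.powersetCard (Fin n) m) :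
    inverseSymbol k ξ z t = ∑ s, ((sphereVol k / sphereVol n : ℝ) : ℂ) *
      ((((‖ξ‖ ^ (n - k))⁻¹ : ℝ) : ℂ) * ((meanEntry k t s ξ : ℂ) * z s)) := by
  rw [inverseSymbol, PiLp.smul_apply, PiLp.smul_apply, endC_apply, smul_eq_mul, smul_eq_mul,
    Finset.mul_sum, Finset.mul_sum]
  refine Finset.sum_congr rfl fun s _ => ?_
  rw [mul_left_comm]
  rfl

theorem inverseSymbol_sub (ξ : Euc n) (z w : LamC n m) :
    inverseSymbol k ξ (z - w) = inverseSymbol k ξ z - inverseSymbol k ξ w := by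
  simp only [inverseSymbol, map_sub, smul_sub]

/-- The operators h and σM are inverse at every frequency; only the scalar |ξ|^{n-k} requires ξ ≠ 0.
-/
theorem applySymbol_inverseSymbol (hmk : m < k) (hkn : k < n) {ξ : Euc n} (hξ : ξ ≠ 0)
    (f : Euc n → LamC n m) : applySymbol k (fun ξ => inverseSymbol k ξ (f ξ)) ξ = f ξ := by
  have h : ((‖ξ‖ ^ (n - k) : ℝ) : ℂ) ≠ 0 :=
    Complex.ofReal_ne_zero.2 (pow_ne_zero _ (norm_ne_zero_iff.2 hξ))
  rw [applySymbol, inverseSymbol, map_smul, endC_symbolH_meanRestr hmk hkn, Complex.ofReal_inv,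
    smul_inv_smul₀ h]

theorem aestronglyMeasurable_inverseSymbol {z : Euc n → LamC n m}
    (hz : AEStronglyMeasurable z volume) :
    AEStronglyMeasurable (fun ξ => inverseSymbol k ξ (z ξ)) volume := by
  have h1 : ∀ s, AEStronglyMeasurable (fun ξ => z ξ s) volume := fun s =>
    (EuclideanSpace.proj s : LamC n m →L[ℂ] ℂ).continuous.comp_aestronglyMeasurable hz
  have h2 : (fun ξ => inverseSymbol k ξ (z ξ)) = fun ξ =>
      WithLp.toLp 2 (fun t => ∑ s, ((sphereVol k / sphereVol n : ℝ) : ℂ) *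
        ((((‖ξ‖ ^ (n - k))⁻¹ : ℝ) : ℂ) * ((meanEntry k t s ξ : ℂ) * z ξ s))) := by
    ext1 ξ
    ext t
    exact inverseSymbol_apply ξ (z ξ) t
  rw [h2]
  refine (PiLp.continuous_toLp 2 _).comp_aestronglyMeasurable
    (aemeasurable_pi_iff.2 fun t => AEStronglyMeasurable.aemeasurable ?_).aestronglyMeasurable
  refine Finset.aestronglyMeasurable_fun_sum _ fun s _ => ?_
  have hm := measurable_meanEntry k t s
  refine aestronglyMeasurable_const.mul (AEStronglyMeasurable.mul ?_
    (AEStronglyMeasurable.mul ?_ (h1 s)))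
  · exact Measurable.aestronglyMeasurable (by fun_prop)
  · exact Measurable.aestronglyMeasurable (by fun_prop)

theorem norm_inverseSymbol_le (k : ℕ) :
    ∃ C : ℝ, 0 ≤ C ∧ ∀ (ξ : Euc n) (z : LamC n m),
      ‖inverseSymbol k ξ z‖ ≤ C * (sqrtWeight k ξ ^ 2 * ‖z‖) := by
  obtain ⟨C, hC0, hC⟩ := norm_meanRestr_le (n := n) m k
  refine ⟨‖((sphereVol k / sphereVol n : ℝ) : ℂ)‖ * C, by positivity, fun ξ z => ?_⟩
  rw [inverseSymbol, norm_smul, norm_smul, Complex.norm_real, Real.norm_of_nonneg (by positivity),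
    sqrtWeight_sq]
  calc _ ≤ (‖ξ‖ ^ (n - k))⁻¹ * (‖((sphereVol k / sphereVol n : ℝ) : ℂ)‖ * (C * ‖z‖)) := by
        gcongr
        exact norm_endC_le hC0 (hC ξ) z
    _ = _ := by ring

theorem lintegral_mul_le_sqrt {Ω : Type*} [MeasurableSpace Ω] {μ : Measure Ω} {f g : Ω → ℝ≥0∞}
    (hf : AEMeasurable f μ) (hg : AEMeasurable g μ) :
    ∫⁻ x, f x * g x ∂μ ≤
      (∫⁻ x, f x ^ 2 ∂μ) ^ (1 / 2 : ℝ) * (∫⁻ x, g x ^ 2 ∂μ) ^ (1 / 2 : ℝ) := by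
  have h := ENNReal.lintegral_mul_le_Lp_mul_Lq μ Real.HolderConjugate.two_two hf hg
  simpa only [ENNReal.rpow_two, Pi.mul_apply] using h

theorem lintegral_sqrtWeight_schwartz_lt_top (hk : 0 < k) (hkn : k ≤ n) (φ : 𝓢(Euc n, ℂ)) :
    ∫⁻ ξ, (‖φ ξ‖ₑ * ‖sqrtWeight k ξ‖ₑ) ^ 2 < ∞ := by
  obtain ⟨-, C, hC0, hC⟩ := (decays_schwartz φ).mul (decays_schwartz φ)
  have hint := (integrable_singular_weight hk hkn).const_mul C
  refine lt_of_le_of_lt (lintegral_mono fun ξ => ?_) hint.lintegral_lt_top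
  have h := hC ξ
  rw [norm_mul] at h
  rw [mul_pow, ← ofReal_norm, ← ofReal_norm, ← ENNReal.ofReal_pow (norm_nonneg _),
    ← ENNReal.ofReal_pow (norm_nonneg _), ← ENNReal.ofReal_mul (by positivity), Real.norm_eq_abs,
    sq_abs, sqrtWeight_sq]
  refine ENNReal.ofReal_le_ofReal ?_
  calc ‖φ ξ‖ ^ 2 * (‖ξ‖ ^ (n - k))⁻¹ ≤ (C * ((1 + ‖ξ‖) ^ (n + 1))⁻¹) * (‖ξ‖ ^ (n - k))⁻¹ := by
        rw [sq]; gcongr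
    _ = _ := by ring

/-- Split |ξ|^{-(n-k)} into two equal halves, one attached to φ and one to z, and use
Cauchy-Schwarz. The half with φ is square integrable because the full singular weight is locally
integrable. -/
theorem lintegral_schwartz_inverseSymbol_le (hk : 0 < k) (hkn : k ≤ n) (φ : 𝓢(Euc n, ℂ)) :
    ∃ C : ℝ≥0∞, C ≠ ∞ ∧ ∀ z : Euc n → LamC n m, AEStronglyMeasurable z volume →
      ∫⁻ ξ, ‖φ ξ • inverseSymbol k ξ (z ξ)‖ₑ ≤
        C * (∫⁻ ξ, ‖(sqrtWeight k ξ : ℂ) • z ξ‖ₑ ^ 2) ^ (1 / 2 : ℝ) := by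
  obtain ⟨C, hC0, hC⟩ := norm_inverseSymbol_le (n := n) (m := m) k
  refine ⟨ENNReal.ofReal C * (∫⁻ ξ, (‖φ ξ‖ₑ * ‖sqrtWeight k ξ‖ₑ) ^ 2) ^ (1 / 2 : ℝ),
    ENNReal.mul_ne_top ENNReal.ofReal_ne_top (ENNReal.rpow_ne_top_of_nonneg (by norm_num)
      (lintegral_sqrtWeight_schwartz_lt_top hk hkn φ).ne), fun z hz => ?_⟩
  have hsw := measurable_sqrtWeight (n := n) k
  have hφ := φ.continuous
  have hm1 : AEMeasurable (fun ξ => ‖φ ξ‖ₑ * ‖sqrtWeight k ξ‖ₑ) volume :=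
    Measurable.aemeasurable (by fun_prop)
  have hm2 : AEMeasurable (fun ξ => ‖(sqrtWeight k ξ : ℂ) • z ξ‖ₑ) volume :=
    ((Complex.measurable_ofReal.comp hsw).aestronglyMeasurable.smul hz).enorm
  calc ∫⁻ ξ, ‖φ ξ • inverseSymbol k ξ (z ξ)‖ₑ
      ≤ ∫⁻ ξ, ENNReal.ofReal C *
        ((‖φ ξ‖ₑ * ‖sqrtWeight k ξ‖ₑ) * ‖(sqrtWeight k ξ : ℂ) • z ξ‖ₑ) := by
        refine lintegral_mono fun ξ => ?_
        simp only [← ofReal_norm]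
        rw [← ENNReal.ofReal_mul (norm_nonneg _), ← ENNReal.ofReal_mul (by positivity),
          ← ENNReal.ofReal_mul hC0]
        refine ENNReal.ofReal_le_ofReal ?_
        rw [norm_smul, norm_smul, Complex.norm_real]
        calc ‖φ ξ‖ * ‖inverseSymbol k ξ (z ξ)‖
            ≤ ‖φ ξ‖ * (C * (‖sqrtWeight k ξ‖ ^ 2 * ‖z ξ‖)) := by
              gcongr
              rw [Real.norm_eq_abs, sq_abs]
              exact hC ξ _
          _ = _ := by ring
    _ = ENNReal.ofReal C * ∫⁻ ξ, (‖φ ξ‖ₑ * ‖sqrtWeight k ξ‖ₑ) *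
        ‖(sqrtWeight k ξ : ℂ) • z ξ‖ₑ := lintegral_const_mul' _ _ ENNReal.ofReal_ne_top
    _ ≤ _ := by
        rw [mul_assoc]
        gcongr
        exact lintegral_mul_le_sqrt hm1 hm2

end Inverse

/-! ### The dual transform on `L²` -/

section Dual

variable {n m k : ℕ}

theorem lintegral_fibre_le (ψ : 𝓢(Euc n, ℂ)) :
    ∃ C : ℝ, 0 ≤ C ∧ ∀ (P : Gr n k) (u : P.plane),
      ∫⁻ y : (P.planeᗮ : Submodule ℝ (Euc n)), ‖ψ (u + y)‖ₑ ≤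
        ENNReal.ofReal C * ‖weight (Taut.of P u)‖ₑ := by
  obtain ⟨C, hC0, hC⟩ := norm_fibreInt_plane_le (k := k) ψ
  refine ⟨C, hC0, fun P u => ?_⟩
  rw [← ofReal_integral_norm_eq_lintegral_enorm (integrable_fibre P.plane ψ u),
    Real.enorm_of_nonneg (weight_nonneg _), ← ENNReal.ofReal_mul hC0]
  exact ENNReal.ofReal_le_ofReal (hC P u)

/-- By Tonelli on G × ℝⁿ and on each fibre, ψ enters only through its fibre integrals, which are
bounded by a multiple of `weight` uniformly in P. As `weight` is square integrable on Γ,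
Cauchy-Schwarz concludes. Thus `ℛ^*` is continuous from L²(Γ) to tempered distributions. -/
theorem lintegral_schwartz_dual_le (ψ : 𝓢(Euc n, ℂ)) :
    ∃ C : ℝ≥0∞, C ≠ ∞ ∧ ∀ G : Taut n k → ℝ≥0∞, Measurable G →
      ∫⁻ x, ‖ψ x‖ₑ * ∫⁻ P : Gr n k, G (Taut.of P (P.plane.orthogonalProjectionOnto x))
          ∂grMeasure n k ≤ C * (∫⁻ p, G p ^ 2 ∂tautMeasure n k) ^ (1 / 2 : ℝ) := by
  obtain ⟨C, hC0, hC⟩ := lintegral_fibre_le (k := k) ψ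
  have hw : ∫⁻ p : Taut n k, ‖weight p‖ₑ ^ 2 ∂tautMeasure n k < ∞ := by
    have h := (memLp_weight n k).eLpNorm_lt_top
    rw [eLpNorm_lt_top_iff_lintegral_rpow_enorm_lt_top (by norm_num) (by norm_num)] at h
    simpa using h
  refine ⟨ENNReal.ofReal C * (∫⁻ p : Taut n k, ‖weight p‖ₑ ^ 2 ∂tautMeasure n k) ^ (1 / 2 : ℝ),
    ENNReal.mul_ne_top ENNReal.ofReal_ne_top
      (ENNReal.rpow_ne_top_of_nonneg (by norm_num) hw.ne), fun G hG => ?_⟩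
  have hψ := ψ.continuous
  have hm : Measurable fun q : Euc n × Gr n k =>
      ‖ψ q.1‖ₑ * G (Taut.of q.2 (q.2.plane.orthogonalProjectionOnto q.1)) :=
    (hψ.measurable.comp measurable_fst).enorm.mul (hG.comp (measurable_tautOf_proj n k))
  have hGm : ∀ x, Measurable fun P : Gr n k =>
      G (Taut.of P (P.plane.orthogonalProjectionOnto x)) := fun x =>
    hG.comp ((measurable_tautOf_proj n k).comp (measurable_const.prodMk measurable_id))
  have hfib : ∀ P : Gr n k, ∫⁻ x, ‖ψ x‖ₑ * G (Taut.of P (P.plane.orthogonalProjectionOnto x)) ≤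
      ∫⁻ u : P.plane, ENNReal.ofReal C * (‖weight (Taut.of P u)‖ₑ * G (Taut.of P u)) := by
    intro P
    rw [lintegral_decomposition P.plane (fun x u => ‖ψ x‖ₑ * G (Taut.of P u))]
    have hmq : Measurable fun q : P.plane × (P.planeᗮ : Submodule ℝ (Euc n)) =>
        ‖ψ ((q.1 : Euc n) + q.2)‖ₑ * G (Taut.of P q.1) := by
      refine Measurable.mul ?_ (hG.comp ((measurable_tautOf P).comp measurable_fst))
      exact (Continuous.measurable (by fun_prop))
    rw [lintegral_prod _ hmq.aemeasurable]
    refine lintegral_mono fun u => ?_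
    have hψu : Measurable fun y : (P.planeᗮ : Submodule ℝ (Euc n)) => ‖ψ ((u : Euc n) + y)‖ₑ :=
      Continuous.measurable (by fun_prop)
    simp only
    rw [lintegral_mul_const _ hψu, ← mul_assoc]
    gcongr
    exact hC P u
  simp only [← lintegral_const_mul _ (hGm _)]
  rw [lintegral_lintegral_swap hm.aemeasurable]
  calc ∫⁻ P : Gr n k, (∫⁻ x, ‖ψ x‖ₑ * G (Taut.of P (P.plane.orthogonalProjectionOnto x)))
        ∂grMeasure n k
      ≤ ∫⁻ P : Gr n k, (∫⁻ u : P.plane, ENNReal.ofReal C *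
        (‖weight (Taut.of P u)‖ₑ * G (Taut.of P u))) ∂grMeasure n k := lintegral_mono hfib
    _ = ∫⁻ p, ENNReal.ofReal C * (‖weight p‖ₑ * G p) ∂tautMeasure n k :=
        (lintegral_tautMeasure (((measurable_weight n k).enorm.mul hG).const_mul _)).symm
    _ = ENNReal.ofReal C * ∫⁻ p, ‖weight p‖ₑ * G p ∂tautMeasure n k :=
        lintegral_const_mul' _ _ ENNReal.ofReal_ne_top
    _ ≤ _ := by
        rw [mul_assoc]
        gcongr
        exact lintegral_mul_le_sqrt (measurable_weight n k).enorm.aemeasurable hG.aemeasurable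

theorem stronglyMeasurable_restr_dual {β : Taut n k → Lam m (Euc n)} (hβ : StronglyMeasurable β) :
    StronglyMeasurable fun q : Euc n × Gr n k =>
      restr m q.2.plane (β (Taut.of q.2 (q.2.plane.orthogonalProjectionOnto q.1))) := by
  have h1 : Continuous fun w : (Lam m (Euc n) →L[ℝ] Lam m (Euc n)) × Lam m (Euc n) => w.1 w.2 :=
    continuous_fst.clm_apply continuous_snd
  exact h1.comp_stronglyMeasurable
    (((continuous_restr n m k).comp continuous_snd).stronglyMeasurable.prodMk
      (hβ.comp_measurable (measurable_tautOf_proj n k)))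

theorem stronglyMeasurable_dualTransform {β : Taut n k → Lam m (Euc n)}
    (hβ : StronglyMeasurable β) : StronglyMeasurable (dualTransform β) :=
  StronglyMeasurable.integral_prod_right (f := fun (x : Euc n) (P : Gr n k) =>
    restr m P.plane (β (Taut.of P (P.plane.orthogonalProjectionOnto x))))
    (stronglyMeasurable_restr_dual hβ)

theorem enorm_restr_le (P : Submodule ℝ (Euc n)) (v : Lam m (Euc n)) : ‖restr m P v‖ₑ ≤ ‖v‖ₑ := by
  rw [enorm_le_iff_norm_le]; exact norm_restr_le P v

theorem lintegral_schwartz_dualTransform_le (ψ : 𝓢(Euc n, ℂ)) :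
    ∃ C : ℝ≥0∞, C ≠ ∞ ∧ ∀ β : Taut n k → Lam m (Euc n), StronglyMeasurable β →
      ∫⁻ x, ‖ψ x • toC n m (dualTransform β x)‖ₑ ≤
        C * (∫⁻ p, ‖β p‖ₑ ^ 2 ∂tautMeasure n k) ^ (1 / 2 : ℝ) := by
  obtain ⟨C, hC, h⟩ := lintegral_schwartz_dual_le (k := k) ψ
  refine ⟨C, hC, fun β hβ => le_trans (lintegral_mono fun x => ?_) (h _ hβ.enorm)⟩
  rw [enorm_smul]
  gcongr
  rw [show ‖toC n m (dualTransform β x)‖ₑ = ‖dualTransform β x‖ₑ by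
    rw [← ofReal_norm, ← ofReal_norm, norm_toC]]
  exact (enorm_integral_le_lintegral_enorm _).trans (lintegral_mono fun P => enorm_restr_le _ _)

theorem integrable_schwartz_dualTransform (ψ : 𝓢(Euc n, ℂ)) {β : Taut n k → Lam m (Euc n)}
    (hβ : StronglyMeasurable β) (hβ2 : ∫⁻ p, ‖β p‖ₑ ^ 2 ∂tautMeasure n k < ∞) :
    Integrable fun x => ψ x • toC n m (dualTransform β x) := by
  obtain ⟨C, hC, h⟩ := lintegral_schwartz_dualTransform_le (m := m) (k := k) ψ
  refine ⟨ψ.continuous.aestronglyMeasurable.smul ((toC n m).continuous.comp_aestronglyMeasurable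
    (stronglyMeasurable_dualTransform hβ).aestronglyMeasurable), ?_⟩
  exact (h β hβ).trans_lt (ENNReal.mul_lt_top hC.lt_top
    (ENNReal.rpow_lt_top_of_nonneg (by norm_num) hβ2.ne))

/-- For general β the integral over G need not converge at every x, where its default value 0 would
break linearity. The preceding bound makes it converge for almost every x with ψ(x) ≠ 0, and where ψ
vanishes the identity is trivial. -/
theorem ae_schwartz_smul_dualTransform_sub (ψ : 𝓢(Euc n, ℂ)) {β γ : Taut n k → Lam m (Euc n)}
    (hβ : StronglyMeasurable β) (hβ2 : ∫⁻ p, ‖β p‖ₑ ^ 2 ∂tautMeasure n k < ∞)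
    (hγ : StronglyMeasurable γ) (hγ2 : ∫⁻ p, ‖γ p‖ₑ ^ 2 ∂tautMeasure n k < ∞) :
    ∀ᵐ x, ψ x • toC n m (dualTransform (β - γ) x) =
      ψ x • toC n m (dualTransform β x) - ψ x • toC n m (dualTransform γ x) := by
  obtain ⟨C, hC, h⟩ := lintegral_schwartz_dual_le (k := k) ψ
  have hfin : ∀ δ : Taut n k → Lam m (Euc n), StronglyMeasurable δ →
      ∫⁻ p, ‖δ p‖ₑ ^ 2 ∂tautMeasure n k < ∞ → ∀ᵐ x, ψ x ≠ 0 → Integrable (fun P : Gr n k =>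
        restr m P.plane (δ (Taut.of P (P.plane.orthogonalProjectionOnto x)))) (grMeasure n k) := by
    intro δ hδ hδ2
    have hm : Measurable fun x => ‖ψ x‖ₑ * ∫⁻ P : Gr n k,
        ‖δ (Taut.of P (P.plane.orthogonalProjectionOnto x))‖ₑ ∂grMeasure n k := by
      refine Measurable.mul ψ.continuous.measurable.enorm ?_
      exact Measurable.lintegral_prod_right' (f := fun q : Euc n × Gr n k =>
        ‖δ (Taut.of q.2 (q.2.plane.orthogonalProjectionOnto q.1))‖ₑ)
        (hδ.enorm.comp (measurable_tautOf_proj n k))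
    have hlt := (h _ hδ.enorm).trans_lt (ENNReal.mul_lt_top hC.lt_top
      (ENNReal.rpow_lt_top_of_nonneg (y := (1 / 2 : ℝ)) (by norm_num) hδ2.ne))
    filter_upwards [ae_lt_top hm hlt.ne] with x hx hψ
    refine ⟨((stronglyMeasurable_restr_dual hδ).comp_measurable
      (measurable_const.prodMk measurable_id)).aestronglyMeasurable, ?_⟩
    refine lt_of_le_of_lt (lintegral_mono fun P => enorm_restr_le _ _) ?_
    exact ENNReal.lt_top_of_mul_ne_top_right hx.ne (enorm_ne_zero.2 hψ)
  filter_upwards [hfin β hβ hβ2, hfin γ hγ hγ2] with x hx1 hx2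
  by_cases hψ : ψ x = 0
  · simp [hψ]
  · have : dualTransform (β - γ) x = dualTransform β x - dualTransform γ x := by
      simp only [dualTransform]
      rw [← integral_sub (hx1 hψ) (hx2 hψ)]
      refine integral_congr_ae (Eventually.of_forall fun P => ?_)
      exact map_sub (restr m P.plane) _ _
    rw [this, map_sub, smul_sub]

end Dual

/-! ### Passage to the completion -/

section Completion

variable {n m k : ℕ}

theorem integrable_schwartz_inverseSymbol (hk : 0 < k) (hkn : k ≤ n) (φ : 𝓢(Euc n, ℂ))
    {z : Euc n → LamC n m} (hz : AEStronglyMeasurable z volume)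
    (hz2 : ∫⁻ ξ, ‖(sqrtWeight k ξ : ℂ) • z ξ‖ₑ ^ 2 < ∞) :
    Integrable fun ξ => φ ξ • inverseSymbol k ξ (z ξ) := by
  obtain ⟨C, hC, h⟩ := lintegral_schwartz_inverseSymbol_le (m := m) hk hkn φ
  refine ⟨φ.continuous.aestronglyMeasurable.smul (aestronglyMeasurable_inverseSymbol hz), ?_⟩
  exact (h z hz).trans_lt (ENNReal.mul_lt_top hC.lt_top
    (ENNReal.rpow_lt_top_of_nonneg (by norm_num) hz2.ne))

theorem lintegral_planeTransform_eq (α : 𝓢(Euc n, Lam m (Euc n))) :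
    ∫⁻ p, ‖planeTransform α p‖ₑ ^ 2 ∂tautMeasure n k = ‖schwartzTransform n m k α‖ₑ ^ 2 := by
  have h := eLpNorm_nnreal_pow_eq_lintegral (μ := tautMeasure n k) (f := planeTransform α)
    (p := 2) two_ne_zero
  simp only [NNReal.coe_ofNat, ENNReal.rpow_ofNat, ENNReal.coe_ofNat] at h
  rw [← h]
  exact congrArg (· ^ 2) (Lp.enorm_toLp (hf := memLp_planeTransform k α)).symm

theorem lintegral_planeTransform_sub_eq (α : 𝓢(Euc n, Lam m (Euc n))) (T : L2Taut n m k) :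
    ∫⁻ p, ‖planeTransform α p - T p‖ₑ ^ 2 ∂tautMeasure n k =
      ‖schwartzTransform n m k α - T‖ₑ ^ 2 := by
  have h := eLpNorm_nnreal_pow_eq_lintegral (μ := tautMeasure n k)
    (f := ⇑(schwartzTransform n m k α - T)) (p := 2) two_ne_zero
  simp only [NNReal.coe_ofNat, ENNReal.rpow_ofNat, ENNReal.coe_ofNat] at h
  rw [Lp.enorm_def, h]
  refine lintegral_congr_ae ?_
  filter_upwards [Lp.coeFn_sub (schwartzTransform n m k α) T,
    (memLp_planeTransform k α).coeFn_toLp] with p hp1 hp2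
  have hp3 : schwartzTransform n m k α p = planeTransform α p := hp2
  rw [hp1, Pi.sub_apply, hp3]

theorem lintegral_coe_lt_top (T : L2Taut n m k) :
    ∫⁻ p, ‖T p‖ₑ ^ 2 ∂tautMeasure n k < ∞ := by
  have h := (Lp.memLp T).eLpNorm_lt_top
  rw [eLpNorm_lt_top_iff_lintegral_rpow_enorm_lt_top (by norm_num) (by norm_num)] at h
  simpa using h

theorem lintegral_planeTransform_lt_top (α : 𝓢(Euc n, Lam m (Euc n))) :
    ∫⁻ p, ‖planeTransform α p‖ₑ ^ 2 ∂tautMeasure n k < ∞ := by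
  rw [lintegral_planeTransform_eq]
  exact ENNReal.pow_lt_top enorm_lt_top

theorem lintegral_sqrtWeight_fourier_lt_top (hmk : m < k) (hkn : k < n)
    (α : 𝓢(Euc n, Lam m (Euc n))) :
    ∫⁻ ξ, ‖(sqrtWeight k ξ : ℂ) • (𝓕 (complexForm α)) ξ‖ₑ ^ 2 < ∞ := by
  obtain ⟨C, hC⟩ := lintegral_sqrtWeight_fourier_le (n := n) hmk hkn
  exact (hC α).trans_lt (ENNReal.mul_lt_top ENNReal.ofReal_lt_top
    (lintegral_planeTransform_lt_top α))

/-- The Fourier transform of `ℛ^*ℛα` for a Schwartz form `α`. -/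
theorem integral_fourier_smul_dualTransform (hmk : m < k) (hkn : k < n)
    (α : 𝓢(Euc n, Lam m (Euc n))) (φ : 𝓢(Euc n, ℂ)) :
    ∫ x, (𝓕 φ) x • toC n m (dualTransform (k := k) (planeTransform α) x) =
      ∫ ξ, φ ξ • inverseSymbol k ξ ((𝓕 (complexForm α)) ξ) := by
  have h1 := integrable_schwartz_dualTransform (k := k) (𝓕 φ)
    (stronglyMeasurable_planeTransform α.continuous) (lintegral_planeTransform_lt_top α)
  have h2 := integrable_schwartz_inverseSymbol (by omega) hkn.le φ
    (𝓕 (complexForm α)).continuous.aestronglyMeasurable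
    (lintegral_sqrtWeight_fourier_lt_top hmk hkn α)
  ext t
  refine ((EuclideanSpace.proj t : LamC n m →L[ℂ] ℂ).integral_comp_comm h1).symm.trans
    (Eq.trans ?_ ((EuclideanSpace.proj t : LamC n m →L[ℂ] ℂ).integral_comp_comm h2))
  simp only [EuclideanSpace.coe_proj, PiLp.smul_apply, smul_eq_mul]
  rw [integral_mul_dualTransform hmk hkn]
  simp only [← integral_const_mul]
  -- Each summand is separately integrable by the polar formula, so the sum over s can be moved
  -- under the integral and compared pointwise.
  rw [← integral_finsetSum _ fun s _ =>
    (integral_restrEntry hmk hkn t s ((decays_schwartz _).mul (decays_schwartz _))).1.const_mul _]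
  refine integral_congr_ae (Eventually.of_forall fun ξ => ?_)
  simp only
  rw [inverseSymbol_apply, Finset.mul_sum]
  refine Finset.sum_congr rfl fun s _ => ?_
  rw [FourierTransform.fourierInv_fourier_eq, fourier_complexForm_apply]
  ring

theorem continuous_form : Continuous (X.form : X n m k → L2Form n m) :=
  (WithLp.prod_continuous_ofLp 2 _ _).fst.comp (X.graph n m k).continuous

theorem continuous_transform : Continuous (X.transform : X n m k → L2Taut n m k) :=
  (WithLp.prod_continuous_ofLp 2 _ _).snd.comp (X.graph n m k).continuous

theorem exists_schwartz_tendsto (a : X n m k) : ∃ α : ℕ → 𝓢(Euc n, Lam m (Euc n)),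
    Tendsto (fun j => (α j).toLp 2 volume) atTop (𝓝 (X.form a)) ∧
      Tendsto (fun j => schwartzTransform n m k (α j)) atTop (𝓝 (X.transform a)) := by
  obtain ⟨u, hu, hua⟩ := mem_closure_iff_seq_limit.1
    (UniformSpace.Completion.denseRange_coe (α := SForm n m k) a)
  choose α hα using hu
  have h1 : ∀ j, X.form (u j) = (SForm.toSchwartz n m k (α j)).toLp 2 volume := fun j => by
    rw [← hα, X.form, X.graph_coe]; rfl
  have h2 : ∀ j, X.transform (u j) = schwartzTransform n m k (SForm.toSchwartz n m k (α j)) :=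
    fun j => by rw [← hα, X.transform, X.graph_coe]; rfl
  refine ⟨fun j => SForm.toSchwartz n m k (α j), ?_, ?_⟩
  · simp only [← h1]
    exact (continuous_form.tendsto a).comp hua
  · simp only [← h2]
    exact (continuous_transform.tendsto a).comp hua

/-- The Fourier transform of a square integrable form. -/
def fourierForm (f : L2Form n m) : Lp (LamC n m) 2 (volume : Measure (Euc n)) :=
  𝓕 ((toC n m).compLp f)

theorem continuous_fourierForm : Continuous (fourierForm : L2Form n m → _) :=
  (FourierTransform.continuous_fourier).comp ((toC n m).compLpL 2 volume).continuous

theorem fourierForm_toLp (α : 𝓢(Euc n, Lam m (Euc n))) :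
    fourierForm (α.toLp 2 volume) = (𝓕 (complexForm α)).toLp 2 volume := by
  rw [fourierForm, ← SchwartzMap.toLp_fourier_eq]
  congr 1

/-- The energy estimate is applied to differences of the approximating forms, and the second index
is sent to infinity by Fatou's lemma. This identifies the limit in the weighted space with the
Fourier transform of the L² form underlying `a`. -/
theorem lintegral_sqrtWeight_fourierForm_sub_le (hmk : m < k) (hkn : k < n) (a : X n m k) :
    ∃ C : ℝ, ∀ α : ℕ → 𝓢(Euc n, Lam m (Euc n)),
      Tendsto (fun j => (α j).toLp 2 volume) atTop (𝓝 (X.form a)) →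
      Tendsto (fun j => schwartzTransform n m k (α j)) atTop (𝓝 (X.transform a)) → ∀ j,
      ∫⁻ ξ, ‖(sqrtWeight k ξ : ℂ) • ((𝓕 (complexForm (α j))) ξ - fourierForm (X.form a) ξ)‖ₑ ^ 2 ≤
        ENNReal.ofReal C * ‖schwartzTransform n m k (α j) - X.transform a‖ₑ ^ 2 := by
  obtain ⟨C, hC⟩ := lintegral_sqrtWeight_fourier_le (n := n) hmk hkn
  refine ⟨C, fun α h1 h2 j => ?_⟩
  have h3 : Tendsto (fun j => (𝓕 (complexForm (α j))).toLp 2 volume) atTop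
      (𝓝 (fourierForm (X.form a))) := by
    simp only [← fourierForm_toLp]
    exact (continuous_fourierForm.tendsto _).comp h1
  -- Convergence in L² gives almost everywhere convergence only along a subsequence, which suffices
  -- for Fatou.
  obtain ⟨ns, hns, hae⟩ := (tendstoInMeasure_of_tendsto_Lp h3).exists_seq_tendsto_ae
  have hae2 : ∀ᵐ ξ, ∀ i, (𝓕 (complexForm (α i))).toLp 2 volume ξ = (𝓕 (complexForm (α i))) ξ :=
    ae_all_iff.2 fun i => (𝓕 (complexForm (α i))).coeFn_toLp 2 volume
  have hsw := measurable_sqrtWeight (n := n) k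
  have hlim : ∀ᵐ ξ, ‖(sqrtWeight k ξ : ℂ) •
      ((𝓕 (complexForm (α j))) ξ - fourierForm (X.form a) ξ)‖ₑ ^ 2 =
      liminf (fun i => ‖(sqrtWeight k ξ : ℂ) •
        ((𝓕 (complexForm (α j))) ξ - (𝓕 (complexForm (α (ns i)))) ξ)‖ₑ ^ 2) atTop := by
    filter_upwards [hae, hae2] with ξ hξ hξ2
    simp only [hξ2] at hξ
    have hc : Continuous fun z : LamC n m => ‖(sqrtWeight k ξ : ℂ) •
        ((𝓕 (complexForm (α j))) ξ - z)‖ₑ ^ 2 := by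
      have : Continuous fun z : LamC n m => ‖(sqrtWeight k ξ : ℂ) •
        ((𝓕 (complexForm (α j))) ξ - z)‖ₑ := by fun_prop
      exact (ENNReal.continuous_pow 2).comp this
    exact ((hc.tendsto _).comp hξ).liminf_eq.symm
  have hdiff : ∀ i, ∫⁻ ξ, ‖(sqrtWeight k ξ : ℂ) •
      ((𝓕 (complexForm (α j))) ξ - (𝓕 (complexForm (α (ns i)))) ξ)‖ₑ ^ 2 ≤
      ENNReal.ofReal C *
        ‖schwartzTransform n m k (α j) - schwartzTransform n m k (α (ns i))‖ₑ ^ 2 := by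
    intro i
    rw [← map_sub, ← lintegral_planeTransform_eq]
    refine le_trans (le_of_eq (lintegral_congr fun ξ => ?_)) (hC (α j - α (ns i)))
    have : complexForm (α j - α (ns i)) = complexForm (α j) - complexForm (α (ns i)) :=
      map_sub _ _ _
    rw [this, show 𝓕 (complexForm (α j) - complexForm (α (ns i))) =
      𝓕 (complexForm (α j)) - 𝓕 (complexForm (α (ns i))) from
      map_sub (FourierTransform.fourierCLM ℂ 𝓢(Euc n, LamC n m)) _ _]
    rfl
  rw [lintegral_congr_ae hlim]
  refine (lintegral_liminf_le' fun i => ?_).trans ?_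
  · have hc1 := (𝓕 (complexForm (α j))).continuous
    have hc2 := (𝓕 (complexForm (α (ns i)))).continuous
    refine AEMeasurable.pow_const ?_ 2
    exact ((Complex.measurable_ofReal.comp hsw).aestronglyMeasurable.smul
      (hc1.sub hc2).aestronglyMeasurable).enorm
  · have hT : Tendsto (fun i => ENNReal.ofReal C *
        ‖schwartzTransform n m k (α j) - schwartzTransform n m k (α (ns i))‖ₑ ^ 2) atTop
        (𝓝 (ENNReal.ofReal C * ‖schwartzTransform n m k (α j) - X.transform a‖ₑ ^ 2)) := by
      refine ENNReal.Tendsto.const_mul ?_ (Or.inr ENNReal.ofReal_ne_top)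
      refine ENNReal.Tendsto.pow ?_
      exact (tendsto_const_nhds.sub (h2.comp hns.tendsto_atTop)).enorm
    rw [← hT.liminf_eq]
    exact liminf_le_liminf (Eventually.of_forall hdiff)

/-- The Fourier transform of `ℛ^*ℛa`. -/
theorem isFourierTransform_dualTransform (hmk : m < k) (hkn : k < n) (a : X n m k) :
    IsFourierTransform (dualTransform (X.transform a))
      fun ξ => inverseSymbol k ξ (fourierForm (X.form a) ξ) := by
  intro φ
  have hk : 0 < k := by omega
  obtain ⟨α, h1, h2⟩ := exists_schwartz_tendsto a
  obtain ⟨C, hC⟩ := lintegral_sqrtWeight_fourierForm_sub_le hmk hkn a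
  have hC := hC α h1 h2
  set f := fourierForm (X.form a)
  set T := X.transform a
  have hTm : StronglyMeasurable T := Lp.stronglyMeasurable T
  have hT2 := lintegral_coe_lt_top T
  have hRm := fun j => stronglyMeasurable_planeTransform (k := k) (α j).continuous
  have hR2 := fun j => lintegral_planeTransform_lt_top (k := k) (α j)
  have hT0 : Tendsto (fun j => ‖schwartzTransform n m k (α j) - T‖ₑ) atTop (𝓝 0) := by
    have := (h2.sub (tendsto_const_nhds (x := T))).enorm
    simpa using this
  have hzm : ∀ j, AEStronglyMeasurable (fun ξ => (𝓕 (complexForm (α j))) ξ - f ξ) volume :=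
    fun j => (𝓕 (complexForm (α j))).continuous.aestronglyMeasurable.sub
      (Lp.aestronglyMeasurable f)
  have hz2 : ∀ j, ∫⁻ ξ, ‖(sqrtWeight k ξ : ℂ) • ((𝓕 (complexForm (α j))) ξ - f ξ)‖ₑ ^ 2 < ∞ :=
    fun j => (hC j).trans_lt (ENNReal.mul_lt_top ENNReal.ofReal_lt_top
      (ENNReal.pow_lt_top enorm_lt_top))
  have hgj : ∀ j, Integrable fun ξ => φ ξ • inverseSymbol k ξ ((𝓕 (complexForm (α j))) ξ) :=
    fun j => integrable_schwartz_inverseSymbol hk hkn.le φ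
      (𝓕 (complexForm (α j))).continuous.aestronglyMeasurable
      (lintegral_sqrtWeight_fourier_lt_top hmk hkn (α j))
  have hgd : ∀ j, Integrable fun ξ => φ ξ • inverseSymbol k ξ ((𝓕 (complexForm (α j))) ξ - f ξ) :=
    fun j => integrable_schwartz_inverseSymbol hk hkn.le φ (hzm j) (hz2 j)
  have hsub : ∀ j ξ, φ ξ • inverseSymbol k ξ ((𝓕 (complexForm (α j))) ξ) -
      φ ξ • inverseSymbol k ξ (f ξ) =
      φ ξ • inverseSymbol k ξ ((𝓕 (complexForm (α j))) ξ - f ξ) := fun j ξ => by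
    rw [inverseSymbol_sub, smul_sub]
  -- Integrability for the limit follows from that of one approximation and of its distance to the
  -- limit.
  have hg : Integrable fun ξ => φ ξ • inverseSymbol k ξ (f ξ) := by
    refine ((hgj 0).sub (hgd 0)).congr (Eventually.of_forall fun ξ => ?_)
    simp only [Pi.sub_apply, ← hsub, sub_sub_cancel]
  have hL := integrable_schwartz_dualTransform (𝓕 φ) hTm hT2
  have hLj := fun j => integrable_schwartz_dualTransform (𝓕 φ) (hRm j) (hR2 j)
  refine ⟨hL, hg, ?_⟩
  have hlim1 : Tendsto (fun j => ∫ ξ, φ ξ • inverseSymbol k ξ ((𝓕 (complexForm (α j))) ξ)) atTop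
      (𝓝 (∫ ξ, φ ξ • inverseSymbol k ξ (f ξ))) := by
    refine tendsto_integral_of_L1 _ hg.aestronglyMeasurable (Eventually.of_forall hgj) ?_
    obtain ⟨D, hD, hDle⟩ := lintegral_schwartz_inverseSymbol_le (m := m) hk hkn.le φ
    simp only [hsub]
    refine tendsto_of_tendsto_of_tendsto_of_le_of_le tendsto_const_nhds ?_ (fun _ => zero_le)
      fun j => (hDle _ (hzm j)).trans (mul_le_mul_right (ENNReal.rpow_le_rpow (hC j)
        (by norm_num)) D)
    have h0 : Tendsto (fun j => D * (ENNReal.ofReal C *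
        ‖schwartzTransform n m k (α j) - T‖ₑ ^ 2) ^ (1 / 2 : ℝ)) atTop
        (𝓝 (D * (ENNReal.ofReal C * 0 ^ 2) ^ (1 / 2 : ℝ))) :=
      ENNReal.Tendsto.const_mul (Filter.Tendsto.ennrpow_const _ (ENNReal.Tendsto.const_mul
        (ENNReal.Tendsto.pow hT0) (Or.inr ENNReal.ofReal_ne_top))) (Or.inr hD)
    simpa using h0
  have hlim2 : Tendsto (fun j => ∫ x, (𝓕 φ) x • toC n m
      (dualTransform (k := k) (planeTransform (α j)) x)) atTop
      (𝓝 (∫ x, (𝓕 φ) x • toC n m (dualTransform T x))) := by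
    refine tendsto_integral_of_L1 _ hL.aestronglyMeasurable (Eventually.of_forall hLj) ?_
    obtain ⟨D, hD, hDle⟩ := lintegral_schwartz_dualTransform_le (m := m) (k := k) (𝓕 φ)
    refine tendsto_of_tendsto_of_tendsto_of_le_of_le tendsto_const_nhds ?_ (fun _ => zero_le)
      (h := fun j => D * (‖schwartzTransform n m k (α j) - T‖ₑ ^ 2) ^ (1 / 2 : ℝ)) fun j => ?_
    · have h0 : Tendsto (fun j => D * (‖schwartzTransform n m k (α j) - T‖ₑ ^ 2) ^ (1 / 2 : ℝ))
          atTop (𝓝 (D * (0 ^ 2) ^ (1 / 2 : ℝ))) :=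
        ENNReal.Tendsto.const_mul (Filter.Tendsto.ennrpow_const _ (ENNReal.Tendsto.pow hT0))
          (Or.inr hD)
      simpa using h0
    · refine le_trans (le_of_eq (lintegral_congr_ae ?_))
        ((hDle (planeTransform (α j) - ⇑T) ((hRm j).sub hTm)).trans_eq ?_)
      · filter_upwards [ae_schwartz_smul_dualTransform_sub (𝓕 φ) (hRm j) (hR2 j) hTm hT2]
          with x hx
        rw [hx]
      · simp only [← lintegral_planeTransform_sub_eq]
        rfl
  -- The identity for Schwartz forms makes the two convergent sequences equal term by term, so their
  -- limits agree.
  simp only [integral_fourier_smul_dualTransform hmk hkn] at hlim2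
  exact tendsto_nhds_unique hlim2 hlim1

/-! ### Uniqueness of the distributional Fourier transform -/

theorem locallyIntegrable_of_schwartz_smul {g : Euc n → LamC n m}
    (hg : ∀ φ : 𝓢(Euc n, ℂ), Integrable fun ξ => φ ξ • g ξ) : LocallyIntegrable g volume := by
  refine (locallyIntegrable_iff).2 fun K hK => ?_
  obtain ⟨R, hR⟩ := hK.isBounded.subset_closedBall (0 : Euc n)
  -- The maximum with 1 keeps the inner radius positive whatever R is.
  let χ : ContDiffBump (0 : Euc n) := ⟨max R 1, max R 1 + 1, by positivity, by linarith⟩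
  let φ : 𝓢(Euc n, ℂ) := HasCompactSupport.toSchwartzMap (f := fun x => (χ x : ℂ))
    (χ.hasCompactSupport.comp_left Complex.ofReal_zero)
    (Complex.ofRealCLM.contDiff.comp χ.contDiff)
  refine ((hg φ).integrableOn (s := K)).congr_fun (fun x hx => ?_) hK.measurableSet
  have h1 : χ x = 1 := χ.one_of_mem_closedBall
    (Metric.closedBall_subset_closedBall (le_max_left R 1) (hR hx))
  change ((χ x : ℝ) : ℂ) • g x = g x
  rw [h1, Complex.ofReal_one, one_smul]

/-- Smooth functions of compact support are Schwartz functions and determine a locally integrable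
function almost everywhere. This makes the multiplier independent of the choice hidden in its
definition. -/
theorem IsFourierTransform.ae_eq {γ : Euc n → Lam m (Euc n)} {g g' : Euc n → LamC n m}
    (h : IsFourierTransform γ g) (h' : IsFourierTransform γ g') : g =ᵐ[volume] g' := by
  refine ae_eq_of_integral_contDiff_smul_eq
    (locallyIntegrable_of_schwartz_smul fun φ => (h φ).2.1)
    (locallyIntegrable_of_schwartz_smul fun φ => (h' φ).2.1) fun χ hχ hχc => ?_
  let φ : 𝓢(Euc n, ℂ) := HasCompactSupport.toSchwartzMap (f := fun x => (χ x : ℂ))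
    (hχc.comp_left Complex.ofReal_zero) (Complex.ofRealCLM.contDiff.comp hχ)
  have hφ : ∀ (x : Euc n) (z : LamC n m), χ x • z = φ x • z := fun x z =>
    RCLike.real_smul_eq_coe_smul (K := ℂ) (χ x) z
  simp only [hφ]
  exact (h φ).2.2.symm.trans (h' φ).2.2

end Completion

end KPlane

/-! ### The inversion formula -/

theorem theorem2 (n m k : ℕ) (hmk : m < k) (hkn : k < n) (a : KPlane.X n m k) :
    ∃ hγ : KPlane.InDomQ k (KPlane.dualTransform (KPlane.X.transform a)),
      KPlane.multiplierQ k (KPlane.dualTransform (KPlane.X.transform a)) hγ =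
        (KPlane.toC n m).compLp (KPlane.X.form a) := by
  have hft := KPlane.isFourierTransform_dualTransform hmk hkn a
  -- Positive dimension makes Lebesgue measure free of atoms, so the frequency 0, where the symbol
  -- cannot be inverted, is negligible.
  have hn : Nontrivial (KPlane.Euc n) :=
    Module.nontrivial_of_finrank_pos (R := ℝ) (by rw [finrank_euclideanSpace_fin]; omega)
  have hsymb : ∀ g : KPlane.Euc n → KPlane.LamC n m,
      g =ᵐ[volume] (fun ξ => KPlane.inverseSymbol k ξ (KPlane.fourierForm (KPlane.X.form a) ξ)) →
      KPlane.applySymbol k g =ᵐ[volume] KPlane.fourierForm (KPlane.X.form a) := by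
    intro g hg
    filter_upwards [hg, compl_mem_ae_iff.2 (measure_singleton (0 : KPlane.Euc n))] with ξ h1 h2
    rw [← KPlane.applySymbol_inverseSymbol hmk hkn h2 (KPlane.fourierForm (KPlane.X.form a)),
      KPlane.applySymbol, h1]
    rfl
  have hγ : KPlane.InDomQ k (KPlane.dualTransform (KPlane.X.transform a)) :=
    ⟨_, hft, (Lp.memLp (KPlane.fourierForm (KPlane.X.form a))).ae_eq
      (hsymb _ EventuallyEq.rfl).symm⟩
  refine ⟨hγ, ?_⟩
  -- The chosen Fourier transform agrees almost everywhere with the explicit one by uniqueness, so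
  -- the symbol carries it to the Fourier transform of the form underlying `a`.
  have h1 : hγ.choose_spec.2.toLp (KPlane.applySymbol k hγ.choose) =
      KPlane.fourierForm (KPlane.X.form a) := by
    refine Lp.ext (hγ.choose_spec.2.coeFn_toLp.trans ?_)
    exact hsymb _ (hγ.choose_spec.1.ae_eq hft)
  rw [KPlane.multiplierQ, h1, KPlane.fourierForm, FourierTransform.fourierInv_fourier_eq]
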